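/- **Model.** Let $\mu$ be a probability measure on $\mathbb R$ that is integrable ($\int|h|\,d\mu<\infty$), symmetric about $0$ and different from the point mass at $0$; let $h\sim\mu$. For $S\subset\{1,\dots,n\}$ with $|S|=k$ and $\theta\in\mathbb R$, let $\mathbb P_S$ be the law of $\sigma\in\{-1,1\}^n$ obtained by drawing an unobserved field $\mathbf h=(h_1,\dots,h_n)$ with i.i.d. coordinates of law $\mu$ and then $\sigma$ with probability proportional to $$\exp\Big(\frac{\theta}{2k}\Big(\sum_{i\in S}\sigma_i\Big)^2+\sum_{i=1}^n h_i\sigma_i\Big).$$ Let $\mathbb P_0$ be the same law without interaction ($\theta=0$). One observes $m$ independent copies $\sigma^{(1)},\dots,\sigma^{(m)}$ (each with its own field). Write $m_S=\frac1k\sum_{i\in S}\sigma_i$. **Critical temperature.** Assume $\theta=1/\mathbb E[\operatorname{sech}^2(h)]$, and that $0$ is the unique global minimum of $H(x)=\frac{x^2}{2}-\mathbb E[\log\cosh(\sqrt{\theta}\,x+h)]$ with flatness $\tau\in\mathbb N$, that is, $H(x)=H(0)+\frac{H^{(2\tau)}(0)}{(2\tau)!}x^{2\tau}+O(x^{2\tau+1})$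 as $x\to0$ with $H^{(2\tau)}(0)>0$. Put $$\mathcal V=\frac{((2\tau-1)!)^2\,\theta^{2\tau}\,\operatorname{Var}(\tanh h)\,(\mathbb E[\operatorname{sech}^2 h])^{4\tau-2}}{(H^{(2\tau)}(0))^2},\qquad L=\frac{(2\mathcal V)^{\frac1{2\tau-1}}\,\Gamma\big(\frac{2\tau+1}{4\tau-2}\big)}{\sqrt\pi}.$$ **Tests.** For a threshold $t$, the local test rejects when $\phi_{\rm loc}\ge t$ and the global test rejects when $\phi_{\rm glob}\ge t$, where $$\phi_{\rm loc}=\sup_{|S|=k}k^{\frac1{2\tau-1}}\frac1m\sum_{j=1}^m\big(m_S^{(j)}\big)^2,\qquad \phi_{\rm glob}=k^{-\frac{4\tau-3}{2\tau-1}}\Big(\frac1m\sum_{j=1}^m\Big(\sum_{i=1}^n\sigma_i^{(j)}\Big)^2-n\Big).$$ The risk of a test is its Type I error under $\mathbb P_0$ plus its Type II error under $\mathbb P_S$, the worst case over $|S|=k$. **Theorem.** All constants below may depend on $\mu$ (hence on $\theta,\tau$) and on the quantities quantified before them, but not on $n,k,m,S$. 1. $L>0$ and $L=\dfrac{\int_{\mathbb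 R}x^{2\tau}e^{-x^{4\tau-2}/(2\mathcal V)}dx}{\int_{\mathbb R}x^{2\tau-2}e^{-x^{4\tau-2}/(2\mathcal V)}dx}$; and $\mathbb E_S\big[k^{\frac1{2\tau-1}}m_S^2\big]\to L$ as $k\to\infty$, uniformly in $n\ge k$ and $|S|=k$. 2. (Local test.) For every $t\in(0,L)$ there is $C>0$ such that for every $\delta>0$ there is $K$ such that, whenever $n\ge k\ge K$ and $m\ge C\,k^{\frac1{2\tau-1}}\log n$, the local test with threshold $t$ has risk at most $\delta$. 3. (Global test.) For every $t\in(0,L)$, $A>0$ and $\delta>0$ there are $C>0$ and $K$ such that, whenever $n\ge k\ge K$, the global test with threshold $t$ has risk at most $\delta$ if either $k\le A\,n^{\frac{2\tau-1}{4\tau-3}}$ and $m\ge C\,n^2k^{-\frac{2(4\tau-3)}{2\tau-1}}$, or $k\ge A\,n^{\frac{2\tau-1}{4\tau-3}}$ and $m\ge C$. -/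

import Mathlib

open MeasureTheory ProbabilityTheory Filter Topology Asymptotics

noncomputable section

namespace RFCW

/-- The value `±1` of a spin. -/
def spin (b : Bool) : ℝ := if b then 1 else -1

/-- The magnetization `m_S = |S|⁻¹ ∑_{i ∈ S} σ_i`. -/
def mag {n : ℕ} (S : Finset (Fin n)) (σ : Fin n → Bool) : ℝ :=
  (∑ i ∈ S, spin (σ i)) / (S.card : ℝ)

/-- The Gibbs weight `exp ((θ / (2 |S|)) (∑_{i ∈ S} σ_i)² + ∑_i h_i σ_i)` of the planted random
field Curie-Weiss model with clique `S` and external field `h`. -/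
def gibbsWeight {n : ℕ} (θ : ℝ) (S : Finset (Fin n)) (h : Fin n → ℝ) (σ : Fin n → Bool) : ℝ :=
  Real.exp (θ / (2 * (S.card : ℝ)) * (∑ i ∈ S, spin (σ i)) ^ 2 + ∑ i, h i * spin (σ i))

/-- The conditional probability of `σ` given the external field `h`. -/
def gibbsProb {n : ℕ} (θ : ℝ) (S : Finset (Fin n)) (h : Fin n → ℝ) (σ : Fin n → Bool) : ℝ :=
  gibbsWeight θ S h σ / ∑ σ' : Fin n → Bool, gibbsWeight θ S h σ'

/-- The law of one observed spin vector: the field has i.i.d. coordinates of law `μ`, it is not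
observed, and given the field the spins follow the Gibbs measure. -/
def plantedLaw {n : ℕ} (μ : Measure ℝ) (θ : ℝ) (S : Finset (Fin n)) : Measure (Fin n → Bool) :=
  ∑ σ : Fin n → Bool,
    (∫⁻ h, ENNReal.ofReal (gibbsProb θ S h σ) ∂(Measure.pi fun _ : Fin n => μ)) • Measure.dirac σ

/-- The law of one observed spin vector under the null hypothesis: there is no interaction
(`θ = 0`, for which the choice of the set is irrelevant). -/
def nullLaw (n : ℕ) (μ : Measure ℝ) : Measure (Fin n → Bool) :=
  plantedLaw μ 0 (∅ : Finset (Fin n))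

/-- The law of `m` independent observations (each with its own independent field). -/
def sampleLaw {n : ℕ} (m : ℕ) (P : Measure (Fin n → Bool)) : Measure (Fin m → Fin n → Bool) :=
  Measure.pi fun _ : Fin m => P

/-- `E[sech²(h)]` for `h` of law `μ`. -/
def meanSechSq (μ : Measure ℝ) : ℝ := ∫ h, (1 / Real.cosh h) ^ 2 ∂μ

/-- The population function `x ↦ x² / 2 - E[log cosh (√θ x + h)]`. -/
def potential (μ : Measure ℝ) (θ : ℝ) (x : ℝ) : ℝ :=
  x ^ 2 / 2 - ∫ h, Real.log (Real.cosh (Real.sqrt θ * x + h)) ∂μ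

/-- `0` is the unique global minimum of `H`, with flatness `τ`:
`H x = H 0 + H^{(2τ)}(0) / (2τ)! * x^{2τ} + O(x^{2τ+1})` as `x → 0`, with `H^{(2τ)}(0) > 0`. -/
def HasFlatMinimum (H : ℝ → ℝ) (τ : ℕ) : Prop :=
  (∀ x : ℝ, x ≠ 0 → H 0 < H x) ∧
  0 < iteratedDeriv (2 * τ) H 0 ∧
  (fun x : ℝ => H x - H 0 - iteratedDeriv (2 * τ) H 0 / (Nat.factorial (2 * τ) : ℝ) * x ^ (2 * τ))
    =O[𝓝 0] (fun x : ℝ => x ^ (2 * τ + 1))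

/-- The limiting variance of `(k^{1/(4τ-2)} m_S)^{2τ-1}`. -/
def critVar (μ : Measure ℝ) (θ : ℝ) (τ : ℕ) : ℝ :=
  (Nat.factorial (2 * τ - 1) : ℝ) ^ 2 * θ ^ (2 * τ) * variance Real.tanh μ
      * meanSechSq μ ^ (4 * τ - 2)
    / iteratedDeriv (2 * τ) (potential μ θ) 0 ^ 2

/-- `(2V)^{1/(2τ-1)} Γ((2τ+1)/(4τ-2)) / √π`. -/
def critMoment (μ : Measure ℝ) (θ : ℝ) (τ : ℕ) : ℝ :=
  (2 * critVar μ θ τ) ^ (1 / (2 * (τ : ℝ) - 1))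
    * Real.Gamma ((2 * (τ : ℝ) + 1) / (4 * (τ : ℝ) - 2)) / Real.sqrt Real.pi

/-- The local statistic
`sup_{|S| = k} k^{1/(2τ-1)} * (1/m) ∑_j (m_S^{(j)})²`; the local test rejects when it is at
least the threshold. -/
def localStat (τ k : ℕ) {n m : ℕ} (x : Fin m → Fin n → Bool) : ℝ :=
  ⨆ S : {S : Finset (Fin n) // S.card = k},
    (k : ℝ) ^ (1 / (2 * (τ : ℝ) - 1)) * ((∑ j, mag S.1 (x j) ^ 2) / (m : ℝ))

/-- The global statistic
`k^{-(4τ-3)/(2τ-1)} * ((1/m) ∑_j (∑_i σ_i^{(j)})² - n)`; the global test rejects when it is at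
least the threshold. -/
def globalStat (τ k : ℕ) {n m : ℕ} (x : Fin m → Fin n → Bool) : ℝ :=
  (k : ℝ) ^ (-((4 * (τ : ℝ) - 3) / (2 * (τ : ℝ) - 1)))
    * ((∑ j, (∑ i, spin (x j i)) ^ 2) / (m : ℝ) - (n : ℝ))

/-- The sum of the Type I error and of the Type II error against the clique `S`, for the test
based on `m` observations that rejects the null hypothesis when `φ ≥ t`. -/
def errorSum {n m : ℕ} (μ : Measure ℝ) (θ : ℝ) (S : Finset (Fin n))
    (φ : (Fin m → Fin n → Bool) → ℝ) (t : ℝ) : ℝ :=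
  (sampleLaw m (nullLaw n μ)).real {x | t ≤ φ x}
    + (sampleLaw m (plantedLaw μ θ S)).real {x | φ x < t}

end RFCW

end

noncomputable section

namespace RFCW

/-! ### Laplace asymptotics for perturbed even monomials -/

/-! Write k = |S|, p = τ - 1 and H = `potential μ θ`. Linearizing the squared spin sum by a Gaussian
variable (Hubbard–Stratonovich) shows that, given the field, √θ m_S plus an independent centred
Gaussian of variance 1/k has density proportional to exp(-F), where F = `fieldEnergy θ S h`. Moments
of m_S thus become ratios of one-dimensional integrals.

Since log cosh(s + a) - log cosh a = log cosh s + log(1 + tanh s tanh a), the field enters F only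
through the bounded variables tanh h_i. The mean part of F is k (H - H(0)); the fluctuation is a
linear tilt -tanh(√θ x) ∑ tanh h_i plus an error of order x² √(k U). Here U = `disorder` is a
geometrically weighted sum of squared fluctuations of all powers of tanh h_i, and its mean is
bounded uniformly in S.

Put k = l^(4p+2) and x = y/l. Flatness of order 2τ and the central limit scale of W = k^(-1/2) ∑
tanh h_i then balance: F ≈ l^(2p) (c y^(2p+2) - √θ W y), with c the flatness coefficient.
Criticality forces τ ≥ 2 (`two_le_flatness`), so the prefactor diverges and Laplace's method
(`exists_second_moment_scale`) concentrates y at the critical point v, (2p+2) c v^(2p+1) = √θ W.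
Hence l² m_S² has conditional mean close to v²/θ, a power of |W|. Since W is asymptotically Gaussian
(`exists_clt_bound`), the mean tends to a fractional absolute moment of a Gaussian, which is L
(`integral_critSq`). A fourth moment bound linear in U (`exists_fourth_moment_bound`) controls
fields with large U, where Laplace's method is not uniform, and supplies the variances needed for
the tests.

For the tests, symmetry of μ makes the spins off S exchangeable with random signs; with S empty the
null law is uniform on sign vectors. Under the null hypothesis, k m_T² has a bounded exponential
moment for each T, so Chernoff and a union bound over at most n^k sets handle the local test. The
global statistic is handled by Chebyshev, its excess over n having mean E(∑_S σ)² - k. Type II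
errors follow from Chebyshev and the two moment results. -/

lemma bregman_pow_pos (p : ℕ) {y v : ℝ} (h : y ≠ v) :
    0 < y ^ (2 * p + 2) - v ^ (2 * p + 2) - (2 * p + 2 : ℝ) * v ^ (2 * p + 1) * (y - v) := by
  have hconv : StrictConvexOn ℝ Set.univ (fun x : ℝ => x ^ (2 * p + 2)) :=
    Even.strictConvexOn_pow ⟨p + 1, by ring⟩ (by omega)
  have hd : HasDerivAt (fun x : ℝ => x ^ (2 * p + 2)) ((2 * p + 2 : ℝ) * v ^ (2 * p + 1)) v := by
    have := hasDerivAt_pow (2 * p + 2) v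
    simpa using this
  rcases lt_or_gt_of_ne h with h | h
  · have := hconv.slope_lt_of_hasDerivAt (Set.mem_univ y) (Set.mem_univ v) h hd
    rw [slope_def_field, div_lt_iff₀ (by linarith)] at this
    linarith
  · have := hconv.lt_slope_of_hasDerivAt (Set.mem_univ v) (Set.mem_univ y) h hd
    rw [slope_def_field, lt_div_iff₀ (by linarith)] at this
    linarith

lemma pow_four_le_add_one_pow (p : ℕ) (hp : 1 ≤ p) (y : ℝ) : y ^ 4 ≤ y ^ (2 * p + 2) + 1 := by
  have e1 : y ^ 4 = (y ^ 2) ^ 2 := by ring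
  have e2 : y ^ (2 * p + 2) = (y ^ 2) ^ (p + 1) := by rw [← pow_mul]; ring_nf
  rw [e1, e2]
  have h0 : 0 ≤ y ^ 2 := sq_nonneg y
  rcases le_total 1 (y ^ 2) with h | h
  · have := pow_le_pow_right₀ h (show 2 ≤ p + 1 by omega)
    linarith
  · have h1 : (y ^ 2) ^ 2 ≤ 1 := pow_le_one₀ h0 h
    have := pow_nonneg h0 (p + 1)
    linarith

lemma mul_exp_neg_two_mul_le (z : ℝ) : z * Real.exp (-(2 * z)) ≤ Real.exp (-z) := by
  have h1 : z ≤ Real.exp z := by linarith [Real.add_one_le_exp z]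
  calc z * Real.exp (-(2 * z)) ≤ Real.exp z * Real.exp (-(2 * z)) :=
        mul_le_mul_of_nonneg_right h1 (Real.exp_pos _).le
    _ = Real.exp (-z) := by rw [← Real.exp_add]; ring_nf

lemma integrable_exp_neg_mul_pow_four {b : ℝ} (hb : 0 < b) :
    Integrable (fun y : ℝ => Real.exp (-(b * y ^ 4))) := by
  refine Integrable.mono' ((integrable_exp_neg_mul_sq hb).const_mul (Real.exp b))
    (by fun_prop) (ae_of_all _ fun y => ?_)
  rw [Real.norm_eq_abs, abs_of_pos (Real.exp_pos _), ← Real.exp_add]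
  apply Real.exp_le_exp.2
  nlinarith [mul_nonneg hb.le (sq_nonneg (y ^ 2 - 1)), mul_nonneg hb.le (sq_nonneg y)]

/-- By AM–GM, the sum of exp(-e(y)) and exp(-e(-y)) is at least 2 exp(-(e(y) + e(-y))/2), which
dominates a Gaussian of variance 1/N². Symmetrizing removes any linear tilt, so the bound does not
see the size of the disorder. -/
lemma inv_le_integral_exp_neg {N : ℝ} (hN : 1 ≤ N) {e : ℝ → ℝ}
    (hint : Integrable fun y => Real.exp (-e y))
    (hsym : ∀ y, e y + e (-y) ≤ N ^ 2 * y ^ 2) :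
    1 / N ≤ ∫ y, Real.exp (-e y) := by
  have hN0 : 0 < N := by linarith
  have hg : ∫ y : ℝ, Real.exp (-(N ^ 2 / 2) * y ^ 2) = √(Real.pi / (N ^ 2 / 2)) :=
    integral_gaussian _
  have hneg : ∫ y, Real.exp (-e (-y)) = ∫ y, Real.exp (-e y) :=
    integral_neg_eq_self (fun y => Real.exp (-e y)) volume
  have hintn : Integrable fun y => Real.exp (-e (-y)) := hint.comp_neg
  have hle : ∫ y : ℝ, Real.exp (-(N ^ 2 / 2) * y ^ 2) ≤
      ∫ y, (1 / 2 : ℝ) * (Real.exp (-e y) + Real.exp (-e (-y))) := by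
    apply integral_mono (integrable_exp_neg_mul_sq (by positivity))
      ((hint.add hintn).const_mul _)
    intro y
    have h1 : Real.exp (-(N ^ 2 / 2) * y ^ 2) ≤ Real.exp (-(e y) / 2) * Real.exp (-(e (-y)) / 2) := by
      rw [← Real.exp_add]
      apply Real.exp_le_exp.2
      linarith [hsym y]
    have e1 : Real.exp (-e y) = Real.exp (-(e y) / 2) ^ 2 := by
      rw [← Real.exp_nat_mul]; congr 1; push_cast; ring
    have e2 : Real.exp (-e (-y)) = Real.exp (-(e (-y)) / 2) ^ 2 := by
      rw [← Real.exp_nat_mul]; congr 1; push_cast; ring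
    simp only [Pi.add_apply]
    rw [e1, e2]
    nlinarith [sq_nonneg (Real.exp (-(e y) / 2) - Real.exp (-(e (-y)) / 2))]
  rw [integral_const_mul, integral_add hint hintn, hneg, hg] at hle
  have h3 : 1 / N ≤ √(Real.pi / (N ^ 2 / 2)) := by
    apply Real.le_sqrt_of_sq_le
    rw [div_pow, one_pow, div_le_div_iff₀ (by positivity) (by positivity)]
    nlinarith [Real.pi_gt_three, sq_nonneg N]
  linarith

/-- The energy `e`, at scale `l` and with disorder of size `u`, dominates an even monomial in the
bulk, is at least quadratic outside, and is at most quadratic after symmetrization. -/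
structure EnergyBounds (p : ℕ) (c C R l u : ℝ) (e : ℝ → ℝ) : Prop where
  cont : Continuous e
  bulk : ∀ y, |y| ≤ R * l → l ^ (2 * p) * (c * y ^ (2 * p + 2) - C * u * |y|) ≤ e y
  tail : ∀ y, R * l ≤ |y| → (l ^ (2 * p)) ^ 2 * y ^ 2 / 4 ≤ e y
  symm : ∀ y, e y + e (-y) ≤ (l ^ (2 * p)) ^ 2 * y ^ 2

/-- Young's inequality absorbs the tilt C u |y| into the monomial at a cost of order u². As 2p + 2 ≥
4, a quartic is enough for integrability and for the fourth moment. -/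
lemma EnergyBounds.quartic {p : ℕ} (hp : 1 ≤ p) {c C R l u : ℝ} (hc : 0 < c)
    (hl : 1 ≤ l) (hu : 1 ≤ u) {e : ℝ → ℝ} (he : EnergyBounds p c C R l u e) {y : ℝ}
    (hy : |y| ≤ R * l) :
    l ^ (2 * p) * (c / 2 * y ^ 4 - (2 * c + C ^ 2 / c) * u ^ 2) ≤ e y := by
  refine le_trans ?_ (he.bulk y hy)
  have hN : 0 < l ^ (2 * p) := by positivity
  apply mul_le_mul_of_nonneg_left _ hN.le
  have h1 := pow_four_le_add_one_pow p hp y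
  have h2 : C * u * |y| ≤ C ^ 2 / c * u ^ 2 + c / 4 * y ^ 2 := by
    have : 0 ≤ (C * u / c - |y| / 2) ^ 2 * c := by positivity
    have e1 : (C * u / c - |y| / 2) ^ 2 * c
        = C ^ 2 / c * u ^ 2 + c / 4 * |y| ^ 2 - C * u * |y| := by field_simp; ring
    rw [e1, sq_abs] at this; linarith
  have h3 : y ^ 2 ≤ y ^ 4 + 1 := by nlinarith [sq_nonneg (y ^ 2 - 1), sq_nonneg (y ^ 2)]
  have h4 : 1 ≤ u ^ 2 := one_le_pow₀ hu
  nlinarith [mul_le_mul_of_nonneg_left h1 hc.le, mul_le_mul_of_nonneg_left h3 hc.le,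
    mul_le_mul_of_nonneg_left h4 hc.le]

lemma EnergyBounds.integrable {p : ℕ} (hp : 1 ≤ p) {c C R l u : ℝ} (hc : 0 < c)
    (hl : 1 ≤ l) (hu : 1 ≤ u) {e : ℝ → ℝ} (he : EnergyBounds p c C R l u e) :
    Integrable fun y => Real.exp (-e y) := by
  have hN : 1 ≤ l ^ (2 * p) := one_le_pow₀ hl
  set N := l ^ (2 * p) with hNdef
  set B := (2 * c + C ^ 2 / c) * u ^ 2
  have hcont := he.cont
  refine Integrable.mono' (((integrable_exp_neg_mul_pow_four (half_pos hc)).const_mul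
    (Real.exp (N * B))).add (integrable_exp_neg_mul_sq (b := 1 / 4) (by norm_num)))
    (by fun_prop) (ae_of_all _ fun y => ?_)
  rw [Real.norm_eq_abs, abs_of_pos (Real.exp_pos _), Pi.add_apply]
  rcases le_total |y| (R * l) with h | h
  · have h1 := he.quartic hp hc hl hu h
    have h2 : Real.exp (-e y) ≤ Real.exp (N * B) * Real.exp (-(c / 2 * y ^ 4)) := by
      rw [← Real.exp_add]
      apply Real.exp_le_exp.2
      have : 0 ≤ (N - 1) * (c / 2 * y ^ 4) := by
        apply mul_nonneg <;> [linarith; positivity]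
      nlinarith
    linarith [Real.exp_pos (-(1 / 4) * y ^ 2)]
  · have h1 := he.tail y h
    have h2 : Real.exp (-e y) ≤ Real.exp (-(1 / 4) * y ^ 2) := by
      apply Real.exp_le_exp.2
      have : 0 ≤ (N ^ 2 - 1) * y ^ 2 := by
        apply mul_nonneg _ (sq_nonneg _)
        nlinarith
      nlinarith
    have : 0 < Real.exp (N * B) * Real.exp (-(c / 2 * y ^ 4)) := by positivity
    linarith

/-- Where y⁴ is at most a multiple of u² nothing has to be proved; the remaining region contributes
O(1/N) with N = l^(2p), while the normalizing integral is at least 1/N. The disorder therefore costs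
only a factor u², without any upper bound on u. -/
lemma exists_fourth_moment_bound (p : ℕ) (hp : 1 ≤ p) {c : ℝ} (C R : ℝ) (hc : 0 < c) :
    ∃ K : ℝ, 0 < K ∧ ∀ l u : ℝ, 1 ≤ l → 1 ≤ u → ∀ e : ℝ → ℝ, EnergyBounds p c C R l u e →
      Integrable (fun y => y ^ 4 * Real.exp (-e y)) ∧
      ∫ y, y ^ 4 * Real.exp (-e y) ≤ K * u ^ 2 * ∫ y, Real.exp (-e y) := by
  set B := 2 * c + C ^ 2 / c with hB
  have hBpos : 0 < B := by positivity
  set J1 := ∫ y : ℝ, Real.exp (-(c / 8 * y ^ 4))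
  set J2 := ∫ y : ℝ, Real.exp (-(1 / 8) * y ^ 2)
  have hJ1 : 0 ≤ J1 := integral_nonneg fun y => (Real.exp_pos _).le
  have hJ2 : 0 ≤ J2 := integral_nonneg fun y => (Real.exp_pos _).le
  refine ⟨4 * B / c + (8 / c * J1 + 256 * J2), by positivity, fun l u hl hu e he => ?_⟩
  have hN : 1 ≤ l ^ (2 * p) := one_le_pow₀ hl
  have hint := he.integrable hp hc hl hu
  have hlow := inv_le_integral_exp_neg hN hint he.symm
  have hcont := he.cont
  set N := l ^ (2 * p) with hNdef
  have hN0 : 0 < N := by linarith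
  set I0 := ∫ y, Real.exp (-e y)
  have hpt : ∀ y, y ^ 4 * Real.exp (-e y) ≤ 4 * B / c * u ^ 2 * Real.exp (-e y)
      + 1 / N * (8 / c * Real.exp (-(c / 8 * y ^ 4)) + 256 * Real.exp (-(1 / 8) * y ^ 2)) := by
    intro y
    have p1 : 0 < Real.exp (-e y) := Real.exp_pos _
    have p2 : 0 < Real.exp (-(c / 8 * y ^ 4)) := Real.exp_pos _
    have p3 : 0 < Real.exp (-(1 / 8) * y ^ 2) := Real.exp_pos _
    have q1 : 0 ≤ 4 * B / c * u ^ 2 * Real.exp (-e y) := by positivity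
    have q2 : 0 ≤ 1 / N * (8 / c * Real.exp (-(c / 8 * y ^ 4))) := by positivity
    have q3 : 0 ≤ 1 / N * (256 * Real.exp (-(1 / 8) * y ^ 2)) := by positivity
    rw [mul_add (1 / N)]
    rcases le_total |y| (R * l) with h | h
    · have h1 := he.quartic hp hc hl hu h
      -- Above this threshold the negative term B u² uses up at most half of the quartic c/2 y⁴.
      rcases le_total (y ^ 4) (4 * B / c * u ^ 2) with h2 | h2
      · have := mul_le_mul_of_nonneg_right h2 p1.le
        linarith
      · have h3 : B * u ^ 2 ≤ c / 4 * y ^ 4 := by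
          have := mul_le_mul_of_nonneg_left h2 (show 0 ≤ c / 4 by positivity)
          have e1 : c / 4 * (4 * B / c * u ^ 2) = B * u ^ 2 := by field_simp
          linarith
        have h4 : N * (c / 4 * y ^ 4) ≤ e y := by
          refine le_trans (mul_le_mul_of_nonneg_left ?_ hN0.le) h1
          linarith
        have h5 : Real.exp (-e y) ≤ Real.exp (-(2 * (N * c / 8 * y ^ 4))) := by
          apply Real.exp_le_exp.2; linarith
        -- Half of the exponent pays for the factor y⁴ and produces the 1/N; the other half keeps
        -- the integral finite.
        have h6 := mul_exp_neg_two_mul_le (N * c / 8 * y ^ 4)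
        have h7 : Real.exp (-(N * c / 8 * y ^ 4)) ≤ Real.exp (-(c / 8 * y ^ 4)) := by
          apply Real.exp_le_exp.2
          have : 0 ≤ (N - 1) * (c / 8 * y ^ 4) := by
            apply mul_nonneg <;> [linarith; positivity]
          nlinarith
        have h8 : y ^ 4 * Real.exp (-e y) ≤ 1 / N * (8 / c * Real.exp (-(c / 8 * y ^ 4))) := by
          calc y ^ 4 * Real.exp (-e y)
              ≤ y ^ 4 * Real.exp (-(2 * (N * c / 8 * y ^ 4))) := by gcongr
            _ = 1 / N * (8 / c * ((N * c / 8 * y ^ 4) *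
                  Real.exp (-(2 * (N * c / 8 * y ^ 4))))) := by field_simp
            _ ≤ _ := by
              have := h6.trans h7
              gcongr
        linarith
    · have h1 := he.tail y h
      set z := N ^ 2 * y ^ 2 / 16 with hz
      have h2 : Real.exp (-e y) ≤ Real.exp (-(2 * z)) * Real.exp (-(2 * z)) := by
        rw [← Real.exp_add]; apply Real.exp_le_exp.2; rw [hz]; linarith
      have hz0 : 0 ≤ z := by positivity
      have h6 : z ^ 2 * Real.exp (-(2 * z)) ≤ 1 := by
        have a1 : z ≤ Real.exp z := by linarith [Real.add_one_le_exp z]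
        have : Real.exp (-(2 * z)) = (Real.exp z ^ 2)⁻¹ := by
          rw [Real.exp_neg, ← Real.exp_nat_mul]; norm_num
        rw [this, ← div_eq_mul_inv, div_le_one (by positivity)]
        gcongr
      have h7 : Real.exp (-(2 * z)) ≤ Real.exp (-(1 / 8) * y ^ 2) := by
        apply Real.exp_le_exp.2
        have : 0 ≤ (N ^ 2 - 1) * y ^ 2 := by
          apply mul_nonneg _ (sq_nonneg _)
          nlinarith
        rw [hz]; nlinarith
      have hN4 : 1 / N ^ 4 ≤ 1 / N := by
        apply one_div_le_one_div_of_le hN0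
        calc N = N ^ 1 := (pow_one N).symm
          _ ≤ N ^ 4 := pow_le_pow_right₀ hN (by norm_num)
      have h8 : y ^ 4 * Real.exp (-e y) ≤ 1 / N * (256 * Real.exp (-(1 / 8) * y ^ 2)) := by
        calc y ^ 4 * Real.exp (-e y)
            ≤ y ^ 4 * (Real.exp (-(2 * z)) * Real.exp (-(2 * z))) := by gcongr
          _ = 1 / N ^ 4 * (256 * ((z ^ 2 * Real.exp (-(2 * z))) * Real.exp (-(2 * z)))) := by
              rw [hz]; field_simp; ring
          _ ≤ 1 / N * (256 * (1 * Real.exp (-(1 / 8) * y ^ 2))) := by gcongr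
          _ = _ := by ring
      linarith
  have hi1 := (integrable_exp_neg_mul_pow_four (show 0 < c / 8 by positivity)).const_mul (8 / c)
  have hi2 := (integrable_exp_neg_mul_sq (show (0 : ℝ) < 1 / 8 by norm_num)).const_mul 256
  have hi12 : Integrable (fun y : ℝ => 8 / c * Real.exp (-(c / 8 * y ^ 4))
      + 256 * Real.exp (-(1 / 8) * y ^ 2)) := hi1.add hi2
  have hrhs : Integrable (fun y => 4 * B / c * u ^ 2 * Real.exp (-e y)
      + 1 / N * (8 / c * Real.exp (-(c / 8 * y ^ 4)) + 256 * Real.exp (-(1 / 8) * y ^ 2))) :=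
    (hint.const_mul _).add (hi12.const_mul _)
  have hy4 : Integrable (fun y => y ^ 4 * Real.exp (-e y)) := by
    refine Integrable.mono' hrhs (by fun_prop) (ae_of_all _ fun y => ?_)
    rw [Real.norm_eq_abs, abs_of_nonneg (by positivity)]
    exact hpt y
  refine ⟨hy4, ?_⟩
  have h1 := integral_mono hy4 hrhs hpt
  rw [integral_add (hint.const_mul _) (hi12.const_mul _), integral_const_mul,
    integral_const_mul, integral_add hi1 hi2, integral_const_mul, integral_const_mul] at h1
  change _ ≤ 4 * B / c * u ^ 2 * I0 + 1 / N * (8 / c * J1 + 256 * J2) at h1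
  have h2 : 1 / N * (8 / c * J1 + 256 * J2) ≤ I0 * (8 / c * J1 + 256 * J2) := by gcongr
  have h3 : 1 ≤ u ^ 2 := one_le_pow₀ hu
  have hI0 : 0 ≤ I0 := integral_nonneg fun y => (Real.exp_pos _).le
  have h4 : I0 * (8 / c * J1 + 256 * J2) ≤ (8 / c * J1 + 256 * J2) * u ^ 2 * I0 := by
    have : 0 ≤ I0 * (8 / c * J1 + 256 * J2) := by positivity
    nlinarith
  calc _ ≤ _ := h1
    _ ≤ 4 * B / c * u ^ 2 * I0 + (8 / c * J1 + 256 * J2) * u ^ 2 * I0 := by linarith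
    _ = _ := by ring

/-- Strict convexity gives positivity for each pair, and compactness makes it uniform. Uniformity in
v matters because the critical point depends on the random field. -/
lemma exists_bregman_gap (p : ℕ) {c : ℝ} (hc : 0 < c) (V Y δ : ℝ) (hδ : 0 < δ) :
    ∃ κ : ℝ, 0 < κ ∧ ∀ y v : ℝ, |v| ≤ V → |y| ≤ Y → δ ≤ |y - v| →
      κ ≤ c * (y ^ (2 * p + 2) - v ^ (2 * p + 2) - (2 * p + 2 : ℝ) * v ^ (2 * p + 1) * (y - v)) := by
  set f : ℝ × ℝ → ℝ := fun z => c * (z.1 ^ (2 * p + 2) - z.2 ^ (2 * p + 2)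
    - (2 * p + 2 : ℝ) * z.2 ^ (2 * p + 1) * (z.1 - z.2)) with hf
  have hfc : Continuous f := by fun_prop
  set s : Set (ℝ × ℝ) := (Set.Icc (-Y) Y ×ˢ Set.Icc (-V) V) ∩ {z | δ ≤ |z.1 - z.2|} with hs
  have hsc : IsCompact s := (isCompact_Icc.prod isCompact_Icc).inter_right
    (isClosed_le continuous_const (by fun_prop))
  rcases s.eq_empty_or_nonempty with he | hne
  · refine ⟨1, one_pos, fun y v hv hy hyv => ?_⟩
    have : (y, v) ∈ s := ⟨⟨abs_le.1 hy, abs_le.1 hv⟩, hyv⟩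
    rw [he] at this
    exact this.elim
  · obtain ⟨z, hz, hmin⟩ := hsc.exists_isMinOn hne hfc.continuousOn
    refine ⟨f z, ?_, fun y v hv hy hyv => hmin (show (y, v) ∈ s from
      ⟨⟨abs_le.1 hy, abs_le.1 hv⟩, hyv⟩)⟩
    have hzne : z.1 ≠ z.2 := by
      intro h
      have h2 : δ ≤ |z.1 - z.2| := hz.2
      rw [h, sub_self, abs_zero] at h2
      linarith
    exact mul_pos hc (bregman_pow_pos p hzne)

lemma exists_bregman_small (p : ℕ) (c V : ℝ) {κ : ℝ} (hκ : 0 < κ) :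
    ∃ ρ : ℝ, 0 < ρ ∧ ρ ≤ 1 ∧ ∀ y v : ℝ, |v| ≤ V → |y - v| ≤ ρ →
      c * (y ^ (2 * p + 2) - v ^ (2 * p + 2) - (2 * p + 2 : ℝ) * v ^ (2 * p + 1) * (y - v)) ≤ κ := by
  set f : ℝ × ℝ → ℝ := fun z => c * (z.1 ^ (2 * p + 2) - z.2 ^ (2 * p + 2)
    - (2 * p + 2 : ℝ) * z.2 ^ (2 * p + 1) * (z.1 - z.2)) with hf
  have hfc : Continuous f := by fun_prop
  have hsc : IsCompact (Set.Icc (-(V + 1)) (V + 1) ×ˢ Set.Icc (-(V + 1)) (V + 1)) :=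
    (isCompact_Icc (a := -(V + 1)) (b := V + 1)).prod (isCompact_Icc (a := -(V + 1)) (b := V + 1))
  have huc := hsc.uniformContinuousOn_of_continuous hfc.continuousOn
  obtain ⟨d, hd, hdist⟩ := Metric.uniformContinuousOn_iff.1 huc κ hκ
  refine ⟨min (d / 2) 1, by positivity, min_le_right _ _, fun y v hv hyv => ?_⟩
  have h1 : |y - v| ≤ 1 := hyv.trans (min_le_right _ _)
  have h2 : |y - v| < d := by linarith [hyv.trans (min_le_left _ _)]
  have hv' := abs_le.1 hv
  have h1' := abs_le.1 h1
  have := hdist (y, v) ⟨⟨by dsimp only; linarith, by dsimp only; linarith⟩,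
      ⟨by dsimp only; linarith, by dsimp only; linarith⟩⟩
    (v, v) ⟨⟨by dsimp only; linarith, by dsimp only; linarith⟩,
      ⟨by dsimp only; linarith, by dsimp only; linarith⟩⟩
    (by rw [Prod.dist_eq]; simp [Real.dist_eq, h2])
  have h3 : f (v, v) = 0 := by simp [hf]
  rw [h3, Real.dist_eq, sub_zero] at this
  exact (le_abs_self _).trans this.le

-- Laplace's method, uniform over disorder bounded by M. Since β is the derivative of c y^(2p+2) at
-- v, the leading energy exceeds its minimum exactly by c times the Bregman divergence of the
-- monomial. Near v the integrand is small; at intermediate distance the gap κ makes the mass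
-- negligible against a window of radius ρ around v; beyond Y the fourth moment takes over.
set_option maxHeartbeats 1000000 in
theorem exists_second_moment_scale (p : ℕ) (hp : 1 ≤ p) {c₁ C R c : ℝ} (hc₁ : 0 < c₁) (hc : 0 < c)
    (η L₀ : ℝ → ℝ) {ε M : ℝ} (hε : 0 < ε) (hM : 1 ≤ M) :
    ∃ Λ : ℝ, ∀ (l u β v : ℝ) (e : ℝ → ℝ), Λ ≤ l → 1 ≤ l → 1 ≤ u → u ≤ M → |β| ≤ C * u →
      (2 * p + 2 : ℝ) * c * v ^ (2 * p + 1) = β → EnergyBounds p c₁ C R l u e →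
      (∀ Y, L₀ Y ≤ l → ∀ y, |y| ≤ Y →
        |e y - l ^ (2 * p) * (c * y ^ (2 * p + 2) - β * y)| ≤ l ^ (2 * p) * (η Y * u / l)) →
      |∫ y, (y ^ 2 - v ^ 2) * Real.exp (-e y)| ≤ ε * ∫ y, Real.exp (-e y) := by
  obtain ⟨K, hK, hmom⟩ := exists_fourth_moment_bound p hp C R hc₁
  set V := 1 + |C| * M / c with hV
  have hV1 : 1 ≤ V := by
    rw [hV]; have : 0 ≤ |C| * M / c := by positivity
    linarith
  set δ := min 1 (ε / (3 * (2 * V + 1))) with hδ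
  have hδ0 : 0 < δ := by positivity
  set Q := (1 + V ^ 2) * (K * M ^ 2) with hQ
  have hQ0 : 0 < Q := by positivity
  -- The last summand makes the fourth moment tail Q/Y² at most ε/3; V + 1 keeps the window around v
  -- inside |y| ≤ Y, because ρ ≤ 1.
  set Y := V + 1 + 3 * Q / ε with hY
  have hYV : V + 1 ≤ Y := by
    rw [hY]; have : 0 ≤ 3 * Q / ε := by positivity
    linarith
  have hY1 : 1 ≤ Y := by linarith
  have hY2 : Q / Y ^ 2 ≤ ε / 3 := by
    have h1 : 3 * Q / ε ≤ Y := by linarith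
    have h2 : Y ≤ Y ^ 2 := by nlinarith
    rw [div_le_iff₀ (by positivity)]
    rw [div_le_iff₀ hε] at h1
    nlinarith
  obtain ⟨κ, hκ, hgap⟩ := exists_bregman_gap p hc V Y δ hδ0
  obtain ⟨ρ, hρ, hρ1, hsmall⟩ := exists_bregman_small p c V (show 0 < κ / 4 by positivity)
  have hlim : Tendsto (fun l : ℝ => (Y ^ 2 + V ^ 2) * (Y / ρ) * Real.exp (-(κ / 4 * l))) atTop
      (𝓝 0) := by
    have h1 : Tendsto (fun l : ℝ => Real.exp (-(κ / 4 * l))) atTop (𝓝 0) :=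
      Real.tendsto_exp_neg_atTop_nhds_zero.comp (tendsto_id.const_mul_atTop (by positivity))
    simpa using h1.const_mul ((Y ^ 2 + V ^ 2) * (Y / ρ))
  obtain ⟨Λ₁, hΛ₁⟩ := Filter.eventually_atTop.1
    (hlim.eventually (gt_mem_nhds (show (0 : ℝ) < ε / 3 by positivity)))
  refine ⟨max Λ₁ (max (L₀ Y) (8 * |η Y| * M / κ)), fun l u β v e hl hl1 hu huM hβ hv he happ => ?_⟩
  have hlΛ : Λ₁ ≤ l := (le_max_left _ _).trans hl
  have hlL : L₀ Y ≤ l := (le_max_left _ _).trans ((le_max_right _ _).trans hl)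
  have hlη : 8 * |η Y| * M / κ ≤ l := (le_max_right _ _).trans ((le_max_right _ _).trans hl)
  have hl0 : 0 < l := by linarith
  have hN : 1 ≤ l ^ (2 * p) := one_le_pow₀ hl1
  have hNl : l ≤ l ^ (2 * p) := by
    calc l = l ^ 1 := (pow_one l).symm
      _ ≤ _ := pow_le_pow_right₀ hl1 (by omega)
  have hint := he.integrable hp hc₁ hl1 hu
  obtain ⟨hint4, hbd4⟩ := hmom l u hl1 hu e he
  have hcont := he.cont
  have happY := happ Y hlL
  set N := l ^ (2 * p)
  have hN0 : 0 < N := by linarith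
  set I := ∫ y, Real.exp (-e y) with hI
  have hI0 : 0 ≤ I := integral_nonneg fun y => (Real.exp_pos _).le
  -- Budget for the gap: κ/8 for the approximation and κ/4 for the window. The energy is at most N(A
  -- + 3κ/8) on the window and at least N(A + 7κ/8) away from v.
  have hηu : η Y * u / l ≤ κ / 8 := by
    rw [div_le_iff₀ hl0]
    rw [div_le_iff₀ hκ] at hlη
    have h1 : η Y * u ≤ |η Y| * M := by
      calc η Y * u ≤ |η Y| * u := by gcongr; exact le_abs_self _
        _ ≤ _ := by gcongr
    linarith
  have hvV : |v| ≤ V := by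
    by_contra hcon
    push Not at hcon
    have h1 : 1 ≤ |v| := by linarith
    have h2 : |v| ≤ |v| ^ (2 * p + 1) := by
      calc |v| = |v| ^ 1 := (pow_one _).symm
        _ ≤ _ := pow_le_pow_right₀ h1 (by omega)
    have h3 : (2 * p + 2 : ℝ) * c * |v| ^ (2 * p + 1) ≤ |C| * M := by
      calc (2 * p + 2 : ℝ) * c * |v| ^ (2 * p + 1) = |β| := by
            rw [← hv, abs_mul, abs_pow, abs_of_pos (show 0 < (2 * p + 2 : ℝ) * c by positivity)]
        _ ≤ C * u := hβ
        _ ≤ |C| * M := by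
            calc C * u ≤ |C| * u := by gcongr; exact le_abs_self _
              _ ≤ _ := by gcongr
    have h4 : c * |v| ≤ |C| * M := by
      refine le_trans ?_ h3
      have h5 : c * |v| ≤ c * |v| ^ (2 * p + 1) := by gcongr
      have h6 : 0 ≤ (2 * p + 1 : ℝ) * (c * |v| ^ (2 * p + 1)) := by positivity
      linarith
    have h7 : |v| ≤ |C| * M / c := by rw [le_div_iff₀ hc]; linarith
    linarith
  have hv2 : v ^ 2 ≤ V ^ 2 := by rw [← sq_abs v]; gcongr
  set A := c * v ^ (2 * p + 2) - β * v with hA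
  have hbreg : ∀ y, c * y ^ (2 * p + 2) - β * y = A + c * (y ^ (2 * p + 2) - v ^ (2 * p + 2)
      - (2 * p + 2 : ℝ) * v ^ (2 * p + 1) * (y - v)) := by
    intro y; rw [hA, ← hv]; ring
  have hlow : 2 * ρ * Real.exp (-(N * (A + 3 * κ / 8))) ≤ I := by
    have h1 : ∫ y in Set.Icc (v - ρ) (v + ρ), Real.exp (-(N * (A + 3 * κ / 8)))
        ≤ ∫ y in Set.Icc (v - ρ) (v + ρ), Real.exp (-e y) := by
      apply setIntegral_mono_on (by simp) hint.integrableOn measurableSet_Icc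
      intro y hy
      have hyv : |y - v| ≤ ρ := abs_le.2 ⟨by linarith [hy.1], by linarith [hy.2]⟩
      have hyY : |y| ≤ Y := by
        calc |y| = |v + (y - v)| := by ring_nf
          _ ≤ |v| + |y - v| := abs_add_le _ _
          _ ≤ Y := by linarith
      have h2 := (abs_le.1 (happY y hyY)).2
      rw [hbreg] at h2
      have h3 := hsmall y v hvV hyv
      apply Real.exp_le_exp.2
      have h4 : N * (A + c * (y ^ (2 * p + 2) - v ^ (2 * p + 2)
          - (2 * p + 2 : ℝ) * v ^ (2 * p + 1) * (y - v))) + N * (η Y * u / l)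
          ≤ N * (A + 3 * κ / 8) := by
        rw [← mul_add]
        apply mul_le_mul_of_nonneg_left _ hN0.le
        linarith
      linarith
    have h2 : ∫ y in Set.Icc (v - ρ) (v + ρ), Real.exp (-e y) ≤ I :=
      setIntegral_le_integral hint (ae_of_all _ fun y => (Real.exp_pos _).le)
    rw [setIntegral_const] at h1
    simp only [measureReal_def, Real.volume_Icc, smul_eq_mul] at h1
    rw [show v + ρ - (v - ρ) = 2 * ρ by ring, ENNReal.toReal_ofReal (by positivity)] at h1
    linarith
  set E := Real.exp (-(N * (A + 7 * κ / 8))) with hE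
  have hpt : ∀ y, |(y ^ 2 - v ^ 2) * Real.exp (-e y)| ≤ ε / 3 * Real.exp (-e y)
      + (1 + V ^ 2) / Y ^ 2 * (y ^ 4 * Real.exp (-e y))
      + (Set.Icc (-Y) Y).indicator (fun _ => (Y ^ 2 + V ^ 2) * E) y := by
    intro y
    have p1 : 0 < Real.exp (-e y) := Real.exp_pos _
    rw [abs_mul, abs_of_pos p1]
    have q1 : 0 ≤ ε / 3 * Real.exp (-e y) := by positivity
    have q2 : 0 ≤ (1 + V ^ 2) / Y ^ 2 * (y ^ 4 * Real.exp (-e y)) := by positivity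
    have q3 : 0 ≤ (Set.Icc (-Y) Y).indicator (fun _ => (Y ^ 2 + V ^ 2) * E) y :=
      Set.indicator_nonneg (fun _ _ => by positivity) y
    by_cases h1 : |y - v| ≤ δ
    · have h2 : |y ^ 2 - v ^ 2| ≤ ε / 3 := by
        have h3 : |y + v| ≤ 2 * V + 1 := by
          calc |y + v| = |(y - v) + 2 * v| := by ring_nf
            _ ≤ |y - v| + |2 * v| := abs_add_le _ _
            _ ≤ 1 + 2 * V := by
              rw [abs_mul, abs_of_pos (show (0 : ℝ) < 2 by norm_num)]
              have : δ ≤ 1 := min_le_left _ _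
              linarith
            _ = _ := by ring
        have h4 : δ ≤ ε / (3 * (2 * V + 1)) := min_le_right _ _
        calc |y ^ 2 - v ^ 2| = |y - v| * |y + v| := by rw [← abs_mul]; ring_nf
          _ ≤ (ε / (3 * (2 * V + 1))) * (2 * V + 1) := by gcongr; exact h1.trans h4
          _ = ε / 3 := by field_simp
      have := mul_le_mul_of_nonneg_right h2 p1.le
      linarith
    · push Not at h1
      have hle : |y ^ 2 - v ^ 2| ≤ y ^ 2 + V ^ 2 := by
        rw [abs_le]; constructor <;> linarith [sq_nonneg y, sq_nonneg v]
      by_cases h2 : |y| ≤ Y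
      · have hmem : y ∈ Set.Icc (-Y) Y := abs_le.1 h2
        rw [Set.indicator_of_mem hmem] at q3 ⊢
        have h3 := (abs_le.1 (happY y h2)).1
        rw [hbreg] at h3
        have h4 := hgap y v hvV h2 h1.le
        have h5 : Real.exp (-e y) ≤ E := by
          apply Real.exp_le_exp.2
          have h6 : N * (A + 7 * κ / 8) ≤ N * (A + c * (y ^ (2 * p + 2) - v ^ (2 * p + 2)
              - (2 * p + 2 : ℝ) * v ^ (2 * p + 1) * (y - v))) - N * (η Y * u / l) := by
            rw [← mul_sub]
            apply mul_le_mul_of_nonneg_left _ hN0.le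
            linarith
          linarith
        have h6 : y ^ 2 ≤ Y ^ 2 := by rw [← sq_abs y]; gcongr
        have h7 : |y ^ 2 - v ^ 2| * Real.exp (-e y) ≤ (Y ^ 2 + V ^ 2) * E := by
          apply mul_le_mul (by linarith) h5 p1.le (by positivity)
        linarith
      · push Not at h2
        have h6 : Y ^ 2 ≤ y ^ 2 := by rw [← sq_abs y]; gcongr
        have h7 : y ^ 2 + V ^ 2 ≤ (1 + V ^ 2) / Y ^ 2 * y ^ 4 := by
          have h8 : 1 ≤ y ^ 2 := (one_le_pow₀ hY1).trans h6
          calc y ^ 2 + V ^ 2 ≤ (1 + V ^ 2) * y ^ 2 := by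
                linarith [mul_le_mul_of_nonneg_left h8 (sq_nonneg V)]
            _ = (1 + V ^ 2) / Y ^ 2 * (Y ^ 2 * y ^ 2) := by field_simp
            _ ≤ (1 + V ^ 2) / Y ^ 2 * (y ^ 2 * y ^ 2) := by gcongr
            _ = _ := by ring
        have := mul_le_mul_of_nonneg_right (hle.trans h7) p1.le
        linarith
  have hind : Integrable ((Set.Icc (-Y) Y).indicator (fun _ : ℝ => (Y ^ 2 + V ^ 2) * E)) :=
    (integrable_indicator_iff measurableSet_Icc).2 (integrableOn_const (by simp))
  have h12 : Integrable (fun y => ε / 3 * Real.exp (-e y)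
      + (1 + V ^ 2) / Y ^ 2 * (y ^ 4 * Real.exp (-e y))) :=
    (hint.const_mul _).add (hint4.const_mul _)
  have hrhs : Integrable (fun y => ε / 3 * Real.exp (-e y)
      + (1 + V ^ 2) / Y ^ 2 * (y ^ 4 * Real.exp (-e y))
      + (Set.Icc (-Y) Y).indicator (fun _ => (Y ^ 2 + V ^ 2) * E) y) := h12.add hind
  have h1 : |∫ y, (y ^ 2 - v ^ 2) * Real.exp (-e y)| ≤ ε / 3 * I
      + (1 + V ^ 2) / Y ^ 2 * (∫ y, y ^ 4 * Real.exp (-e y)) + 2 * Y * ((Y ^ 2 + V ^ 2) * E) := by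
    have h2 := norm_integral_le_of_norm_le hrhs (f := fun y => (y ^ 2 - v ^ 2) * Real.exp (-e y))
      (ae_of_all _ fun y => hpt y)
    rw [integral_add h12 hind, integral_add (hint.const_mul _) (hint4.const_mul _),
      integral_const_mul, integral_const_mul, integral_indicator measurableSet_Icc,
      setIntegral_const] at h2
    simp only [measureReal_def, Real.volume_Icc, smul_eq_mul] at h2
    rw [show Y - -Y = 2 * Y by ring, ENNReal.toReal_ofReal (by positivity)] at h2
    exact h2
  have h2 : (1 + V ^ 2) / Y ^ 2 * (∫ y, y ^ 4 * Real.exp (-e y)) ≤ ε / 3 * I := by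
    calc (1 + V ^ 2) / Y ^ 2 * (∫ y, y ^ 4 * Real.exp (-e y))
        ≤ (1 + V ^ 2) / Y ^ 2 * (K * M ^ 2 * I) := by
          gcongr
          refine hbd4.trans ?_
          gcongr
      _ = Q / Y ^ 2 * I := by rw [hQ]; ring
      _ ≤ ε / 3 * I := by gcongr
  have h3 : 2 * Y * ((Y ^ 2 + V ^ 2) * E) ≤ ε / 3 * I := by
    have h4 := (hΛ₁ l hlΛ).le
    -- The surplus is Nκ/2, and l ≤ N = l^(2p) because p ≥ 1; a decay in l alone is enough.
    have h5 : E ≤ Real.exp (-(κ / 4 * l)) * Real.exp (-(N * (A + 3 * κ / 8))) := by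
      rw [hE, ← Real.exp_add]
      apply Real.exp_le_exp.2
      linarith [mul_le_mul_of_nonneg_left hNl (show 0 ≤ κ / 4 by positivity), mul_pos hN0 hκ]
    calc 2 * Y * ((Y ^ 2 + V ^ 2) * E)
        ≤ 2 * Y * ((Y ^ 2 + V ^ 2) * (Real.exp (-(κ / 4 * l)) *
            Real.exp (-(N * (A + 3 * κ / 8))))) := by gcongr
      _ = ((Y ^ 2 + V ^ 2) * (Y / ρ) * Real.exp (-(κ / 4 * l))) *
            (2 * ρ * Real.exp (-(N * (A + 3 * κ / 8)))) := by field_simp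
      _ ≤ ε / 3 * I := by gcongr
  linarith

/-! ### Hyperbolic functions -/

lemma continuous_tanh : Continuous Real.tanh := by
  have h : Real.tanh = fun x => Real.sinh x / Real.cosh x :=
    funext Real.tanh_eq_sinh_div_cosh
  rw [h]
  exact Real.continuous_sinh.div Real.continuous_cosh fun x => (Real.cosh_pos x).ne'

lemma continuous_log_cosh : Continuous fun x => Real.log (Real.cosh x) :=
  Real.continuous_cosh.log fun x => (Real.cosh_pos x).ne'

lemma one_add_tanh_mul_tanh_pos (s a : ℝ) : 0 < 1 + Real.tanh s * Real.tanh a := by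
  have h : |Real.tanh s * Real.tanh a| < 1 := by
    rw [abs_mul]
    exact mul_lt_one_of_nonneg_of_lt_one_left (abs_nonneg _) (Real.abs_tanh_lt_one s)
      (Real.abs_tanh_lt_one a).le
  linarith [(abs_lt.1 h).1]

/-- The addition formula for cosh. It lets the field act through the bounded variable tanh a only,
and the linear term of the last logarithm is the tilt that drives the limit. -/
lemma log_cosh_add (s a : ℝ) : Real.log (Real.cosh (s + a)) - Real.log (Real.cosh a)
    = Real.log (Real.cosh s) + Real.log (1 + Real.tanh s * Real.tanh a) := by
  have hs := Real.cosh_pos s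
  have ha := Real.cosh_pos a
  have h : Real.cosh (s + a) =
      Real.cosh a * (Real.cosh s * (1 + Real.tanh s * Real.tanh a)) := by
    rw [Real.cosh_add, Real.tanh_eq_sinh_div_cosh, Real.tanh_eq_sinh_div_cosh]
    field_simp
  have hp := one_add_tanh_mul_tanh_pos s a
  rw [h, Real.log_mul ha.ne' (mul_pos hs hp).ne', Real.log_mul hs.ne' hp.ne']
  ring

lemma log_cosh_add_le (s a : ℝ) :
    Real.log (Real.cosh (s + a)) - Real.log (Real.cosh a) ≤ |s| := by
  have ha := Real.cosh_pos a
  have h : Real.cosh (s + a) ≤ Real.exp |s| * Real.cosh a := by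
    rw [Real.cosh_eq, Real.cosh_eq]
    have h1 : Real.exp (s + a) ≤ Real.exp |s| * Real.exp a := by
      rw [← Real.exp_add]; apply Real.exp_le_exp.2; linarith [le_abs_self s]
    have h2 : Real.exp (-(s + a)) ≤ Real.exp |s| * Real.exp (-a) := by
      rw [← Real.exp_add]; apply Real.exp_le_exp.2; linarith [neg_abs_le s]
    linarith
  have h2 := Real.log_le_log (Real.cosh_pos _) h
  rw [Real.log_mul (Real.exp_pos _).ne' ha.ne', Real.log_exp] at h2
  linarith

lemma abs_log_cosh_sub_le (a b : ℝ) :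
    |Real.log (Real.cosh a) - Real.log (Real.cosh b)| ≤ |a - b| := by
  rw [abs_le]
  have h1 := log_cosh_add_le (a - b) b
  have h2 := log_cosh_add_le (b - a) a
  rw [sub_add_cancel] at h1 h2
  rw [abs_sub_comm b a] at h2
  constructor <;> linarith

/-- Midpoint convexity of log cosh, from cosh(a + s) cosh(a - s) = cosh² a + sinh² s. -/
lemma two_mul_log_cosh_le (s a : ℝ) : 2 * Real.log (Real.cosh a)
    ≤ Real.log (Real.cosh (s + a)) + Real.log (Real.cosh (-s + a)) := by
  have h1 := Real.cosh_pos (s + a)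
  have h2 := Real.cosh_pos (-s + a)
  have ha := Real.cosh_pos a
  rw [← Real.log_mul h1.ne' h2.ne']
  have : 2 * Real.log (Real.cosh a) = Real.log (Real.cosh a ^ 2) := by
    rw [Real.log_pow]; norm_num
  rw [this]
  apply Real.log_le_log (by positivity)
  rw [Real.cosh_add, Real.cosh_add, Real.cosh_neg, Real.sinh_neg]
  nlinarith [Real.cosh_sq a, Real.cosh_sq s, sq_nonneg (Real.sinh s)]

lemma abs_tanh_le (s : ℝ) : |Real.tanh s| ≤ |s| := by
  have key : ∀ s : ℝ, 0 ≤ s → Real.tanh s ≤ s := by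
    intro s hs
    have h1 : Real.exp (2 * s) * (1 - s) ≤ 1 + s := by
      rcases le_total 1 s with h | h
      · nlinarith [Real.exp_pos (2 * s)]
      · have hmono : MonotoneOn (fun x : ℝ => 1 + x - Real.exp (2 * x) * (1 - x)) (Set.Ici 0) := by
          apply monotoneOn_of_deriv_nonneg (convex_Ici 0) (by fun_prop) (by fun_prop)
          intro x hx
          rw [interior_Ici] at hx
          have hd : HasDerivAt (fun x : ℝ => 1 + x - Real.exp (2 * x) * (1 - x))
              (1 - (Real.exp (2 * x) * 2 * (1 - x) + Real.exp (2 * x) * (-1))) x := by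
            have e1 : HasDerivAt (fun x : ℝ => Real.exp (2 * x)) (Real.exp (2 * x) * 2) x := by
              simpa using ((hasDerivAt_id x).const_mul 2).exp
            have e2 : HasDerivAt (fun x : ℝ => 1 - x) (-1) x := by
              simpa using (hasDerivAt_id x).const_sub 1
            have e3 : HasDerivAt (fun x : ℝ => 1 + x) 1 x := by
              simpa using (hasDerivAt_id x).const_add 1
            exact e3.sub (e1.mul e2)
          rw [hd.deriv]
          have h2 : 1 - 2 * x ≤ Real.exp (-(2 * x)) := Real.one_sub_le_exp_neg _
          have h3 : Real.exp (2 * x) * Real.exp (-(2 * x)) = 1 := by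
            rw [← Real.exp_add]; simp
          nlinarith [Real.exp_pos (2 * x)]
        have := hmono (Set.mem_Ici.2 le_rfl) (Set.mem_Ici.2 hs) hs
        simp at this
        linarith
    rw [Real.tanh_eq, div_le_iff₀ (by positivity)]
    have h2 : Real.exp (2 * s) = Real.exp s * Real.exp s := by rw [← Real.exp_add]; ring_nf
    have h3 : Real.exp s * Real.exp (-s) = 1 := by rw [← Real.exp_add]; simp
    have h4 : Real.exp s * (1 - s) ≤ (1 + s) * Real.exp (-s) := by
      have := mul_le_mul_of_nonneg_right h1 (Real.exp_pos (-s)).le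
      rw [h2] at this
      have h5 : Real.exp s * Real.exp s * (1 - s) * Real.exp (-s) = Real.exp s * (1 - s) := by
        calc _ = Real.exp s * (1 - s) * (Real.exp s * Real.exp (-s)) := by ring
          _ = _ := by rw [h3, mul_one]
      linarith
    linarith
  rcases le_total 0 s with h | h
  · have h0 : 0 ≤ Real.tanh s := by
      rw [Real.tanh_eq_sinh_div_cosh]
      exact div_nonneg (Real.sinh_nonneg_iff.2 h) (Real.cosh_pos _).le
    rw [abs_of_nonneg h0, abs_of_nonneg h]
    exact key s h
  · have h0 : 0 ≤ Real.tanh (-s) := by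
      rw [Real.tanh_eq_sinh_div_cosh]
      exact div_nonneg (Real.sinh_nonneg_iff.2 (by linarith)) (Real.cosh_pos _).le
    have := key (-s) (by linarith)
    rw [← abs_neg s, ← abs_neg (Real.tanh s), ← Real.tanh_neg, abs_of_nonneg h0,
      abs_of_nonneg (by linarith : 0 ≤ -s)]
    exact this

/-- From s ≤ sinh s and cosh s ≤ exp(s²/2) for s ≥ 0. It serves to replace tanh(√θ x) by √θ x in the
tilt. -/
lemma abs_tanh_sub_self_le (s : ℝ) : |Real.tanh s - s| ≤ |s| ^ 3 := by
  have key : ∀ s : ℝ, 0 ≤ s → s - Real.tanh s ≤ s ^ 3 := by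
    intro s hs
    have h1 : s ≤ Real.sinh s := Real.self_le_sinh_iff.2 hs
    have hc := Real.cosh_pos s
    have h2 : (1 - s ^ 2 / 2) * Real.cosh s ≤ 1 := by
      have h3 : 1 - s ^ 2 / 2 ≤ Real.exp (-(s ^ 2 / 2)) := Real.one_sub_le_exp_neg _
      calc (1 - s ^ 2 / 2) * Real.cosh s ≤ Real.exp (-(s ^ 2 / 2)) * Real.cosh s := by gcongr
        _ ≤ Real.exp (-(s ^ 2 / 2)) * Real.exp (s ^ 2 / 2) := by
            gcongr; exact Real.cosh_le_exp_half_sq s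
        _ = 1 := by rw [← Real.exp_add]; simp
    have h4 : s * (1 - s ^ 2 / 2) ≤ Real.tanh s := by
      rw [Real.tanh_eq_sinh_div_cosh, le_div_iff₀ hc]
      nlinarith [mul_le_mul_of_nonneg_left h2 hs]
    have h5 : 0 ≤ s ^ 3 := by positivity
    nlinarith
  have habs := abs_tanh_le s
  rcases le_total 0 s with h | h
  · have h1 : Real.tanh s ≤ s := by
      have := le_abs_self (Real.tanh s); rw [abs_of_nonneg h] at habs; linarith
    rw [abs_of_nonpos (by linarith), abs_of_nonneg h]
    linarith [key s h]
  · have h1 : s ≤ Real.tanh s := by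
      have := neg_abs_le (Real.tanh s); rw [abs_of_nonpos h] at habs; linarith
    rw [abs_of_nonneg (by linarith), abs_of_nonpos h]
    have := key (-s) (by linarith)
    rw [Real.tanh_neg] at this
    linarith

lemma abs_tanh_le_tanh {s R : ℝ} (h : |s| ≤ R) : |Real.tanh s| ≤ Real.tanh R := by
  have hmono : ∀ {a b : ℝ}, a ≤ b → Real.tanh a ≤ Real.tanh b := by
    intro a b hab
    rw [Real.tanh_eq_sinh_div_cosh, Real.tanh_eq_sinh_div_cosh,
      div_le_div_iff₀ (Real.cosh_pos _) (Real.cosh_pos _)]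
    have h1 : 0 ≤ Real.sinh (b - a) := Real.sinh_nonneg_iff.2 (by linarith)
    rw [Real.sinh_sub] at h1
    linarith
  rw [abs_le] at h ⊢
  constructor
  · rw [← Real.tanh_neg]; exact hmono h.1
  · exact hmono h.2

/-! ### The random energy and its disorder -/

/-- `k` times the random counterpart of the population function, normalized to vanish at `0`. -/
def fieldEnergy {n : ℕ} (θ : ℝ) (S : Finset (Fin n)) (h : Fin n → ℝ) (x : ℝ) : ℝ :=
  S.card * x ^ 2 / 2
    - ∑ i ∈ S, (Real.log (Real.cosh (√θ * x + h i)) - Real.log (Real.cosh (h i)))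

/-- The centered sum of the powers of order `j + 1` of `tanh (h i)`, `i ∈ S`. -/
def tanhDev {n : ℕ} (μ : Measure ℝ) (S : Finset (Fin n)) (h : Fin n → ℝ) (j : ℕ) : ℝ :=
  ∑ i ∈ S, Real.tanh (h i) ^ (j + 1) - S.card * ∫ a, Real.tanh a ^ (j + 1) ∂μ

/-- A weighted quadratic functional of the fluctuations of the field. -/
def disorder {n : ℕ} (μ : Measure ℝ) (r : ℝ) (S : Finset (Fin n)) (h : Fin n → ℝ) : ℝ :=
  1 + ∑' j, r ^ j * (tanhDev μ S h j ^ 2 / S.card)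

lemma continuous_fieldEnergy {n : ℕ} (θ : ℝ) (S : Finset (Fin n)) (h : Fin n → ℝ) :
    Continuous (fieldEnergy θ S h) := by
  unfold fieldEnergy
  refine Continuous.sub (by fun_prop) (continuous_finsetSum _ fun i _ => ?_)
  exact (continuous_log_cosh.comp (by fun_prop)).sub continuous_const

lemma fieldEnergy_symm {n : ℕ} (θ : ℝ) (S : Finset (Fin n)) (h : Fin n → ℝ) (x : ℝ) :
    fieldEnergy θ S h x + fieldEnergy θ S h (-x) ≤ S.card * x ^ 2 := by
  unfold fieldEnergy
  have h1 : 0 ≤ ∑ i ∈ S, (Real.log (Real.cosh (√θ * x + h i)) - Real.log (Real.cosh (h i)))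
      + ∑ i ∈ S, (Real.log (Real.cosh (√θ * (-x) + h i)) - Real.log (Real.cosh (h i))) := by
    rw [← Finset.sum_add_distrib]
    apply Finset.sum_nonneg
    intro i _
    have := two_mul_log_cosh_le (√θ * x) (h i)
    rw [show √θ * (-x) = -(√θ * x) by ring]
    linarith
  have h2 : (-x) ^ 2 = x ^ 2 := by ring
  rw [h2]
  linarith

/-- As log cosh is 1-Lipschitz, each site subtracts at most √θ |x|, which is at most x²/4 in this
range, whatever the field. -/
lemma fieldEnergy_tail {n : ℕ} (θ : ℝ) (S : Finset (Fin n)) (h : Fin n → ℝ) {x : ℝ}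
    (hx : 4 * √θ ≤ |x|) : S.card * x ^ 2 / 4 ≤ fieldEnergy θ S h x := by
  unfold fieldEnergy
  have h1 : ∑ i ∈ S, (Real.log (Real.cosh (√θ * x + h i)) - Real.log (Real.cosh (h i)))
      ≤ ∑ i ∈ S, x ^ 2 / 4 := by
    apply Finset.sum_le_sum
    intro i _
    refine (log_cosh_add_le _ _).trans ?_
    rw [abs_mul, abs_of_nonneg (Real.sqrt_nonneg θ), ← sq_abs x]
    nlinarith [abs_nonneg x]
  rw [Finset.sum_const, nsmul_eq_mul] at h1
  linarith

lemma abs_tanhDev_le {n : ℕ} (μ : Measure ℝ) [IsProbabilityMeasure μ] (S : Finset (Fin n))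
    (h : Fin n → ℝ) (j : ℕ) : |tanhDev μ S h j| ≤ 2 * S.card := by
  unfold tanhDev
  have hb : ∀ a : ℝ, |Real.tanh a ^ (j + 1)| ≤ 1 := fun a => by
    rw [abs_pow]; exact pow_le_one₀ (abs_nonneg _) (Real.abs_tanh_lt_one a).le
  have h1 : |∑ i ∈ S, Real.tanh (h i) ^ (j + 1)| ≤ S.card := by
    refine (Finset.abs_sum_le_sum_abs _ _).trans ?_
    calc _ ≤ ∑ i ∈ S, (1 : ℝ) := Finset.sum_le_sum fun i _ => hb _
      _ = _ := by simp
  have h2 : |∫ a, Real.tanh a ^ (j + 1) ∂μ| ≤ 1 := by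
    have := norm_integral_le_of_norm_le_const (μ := μ) (f := fun a => Real.tanh a ^ (j + 1))
      (ae_of_all _ hb)
    simpa using this
  have h3 : |(S.card : ℝ) * ∫ a, Real.tanh a ^ (j + 1) ∂μ| ≤ S.card := by
    rw [abs_mul, Nat.abs_cast]
    have : (0 : ℝ) ≤ S.card := by positivity
    nlinarith
  calc _ ≤ |∑ i ∈ S, Real.tanh (h i) ^ (j + 1)| + |(S.card : ℝ) * ∫ a, Real.tanh a ^ (j + 1) ∂μ| :=
        abs_sub _ _
    _ ≤ _ := by linarith

lemma disorder_term_le {n : ℕ} (μ : Measure ℝ) [IsProbabilityMeasure μ] {r : ℝ} (hr : 0 ≤ r)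
    (S : Finset (Fin n)) (h : Fin n → ℝ) (j : ℕ) :
    r ^ j * (tanhDev μ S h j ^ 2 / S.card) ≤ r ^ j * (4 * S.card) := by
  apply mul_le_mul_of_nonneg_left _ (by positivity)
  rcases Nat.eq_zero_or_pos S.card with h0 | h0
  · simp [h0]
  · have h1 : (0 : ℝ) < S.card := by exact_mod_cast h0
    rw [div_le_iff₀ h1, ← sq_abs]
    have := abs_tanhDev_le μ S h j
    nlinarith [abs_nonneg (tanhDev μ S h j)]

lemma disorder_term_nonneg {n : ℕ} (μ : Measure ℝ) {r : ℝ} (hr : 0 ≤ r)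
    (S : Finset (Fin n)) (h : Fin n → ℝ) (j : ℕ) :
    0 ≤ r ^ j * (tanhDev μ S h j ^ 2 / S.card) := by positivity

lemma summable_disorder {n : ℕ} (μ : Measure ℝ) [IsProbabilityMeasure μ] {r : ℝ} (hr : 0 ≤ r)
    (hr1 : r < 1) (S : Finset (Fin n)) (h : Fin n → ℝ) :
    Summable fun j => r ^ j * (tanhDev μ S h j ^ 2 / S.card) :=
  Summable.of_nonneg_of_le (disorder_term_nonneg μ hr S h) (disorder_term_le μ hr S h)
    ((summable_geometric_of_lt_one hr hr1).mul_right _)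

lemma one_le_disorder {n : ℕ} (μ : Measure ℝ) {r : ℝ} (hr : 0 ≤ r)
    (S : Finset (Fin n)) (h : Fin n → ℝ) : 1 ≤ disorder μ r S h := by
  have : 0 ≤ ∑' j, r ^ j * (tanhDev μ S h j ^ 2 / S.card) :=
    tsum_nonneg (disorder_term_nonneg μ hr S h)
  unfold disorder
  linarith

lemma abs_tanhDev_zero_le {n : ℕ} (μ : Measure ℝ) [IsProbabilityMeasure μ] {r : ℝ} (hr : 0 ≤ r)
    (hr1 : r < 1) (S : Finset (Fin n)) (h : Fin n → ℝ) :
    |tanhDev μ S h 0| ≤ √S.card * √(disorder μ r S h) := by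
  rw [← Real.sqrt_mul (Nat.cast_nonneg _)]
  apply Real.abs_le_sqrt
  rcases Nat.eq_zero_or_pos S.card with h0 | h0
  · have := abs_tanhDev_le μ S h 0
    rw [h0] at this ⊢
    have h1 : tanhDev μ S h 0 = 0 := abs_eq_zero.1 (le_antisymm (by simpa using this) (abs_nonneg _))
    simp [h1]
  · have h1 : (0 : ℝ) < S.card := by exact_mod_cast h0
    have h2 := (summable_disorder μ hr hr1 S h).le_tsum 0
      fun j _ => disorder_term_nonneg μ hr S h j
    have h3 : tanhDev μ S h 0 ^ 2 / S.card ≤ disorder μ r S h := by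
      unfold disorder; simp only [pow_zero, one_mul] at h2; linarith
    rw [div_le_iff₀ h1] at h3
    linarith

lemma hasSum_log_one_add_mul {t a : ℝ} (ht : |t * a| < 1) :
    HasSum (fun j : ℕ => (-1) ^ j * t ^ (j + 1) / (j + 1) * a ^ (j + 1)) (Real.log (1 + t * a)) := by
  have h := (Real.hasSum_pow_div_log_of_abs_lt_one (x := -(t * a)) (by rwa [abs_neg])).mul_left (-1)
  convert! h using 1
  · ext j
    rw [neg_pow (t * a), mul_pow, pow_succ (-1 : ℝ) j]
    ring
  · rw [sub_neg_eq_add]; ring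

lemma abs_log_coeff_le {t r : ℝ} (htr : |t| ≤ r) (j : ℕ) :
    |(-1) ^ j * t ^ (j + 1) / ((j : ℝ) + 1)| ≤ r ^ (j + 1) := by
  rw [abs_div, abs_mul, abs_pow, abs_neg, abs_one, one_pow, one_mul, abs_pow,
    abs_of_pos (by positivity : (0 : ℝ) < j + 1)]
  calc |t| ^ (j + 1) / ((j : ℝ) + 1) ≤ |t| ^ (j + 1) / 1 := by
        gcongr; linarith [(Nat.cast_nonneg j : (0 : ℝ) ≤ j)]
    _ ≤ _ := by rw [div_one]; gcongr

lemma hasSum_integral_log (μ : Measure ℝ) [IsProbabilityMeasure μ] {t r : ℝ}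
    (hr1 : r < 1) (htr : |t| ≤ r) :
    HasSum (fun j : ℕ => (-1) ^ j * t ^ (j + 1) / (j + 1) * ∫ a, Real.tanh a ^ (j + 1) ∂μ)
      (∫ a, Real.log (1 + t * Real.tanh a) ∂μ) := by
  have hr : 0 ≤ r := (abs_nonneg _).trans htr
  have hb : ∀ (j : ℕ) (a : ℝ), ‖(-1) ^ j * t ^ (j + 1) / ((j : ℝ) + 1) * Real.tanh a ^ (j + 1)‖
      ≤ r ^ (j + 1) := fun j a => by
    rw [norm_mul, Real.norm_eq_abs, Real.norm_eq_abs, abs_pow]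
    calc _ ≤ r ^ (j + 1) * 1 := by
          gcongr
          · exact abs_log_coeff_le htr j
          · exact pow_le_one₀ (abs_nonneg _) (Real.abs_tanh_lt_one a).le
      _ = _ := mul_one _
  have hsum : Summable fun j : ℕ => r ^ (j + 1) :=
    (summable_nat_add_iff 1).2 (summable_geometric_of_lt_one hr hr1)
  have hc := continuous_tanh
  have h := hasSum_integral_of_dominated_convergence (μ := μ)
    (F := fun (j : ℕ) a => (-1) ^ j * t ^ (j + 1) / ((j : ℝ) + 1) * Real.tanh a ^ (j + 1))
    (f := fun a => Real.log (1 + t * Real.tanh a)) (fun j _ => r ^ (j + 1))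
    (fun j => by fun_prop) (fun j => ae_of_all _ (hb j)) (ae_of_all _ fun _ => hsum)
    (integrable_const _) (ae_of_all _ fun a => hasSum_log_one_add_mul (by
      rw [abs_mul]
      exact mul_lt_one_of_nonneg_of_lt_one_left (abs_nonneg _) (htr.trans_lt hr1)
        (Real.abs_tanh_lt_one a).le))
  simpa only [integral_const_mul] using h

/-- The fluctuations of the energy beyond first order. -/
lemma abs_log_fluctuation_le {n : ℕ} (μ : Measure ℝ) [IsProbabilityMeasure μ] {t r : ℝ}
    (hr0 : 0 < r) (hr1 : r < 1) (htr : |t| ≤ r) (S : Finset (Fin n)) (h : Fin n → ℝ)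
    (hS : 0 < S.card) :
    |∑ i ∈ S, Real.log (1 + t * Real.tanh (h i))
        - S.card * ∫ a, Real.log (1 + t * Real.tanh a) ∂μ - t * tanhDev μ S h 0|
      ≤ (1 / (1 - r) + 1 / r) * t ^ 2 * (√S.card * √(disorder μ r S h)) := by
  have hSpos : (0 : ℝ) < S.card := by exact_mod_cast hS
  have h1 : HasSum (fun j : ℕ => (-1) ^ j * t ^ (j + 1) / (j + 1) * tanhDev μ S h j)
      (∑ i ∈ S, Real.log (1 + t * Real.tanh (h i))
        - S.card * ∫ a, Real.log (1 + t * Real.tanh a) ∂μ) := by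
    have e1 : HasSum (fun j : ℕ => ∑ i ∈ S,
        ((-1) ^ j * t ^ (j + 1) / (j + 1) * Real.tanh (h i) ^ (j + 1)))
        (∑ i ∈ S, Real.log (1 + t * Real.tanh (h i))) :=
      hasSum_sum fun i _ => hasSum_log_one_add_mul (by
        rw [abs_mul]
        exact mul_lt_one_of_nonneg_of_lt_one_left (abs_nonneg _) (htr.trans_lt hr1)
          (Real.abs_tanh_lt_one _).le)
    have e2 := (hasSum_integral_log μ hr1 htr).mul_left (S.card : ℝ)
    convert! e1.sub e2 using 1
    ext j
    rw [tanhDev, mul_sub, Finset.mul_sum]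
    ring
  -- The term j = 0 is exactly the linear tilt; all the others carry a factor t².
  have h2 := (hasSum_nat_add_iff' 1).2 h1
  simp only [Finset.sum_range_one, pow_zero, one_mul, zero_add, pow_one, Nat.cast_zero, div_one,
    Nat.cast_add, Nat.cast_one] at h2
  set U := disorder μ r S h with hU
  have hU1 : 1 ≤ U := one_le_disorder μ hr0.le S h
  set δ := √S.card * √U with hδ
  have hδ0 : 0 < δ := by positivity
  have hδ2 : δ ^ 2 = S.card * U := by
    rw [hδ, mul_pow, Real.sq_sqrt hSpos.le, Real.sq_sqrt (by linarith)]
  have hd := (summable_nat_add_iff 1).2 (summable_disorder μ hr0.le hr1 S h)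
  have hdle : ∑' j, r ^ (j + 1) * (tanhDev μ S h (j + 1) ^ 2 / S.card) ≤ U := by
    have := (summable_disorder μ hr0.le hr1 S h).tsum_eq_zero_add
    have h0 := disorder_term_nonneg μ hr0.le S h 0
    rw [hU, disorder]
    linarith
  have hg := summable_geometric_of_lt_one hr0.le hr1
  have hbs : Summable fun j => t ^ 2 * (δ * r ^ j
      + S.card / (r * δ) * (r ^ (j + 1) * (tanhDev μ S h (j + 1) ^ 2 / S.card))) :=
    ((hg.mul_left _).add (hd.mul_left _)).mul_left _
  have hterm : ∀ j : ℕ, ‖(-1) ^ (j + 1) * t ^ (j + 1 + 1) / ((j : ℝ) + 1 + 1)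
      * tanhDev μ S h (j + 1)‖ ≤ t ^ 2 * (δ * r ^ j
      + S.card / (r * δ) * (r ^ (j + 1) * (tanhDev μ S h (j + 1) ^ 2 / S.card))) := by
    intro j
    rw [norm_mul, Real.norm_eq_abs, Real.norm_eq_abs]
    set d := |tanhDev μ S h (j + 1)| with hdd
    have a1 : |(-1) ^ (j + 1) * t ^ (j + 1 + 1) / ((j : ℝ) + 1 + 1)| ≤ t ^ 2 * r ^ j := by
      rw [abs_div, abs_mul, abs_pow, abs_neg, abs_one, one_pow, one_mul, abs_pow,
        abs_of_pos (by positivity : (0 : ℝ) < j + 1 + 1)]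
      calc |t| ^ (j + 1 + 1) / ((j : ℝ) + 1 + 1) ≤ |t| ^ (j + 1 + 1) / 1 := by
            gcongr; linarith [(Nat.cast_nonneg j : (0 : ℝ) ≤ j)]
        _ = |t| ^ 2 * |t| ^ j := by rw [div_one]; ring
        _ ≤ _ := by rw [sq_abs]; gcongr
    -- AM–GM at the scale δ = √(k U) trades each fluctuation for its square. After summation with
    -- geometric weights both parts are of order δ, so one quantity U controls the whole series for
    -- every |t| ≤ r.
    have a2 : d ≤ δ + d ^ 2 / δ := by
      have : d * δ ≤ δ ^ 2 + d ^ 2 := by nlinarith [sq_nonneg (d - δ), sq_nonneg d, sq_nonneg δ]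
      have h3 : δ + d ^ 2 / δ = (δ ^ 2 + d ^ 2) / δ := by field_simp
      rw [h3, le_div_iff₀ hδ0]
      exact this
    calc _ ≤ t ^ 2 * r ^ j * (δ + d ^ 2 / δ) := by gcongr
      _ = _ := by
        rw [hdd, sq_abs]; field_simp; ring
  have h3 := tsum_of_norm_bounded hbs.hasSum hterm
  rw [h2.tsum_eq, tsum_mul_left, (hg.mul_left _).tsum_add (hd.mul_left _), tsum_mul_left,
    tsum_mul_left, tsum_geometric_of_lt_one hr0.le hr1] at h3
  rw [Real.norm_eq_abs] at h3
  refine h3.trans ?_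
  have h4 : S.card / (r * δ) * ∑' j, r ^ (j + 1) * (tanhDev μ S h (j + 1) ^ 2 / S.card)
      ≤ 1 / r * δ := by
    calc _ ≤ S.card / (r * δ) * U := by gcongr
      _ = 1 / r * (δ ^ 2 / δ) := by rw [hδ2]; field_simp
      _ = _ := by field_simp
  calc t ^ 2 * (δ * (1 - r)⁻¹ + S.card / (r * δ) *
        ∑' j, r ^ (j + 1) * (tanhDev μ S h (j + 1) ^ 2 / S.card))
      ≤ t ^ 2 * (δ * (1 - r)⁻¹ + 1 / r * δ) := by gcongr
    _ = _ := by rw [one_div (1 - r)]; ring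

/-! ### The population function -/

lemma integral_comp_neg_of_symm {μ : Measure ℝ} (hsymm : μ.map (fun h : ℝ => -h) = μ)
    (f : ℝ → ℝ) : ∫ a, f (-a) ∂μ = ∫ a, f a ∂μ := by
  have h1 : μ.map (Homeomorph.neg ℝ).toMeasurableEquiv = μ := hsymm
  conv_rhs => rw [← h1]
  rw [integral_map_equiv]
  rfl

lemma integral_tanh_eq_zero {μ : Measure ℝ} (hsymm : μ.map (fun h : ℝ => -h) = μ) :
    ∫ a, Real.tanh a ∂μ = 0 := by
  have h := integral_comp_neg_of_symm hsymm Real.tanh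
  simp only [Real.tanh_neg, integral_neg] at h
  linarith

lemma tanhDev_zero {n : ℕ} {μ : Measure ℝ} (hsymm : μ.map (fun h : ℝ => -h) = μ)
    (S : Finset (Fin n)) (h : Fin n → ℝ) : tanhDev μ S h 0 = ∑ i ∈ S, Real.tanh (h i) := by
  simp [tanhDev, integral_tanh_eq_zero hsymm]

lemma integrable_log_cosh_add {μ : Measure ℝ} [IsProbabilityMeasure μ]
    (hint : Integrable (fun h : ℝ => h) μ) (s : ℝ) :
    Integrable (fun a => Real.log (Real.cosh (s + a))) μ := by
  refine Integrable.mono' ((integrable_const |s|).add hint.abs)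
    (continuous_log_cosh.comp (by fun_prop : Continuous fun a => s + a)).aestronglyMeasurable
    (ae_of_all _ fun a => ?_)
  have h1 := abs_log_cosh_sub_le (s + a) 0
  simp only [Real.cosh_zero, Real.log_one, sub_zero] at h1
  exact h1.trans (abs_add_le _ _)

lemma potential_sub {μ : Measure ℝ} [IsProbabilityMeasure μ]
    (hint : Integrable (fun h : ℝ => h) μ) (θ x : ℝ) :
    potential μ θ x - potential μ θ 0 = x ^ 2 / 2 - Real.log (Real.cosh (√θ * x))
      - ∫ a, Real.log (1 + Real.tanh (√θ * x) * Real.tanh a) ∂μ := by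
  have h0 := integrable_log_cosh_add hint 0
  have h1 := integrable_log_cosh_add hint (√θ * x)
  simp only [zero_add] at h0
  have h2 : ∫ a, Real.log (Real.cosh (√θ * x + a)) ∂μ - ∫ a, Real.log (Real.cosh a) ∂μ
      = Real.log (Real.cosh (√θ * x))
        + ∫ a, Real.log (1 + Real.tanh (√θ * x) * Real.tanh a) ∂μ := by
    rw [← integral_sub h1 h0]
    have h3 : (fun a => Real.log (1 + Real.tanh (√θ * x) * Real.tanh a))
        = fun a => (Real.log (Real.cosh (√θ * x + a)) - Real.log (Real.cosh a))
          - Real.log (Real.cosh (√θ * x)) := by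
      ext a; rw [log_cosh_add]; ring
    have h4 : Integrable (fun a => Real.log (Real.cosh (√θ * x + a)) - Real.log (Real.cosh a)) μ :=
      h1.sub h0
    rw [h3, integral_sub h4 (integrable_const _)]
    simp
  unfold potential
  simp only [mul_zero, zero_add]
  linarith

lemma continuous_potential {μ : Measure ℝ} [IsProbabilityMeasure μ]
    (hint : Integrable (fun h : ℝ => h) μ) (θ : ℝ) : Continuous (potential μ θ) := by
  unfold potential
  refine Continuous.sub (by fun_prop) ?_
  have hL : LipschitzWith ⟨√θ, Real.sqrt_nonneg θ⟩
      (fun x => ∫ h, Real.log (Real.cosh (√θ * x + h)) ∂μ) := by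
    apply LipschitzWith.of_dist_le_mul
    intro x y
    rw [Real.dist_eq, ← integral_sub (integrable_log_cosh_add hint _)
      (integrable_log_cosh_add hint _), Real.dist_eq]
    have := norm_integral_le_of_norm_le_const (μ := μ) (C := √θ * |x - y|)
      (f := fun a => Real.log (Real.cosh (√θ * x + a)) - Real.log (Real.cosh (√θ * y + a)))
      (ae_of_all _ fun a => by
        refine (abs_log_cosh_sub_le _ _).trans_eq ?_
        rw [show √θ * x + a - (√θ * y + a) = √θ * (x - y) by ring, abs_mul,
          abs_of_nonneg (Real.sqrt_nonneg θ)])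
    rw [probReal_univ, mul_one] at this
    exact this
  exact hL.continuous

lemma sech_sq_le_one (a : ℝ) : (1 / Real.cosh a) ^ 2 ≤ 1 := by
  rw [div_pow, one_pow, div_le_one (by have := Real.cosh_pos a; positivity)]
  exact one_le_pow₀ (Real.one_le_cosh a)

lemma integrable_sech_sq (μ : Measure ℝ) [IsProbabilityMeasure μ] :
    Integrable (fun a => (1 / Real.cosh a) ^ 2) μ := by
  refine Integrable.mono' (integrable_const (1 : ℝ)) ?_ (ae_of_all _ fun a => ?_)
  · exact ((continuous_const.div Real.continuous_cosh
      fun x => (Real.cosh_pos x).ne').pow 2).aestronglyMeasurable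
  · rw [Real.norm_eq_abs, abs_of_nonneg (by positivity)]; exact sech_sq_le_one a

lemma meanSechSq_pos (μ : Measure ℝ) [IsProbabilityMeasure μ] : 0 < meanSechSq μ := by
  unfold meanSechSq
  rw [integral_pos_iff_support_of_nonneg (fun a => by positivity) (integrable_sech_sq μ)]
  have : Function.support (fun a => (1 / Real.cosh a) ^ 2) = Set.univ := by
    ext a
    have := Real.cosh_pos a
    simp [this.ne']
  rw [this]
  simp

/-- Averaging over h and -h turns the integrand into log(1 + sinh² s sech² h) ≥ u - u² with u =
sinh² s sech² h and s = √θ x. Since θ E[sech² h] = 1 and s² ≤ sinh² s, the quadratic part cancels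
x²/2 and only a quartic term survives. -/
lemma potential_sub_le {μ : Measure ℝ} [IsProbabilityMeasure μ]
    (hint : Integrable (fun h : ℝ => h) μ) (hsymm : μ.map (fun h : ℝ => -h) = μ)
    {θ : ℝ} (hcrit : θ = 1 / meanSechSq μ) (x : ℝ) :
    potential μ θ x - potential μ θ 0 ≤ Real.sinh (√θ * x) ^ 4 / 2 := by
  have hm := meanSechSq_pos μ
  have hθ : 0 < θ := by rw [hcrit]; positivity
  set s := √θ * x with hs
  have hs2 : s ^ 2 = θ * x ^ 2 := by rw [hs, mul_pow, Real.sq_sqrt hθ.le]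
  set F : ℝ → ℝ := fun a => Real.log (1 + Real.tanh s * Real.tanh a) with hF
  have hFi : Integrable F μ := by
    have h0 := integrable_log_cosh_add hint 0
    have h1 := integrable_log_cosh_add hint s
    simp only [zero_add] at h0
    have h3 : F = fun a => (Real.log (Real.cosh (s + a)) - Real.log (Real.cosh a))
        - Real.log (Real.cosh s) := by
      ext a; rw [log_cosh_add, hF]; ring
    rw [h3]
    exact (h1.sub h0).sub (integrable_const _)
  have hFneg : ∫ a, F (-a) ∂μ = ∫ a, F a ∂μ := integral_comp_neg_of_symm hsymm F
  have hFni : Integrable (fun a => F (-a)) μ := by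
    have h1 : Integrable F (μ.map (Homeomorph.neg ℝ).toMeasurableEquiv) := by
      have : μ.map (Homeomorph.neg ℝ).toMeasurableEquiv = μ := hsymm
      rwa [this]
    exact (integrable_map_equiv _ _).1 h1
  have hpt : ∀ a, Real.sinh s ^ 2 * (1 / Real.cosh a) ^ 2 - Real.sinh s ^ 4
      ≤ 2 * Real.log (Real.cosh s) + (F a + F (-a)) := by
    intro a
    have p1 := one_add_tanh_mul_tanh_pos s a
    have p2 := one_add_tanh_mul_tanh_pos s (-a)
    have ps := Real.cosh_pos s
    have pa := Real.cosh_pos a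
    set q := (1 / Real.cosh a) ^ 2 with hq
    have hq0 : 0 ≤ q := by positivity
    have hq1 : q ≤ 1 := sech_sq_le_one a
    set u := Real.sinh s ^ 2 * q with hu
    have hu0 : 0 ≤ u := by positivity
    have e1 : 2 * Real.log (Real.cosh s) + (F a + F (-a)) = Real.log (1 + u) := by
      have : 2 * Real.log (Real.cosh s) = Real.log (Real.cosh s ^ 2) := by
        rw [Real.log_pow]; norm_num
      rw [this, hF]
      dsimp only
      rw [← Real.log_mul p1.ne' p2.ne', ← Real.log_mul (by positivity) (mul_pos p1 p2).ne']
      congr 1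
      rw [Real.tanh_neg, Real.tanh_eq_sinh_div_cosh, Real.tanh_eq_sinh_div_cosh, hu, hq]
      field_simp
      rw [show Real.sinh s ^ 2 = Real.cosh s ^ 2 - 1 from Real.sinh_sq s]
      have h5 : Real.sinh a ^ 2 = Real.cosh a ^ 2 - 1 := Real.sinh_sq a
      have h6 : Real.sinh s ^ 2 = Real.cosh s ^ 2 - 1 := Real.sinh_sq s
      linear_combination (-(Real.sinh s ^ 2)) * h5 + (1 - Real.cosh a ^ 2) * h6
    rw [e1]
    have h2 := Real.one_sub_inv_le_log_of_pos (show 0 < 1 + u by linarith)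
    have h3 : u - u ^ 2 ≤ 1 - (1 + u)⁻¹ := by
      have : 1 - (1 + u)⁻¹ = u / (1 + u) := by field_simp; ring
      rw [this, le_div_iff₀ (by linarith)]
      nlinarith [pow_nonneg hu0 3]
    have h4 : u ^ 2 ≤ Real.sinh s ^ 4 := by
      have : u ≤ Real.sinh s ^ 2 := by
        rw [hu]; exact mul_le_of_le_one_right (sq_nonneg _) hq1
      calc u ^ 2 ≤ (Real.sinh s ^ 2) ^ 2 := by gcongr
        _ = _ := by ring
    linarith
  have hI := integral_mono (μ := μ)
    (((integrable_sech_sq μ).const_mul (Real.sinh s ^ 2)).sub (integrable_const _))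
    ((integrable_const _).add (hFi.add hFni)) hpt
  have e2 : ∫ a, (Real.sinh s ^ 2 * (1 / Real.cosh a) ^ 2 - Real.sinh s ^ 4) ∂μ
      = Real.sinh s ^ 2 * meanSechSq μ - Real.sinh s ^ 4 := by
    rw [integral_sub ((integrable_sech_sq μ).const_mul _) (integrable_const _),
      integral_const_mul]
    simp [meanSechSq]
  have e3 : ∫ a, (2 * Real.log (Real.cosh s) + (F a + F (-a))) ∂μ
      = 2 * Real.log (Real.cosh s) + 2 * ∫ a, F a ∂μ := by
    have hsum : Integrable (fun a => F a + F (-a)) μ := hFi.add hFni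
    rw [integral_add (integrable_const _) hsum, integral_add hFi hFni, hFneg]
    simp only [integral_const, probReal_univ, one_smul]
    ring
  have hI' : Real.sinh s ^ 2 * meanSechSq μ - Real.sinh s ^ 4
      ≤ 2 * Real.log (Real.cosh s) + 2 * ∫ a, F a ∂μ := by
    rw [← e2, ← e3]; exact hI
  rw [potential_sub hint]
  have h5 : s ^ 2 ≤ Real.sinh s ^ 2 := by
    rw [← sq_abs s, ← sq_abs (Real.sinh s), Real.abs_sinh]
    gcongr
    exact Real.self_le_sinh_iff.2 (abs_nonneg s)
  have h6 : x ^ 2 ≤ Real.sinh s ^ 2 * meanSechSq μ := by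
    calc x ^ 2 = s ^ 2 * meanSechSq μ := by rw [hs2, hcrit]; field_simp
      _ ≤ _ := by gcongr
  change x ^ 2 / 2 - Real.log (Real.cosh s) - ∫ a, F a ∂μ ≤ _
  linarith

lemma sinh_pow_four_le {s : ℝ} (h : |s| ≤ 1) : Real.sinh s ^ 4 ≤ 81 * s ^ 4 := by
  have hc : Real.cosh s ≤ 3 := by
    refine (Real.cosh_le_exp_half_sq s).trans ?_
    have h1 : s ^ 2 / 2 ≤ 1 := by
      have : s ^ 2 ≤ 1 := by rw [← sq_abs]; exact pow_le_one₀ (abs_nonneg _) h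
      linarith
    exact (Real.exp_le_exp.2 h1).trans Real.exp_one_lt_three.le
  have h1 : |Real.sinh s| ≤ 3 * |s| := by
    have e : Real.sinh s = Real.tanh s * Real.cosh s := by
      rw [Real.tanh_eq_sinh_div_cosh, div_mul_cancel₀ _ (Real.cosh_pos s).ne']
    rw [e, abs_mul, abs_of_pos (Real.cosh_pos s)]
    have := mul_le_mul (abs_tanh_le s) hc (Real.cosh_pos s).le (abs_nonneg s)
    linarith
  calc Real.sinh s ^ 4 = |Real.sinh s| ^ 4 := by rw [Even.pow_abs ⟨2, rfl⟩]
    _ ≤ (3 * |s|) ^ 4 := by gcongr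
    _ = 81 * s ^ 4 := by rw [mul_pow, Even.pow_abs ⟨2, rfl⟩]; norm_num

/-- The flatness coefficient `H^{(2τ)}(0) / (2τ)!`. -/
def flatCoeff (μ : Measure ℝ) (θ : ℝ) (τ : ℕ) : ℝ :=
  iteratedDeriv (2 * τ) (potential μ θ) 0 / (Nat.factorial (2 * τ) : ℝ)

lemma flatCoeff_pos {μ : Measure ℝ} {θ : ℝ} {τ : ℕ} (hflat : HasFlatMinimum (potential μ θ) τ) :
    0 < flatCoeff μ θ τ :=
  div_pos hflat.2.1 (by positivity)

lemma exists_flat_expansion {μ : Measure ℝ} {θ : ℝ} {τ : ℕ}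
    (hflat : HasFlatMinimum (potential μ θ) τ) :
    ∃ C δ : ℝ, 0 < C ∧ 0 < δ ∧ ∀ x, |x| ≤ δ →
      |potential μ θ x - potential μ θ 0 - flatCoeff μ θ τ * x ^ (2 * τ)|
        ≤ C * |x| ^ (2 * τ + 1) := by
  obtain ⟨C, hC, hb⟩ := hflat.2.2.exists_pos
  obtain ⟨δ, hδ, hball⟩ := Metric.eventually_nhds_iff.1 hb.bound
  refine ⟨C, δ / 2, hC, by positivity, fun x hx => ?_⟩
  have := hball (y := x) (by rw [Real.dist_eq, sub_zero]; linarith)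
  rw [Real.norm_eq_abs, Real.norm_eq_abs, abs_pow] at this
  exact this

/-- The quartic upper bound at criticality is incompatible with a positive quadratic coefficient,
which excludes τ = 1. For τ = 0 the derivative of order zero would give H(0) > 0, whereas H(0) =
-E[log cosh h] ≤ 0. -/
lemma two_le_flatness {μ : Measure ℝ} [IsProbabilityMeasure μ]
    (hint : Integrable (fun h : ℝ => h) μ) (hsymm : μ.map (fun h : ℝ => -h) = μ)
    {θ : ℝ} (hcrit : θ = 1 / meanSechSq μ) {τ : ℕ}
    (hflat : HasFlatMinimum (potential μ θ) τ) : 2 ≤ τ := by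
  have hm := meanSechSq_pos μ
  have hθ : 0 < θ := by rw [hcrit]; positivity
  by_contra hcon
  have hτ : τ = 0 ∨ τ = 1 := by omega
  rcases hτ with rfl | rfl
  · have h1 := hflat.2.1
    simp only [mul_zero, iteratedDeriv_zero, potential] at h1
    have h2 : 0 ≤ ∫ h, Real.log (Real.cosh (0 + h)) ∂μ :=
      integral_nonneg fun a => Real.log_nonneg (Real.one_le_cosh _)
    norm_num at h1 h2
    linarith
  · obtain ⟨C, δ, hC, hδ, hexp⟩ := exists_flat_expansion hflat
    have hc := flatCoeff_pos hflat
    set c := flatCoeff μ θ 1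
    -- Half of the bound sinh⁴ s ≤ 81 s⁴, rounded up from 81/2, plus the constant of the Taylor
    -- remainder.
    set B := 41 * θ ^ 2 + C with hB
    have hB0 : 0 < B := by positivity
    have hsq : 0 < √θ := Real.sqrt_pos.2 hθ
    set x := min (min δ 1) (min (1 / √θ) (c / (2 * B))) with hx
    have hx0 : 0 < x := by positivity
    have hxδ : x ≤ δ := (min_le_left _ _).trans (min_le_left _ _)
    have hx1 : x ≤ 1 := (min_le_left _ _).trans (min_le_right _ _)
    have hxθ : x ≤ 1 / √θ := (min_le_right _ _).trans (min_le_left _ _)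
    have hxB : x ≤ c / (2 * B) := (min_le_right _ _).trans (min_le_right _ _)
    have h1 := (abs_le.1 (hexp x (by rwa [abs_of_pos hx0]))).1
    have h2 := potential_sub_le hint hsymm hcrit x
    have h3 := sinh_pow_four_le (s := √θ * x) (by
      rw [abs_of_pos (by positivity)]
      rw [le_div_iff₀ hsq] at hxθ; linarith)
    have h4 : (√θ * x) ^ 4 = θ ^ 2 * x ^ 4 := by
      rw [mul_pow, show √θ ^ 4 = (√θ ^ 2) ^ 2 by ring, Real.sq_sqrt hθ.le]
    rw [h4] at h3
    rw [abs_of_pos hx0] at h1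
    norm_num at h1
    have h5 : x ^ 4 ≤ x ^ 3 := pow_le_pow_of_le_one hx0.le hx1 (by norm_num)
    have h6 : c * x ^ 2 ≤ B * x ^ 3 := by
      have : θ ^ 2 * x ^ 4 ≤ θ ^ 2 * x ^ 3 := by gcongr
      have h7 : 0 ≤ θ ^ 2 * x ^ 3 := by positivity
      rw [hB]; nlinarith
    have h7 : c ≤ B * x := by
      have : c * x ^ 2 ≤ (B * x) * x ^ 2 := by linarith
      exact le_of_mul_le_mul_right this (by positivity)
    rw [le_div_iff₀ (by positivity)] at hxB
    linarith

/-- Near 0 the expansion gives half of the flatness coefficient; on the rest of [-R, R] uniqueness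
of the minimum and compactness give a positive lower bound. -/
lemma exists_potential_lower {μ : Measure ℝ} [IsProbabilityMeasure μ]
    (hint : Integrable (fun h : ℝ => h) μ) {θ : ℝ} {τ : ℕ}
    (hflat : HasFlatMinimum (potential μ θ) τ) (R : ℝ) :
    ∃ c : ℝ, 0 < c ∧ ∀ x, |x| ≤ R →
      c * x ^ (2 * τ) ≤ potential μ θ x - potential μ θ 0 := by
  obtain ⟨C, δ, hC, hδ, hexp⟩ := exists_flat_expansion hflat
  have ha := flatCoeff_pos hflat
  set a := flatCoeff μ θ τ
  set d := min δ (a / (2 * C)) with hd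
  have hd0 : 0 < d := by positivity
  have hnear : ∀ x, |x| ≤ d → a / 2 * x ^ (2 * τ) ≤ potential μ θ x - potential μ θ 0 := by
    intro x hx
    have h1 := (abs_le.1 (hexp x (hx.trans (min_le_left _ _)))).1
    have h2 : C * |x| ≤ a / 2 := by
      have := hx.trans (min_le_right _ _)
      rw [le_div_iff₀ (by positivity)] at this
      linarith
    have h3 : |x| ^ (2 * τ) = x ^ (2 * τ) := Even.pow_abs ⟨τ, by ring⟩ x
    have h4 : C * |x| ^ (2 * τ + 1) ≤ a / 2 * x ^ (2 * τ) := by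
      rw [pow_succ, h3]
      have h5 : 0 ≤ x ^ (2 * τ) := by rw [← h3]; positivity
      nlinarith
    linarith
  have hcont := continuous_potential hint θ
  have hK : IsCompact (Set.Icc (-R) R ∩ {x : ℝ | d ≤ |x|}) :=
    isCompact_Icc.inter_right (isClosed_le continuous_const continuous_abs)
  have hfar : ∃ m : ℝ, 0 < m ∧ ∀ x, |x| ≤ R → d ≤ |x| →
      m ≤ potential μ θ x - potential μ θ 0 := by
    rcases (Set.Icc (-R) R ∩ {x : ℝ | d ≤ |x|}).eq_empty_or_nonempty with he | hne
    · refine ⟨1, one_pos, fun x h1 h2 => ?_⟩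
      have : x ∈ Set.Icc (-R) R ∩ {x : ℝ | d ≤ |x|} := ⟨abs_le.1 h1, h2⟩
      rw [he] at this
      exact this.elim
    · obtain ⟨z, hz, hmin⟩ := hK.exists_isMinOn hne
        (f := fun x => potential μ θ x - potential μ θ 0) (by fun_prop)
      refine ⟨potential μ θ z - potential μ θ 0, ?_, fun x h1 h2 => hmin
        (show x ∈ Set.Icc (-R) R ∩ {x : ℝ | d ≤ |x|} from ⟨abs_le.1 h1, h2⟩)⟩
      have hz0 : z ≠ 0 := by
        rintro rfl
        have : d ≤ |(0 : ℝ)| := hz.2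
        rw [abs_zero] at this; linarith
      linarith [hflat.1 z hz0]
  obtain ⟨m, hm, hfar⟩ := hfar
  refine ⟨min (a / 2) (m / (|R| + 1) ^ (2 * τ)), by positivity, fun x hx => ?_⟩
  have h3 : |x| ^ (2 * τ) = x ^ (2 * τ) := Even.pow_abs ⟨τ, by ring⟩ x
  have h5 : 0 ≤ x ^ (2 * τ) := by rw [← h3]; positivity
  rcases le_total |x| d with h | h
  · exact (mul_le_mul_of_nonneg_right (min_le_left _ _) h5).trans (hnear x h)
  · refine (mul_le_mul_of_nonneg_right (min_le_right _ _) h5).trans ?_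
    refine le_trans ?_ (hfar x hx h)
    rw [div_mul_eq_mul_div, div_le_iff₀ (by positivity), ← h3]
    have : |x| ≤ |R| + 1 := by linarith [le_abs_self R]
    gcongr

/-- The population part and the linear tilt are separated from an error quadratic in tanh(√θ x),
which is of lower order than the tilt at the critical scale. -/
lemma abs_fieldEnergy_sub_le {μ : Measure ℝ} [IsProbabilityMeasure μ]
    (hint : Integrable (fun h : ℝ => h) μ) {θ r : ℝ} {n : ℕ} (S : Finset (Fin n)) (h : Fin n → ℝ)
    (hS : 0 < S.card) (hr0 : 0 < r) (hr1 : r < 1) {x : ℝ} (hx : |Real.tanh (√θ * x)| ≤ r) :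
    |fieldEnergy θ S h x - S.card * (potential μ θ x - potential μ θ 0)
        + Real.tanh (√θ * x) * tanhDev μ S h 0|
      ≤ (1 / (1 - r) + 1 / r) * Real.tanh (√θ * x) ^ 2 * (√S.card * √(disorder μ r S h)) := by
  have h1 := abs_log_fluctuation_le μ hr0 hr1 hx S h hS
  rw [← abs_neg] at h1
  refine le_trans (le_of_eq ?_) h1
  congr 1
  rw [potential_sub hint, fieldEnergy]
  have h2 : ∑ i ∈ S, (Real.log (Real.cosh (√θ * x + h i)) - Real.log (Real.cosh (h i)))
      = S.card * Real.log (Real.cosh (√θ * x))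
        + ∑ i ∈ S, Real.log (1 + Real.tanh (√θ * x) * Real.tanh (h i)) := by
    rw [← nsmul_eq_mul, ← Finset.sum_const, ← Finset.sum_add_distrib]
    exact Finset.sum_congr rfl fun i _ => log_cosh_add _ _
  rw [h2]
  ring

/-- At the scale `k = l ^ (4 p + 2)`, the rescaled random energy satisfies the bounds and the
approximation that are needed for the Laplace method. -/
theorem exists_energyBounds {μ : Measure ℝ} [IsProbabilityMeasure μ]
    (hint : Integrable (fun h : ℝ => h) μ)
    {θ : ℝ} (hθ : 0 < θ) (p : ℕ) (hflat : HasFlatMinimum (potential μ θ) (p + 1)) :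
    ∃ r c₁ C R : ℝ, ∃ η L₀ : ℝ → ℝ, 0 < r ∧ r < 1 ∧ 0 < c₁ ∧
      ∀ (n : ℕ) (S : Finset (Fin n)) (h : Fin n → ℝ) (l : ℝ), 0 < S.card → 1 ≤ l →
        l ^ (4 * p + 2) = S.card →
        EnergyBounds p c₁ C R l (√(disorder μ r S h)) (fun y => fieldEnergy θ S h (y / l)) ∧
        |√θ * (tanhDev μ S h 0 / √S.card)| ≤ C * √(disorder μ r S h) ∧
        ∀ Y, L₀ Y ≤ l → ∀ y, |y| ≤ Y →
          |fieldEnergy θ S h (y / l) - l ^ (2 * p) * (flatCoeff μ θ (p + 1) * y ^ (2 * p + 2)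
            - √θ * (tanhDev μ S h 0 / √S.card) * y)|
            ≤ l ^ (2 * p) * (η Y * √(disorder μ r S h) / l) := by
  have hsq : 0 < √θ := Real.sqrt_pos.2 hθ
  set R := 4 * √θ with hR
  have hR0 : 0 < R := by positivity
  set r := Real.tanh (√θ * R) with hr
  have hr0 : 0 < r := by
    rw [hr, Real.tanh_eq_sinh_div_cosh]
    exact div_pos (Real.sinh_pos_iff.2 (by positivity)) (Real.cosh_pos _)
  have hr1 : r < 1 := Real.tanh_lt_one _
  obtain ⟨c₁, hc₁, hlow⟩ := exists_potential_lower hint hflat R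
  obtain ⟨C₀, δ, hC₀, hδ, hexp⟩ := exists_flat_expansion hflat
  set Cr := 1 / (1 - r) + 1 / r with hCr
  have hCr0 : 0 < Cr := by
    have : 0 < 1 - r := by linarith
    positivity
  set c := flatCoeff μ θ (p + 1)
  -- η collects the Taylor remainder of the potential, the error of linearizing tanh and the
  -- second-order fluctuations. The threshold on l puts y/l inside the radius of the expansion,
  -- inside |√θ x| ≤ 1 and inside the bulk.
  refine ⟨r, c₁, (1 + Cr) * √θ, R, fun Y => C₀ * |Y| ^ (2 * p + 3) + (1 + Cr) * θ * Y ^ 2,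
    fun Y => Y / min (min δ (1 / √θ)) R, hr0, hr1, hc₁, fun n S h l hS hl hlk => ?_⟩
  have hl0 : 0 < l := by linarith
  have hk : (0 : ℝ) < S.card := by exact_mod_cast hS
  have hsk : √(S.card : ℝ) = l ^ (2 * p + 1) := by
    rw [← hlk, show l ^ (4 * p + 2) = (l ^ (2 * p + 1)) ^ 2 by rw [← pow_mul]; ring_nf,
      Real.sqrt_sq (by positivity)]
  set U := disorder μ r S h with hU
  have hU1 : 1 ≤ U := one_le_disorder μ hr0.le S h
  set u := √U with hu
  have hu1 : 1 ≤ u := Real.one_le_sqrt.2 hU1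
  have hdev : |tanhDev μ S h 0| ≤ l ^ (2 * p + 1) * u := by
    rw [← hsk]; exact abs_tanhDev_zero_le μ hr0.le hr1 S h
  have hfl : ∀ y, |y| ≤ R * l → |fieldEnergy θ S h (y / l)
      - S.card * (potential μ θ (y / l) - potential μ θ 0)
      + Real.tanh (√θ * (y / l)) * tanhDev μ S h 0|
      ≤ Cr * Real.tanh (√θ * (y / l)) ^ 2 * (l ^ (2 * p + 1) * u) := by
    intro y hy
    rw [← hsk]
    apply abs_fieldEnergy_sub_le hint S h hS hr0 hr1
    apply abs_tanh_le_tanh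
    rw [abs_mul, abs_of_pos hsq, abs_div, abs_of_pos hl0]
    gcongr
    rwa [div_le_iff₀ hl0]
  refine ⟨⟨?_, ?_, ?_, ?_⟩, ?_, ?_⟩
  · exact (continuous_fieldEnergy θ S h).comp (by fun_prop)
  · intro y hy
    have h1 := (abs_le.1 (hfl y hy)).1
    have h2 := hlow (y / l) (by rwa [abs_div, abs_of_pos hl0, div_le_iff₀ hl0])
    set t := Real.tanh (√θ * (y / l)) with ht
    have ht1 : |t| ≤ √θ * (|y| / l) := by
      refine (abs_tanh_le _).trans_eq ?_
      rw [abs_mul, abs_of_pos hsq, abs_div, abs_of_pos hl0]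
    -- In the bulk only a crude lower bound is needed, so the quadratic fluctuation is merged with
    -- the linear one, using |tanh| < 1.
    have ht2 : t ^ 2 ≤ |t| := by
      rw [← sq_abs]
      have := (Real.abs_tanh_lt_one (√θ * (y / l))).le
      nlinarith [abs_nonneg t]
    have h3 : t * tanhDev μ S h 0 ≤ |t| * (l ^ (2 * p + 1) * u) := by
      refine (le_abs_self _).trans ?_
      rw [abs_mul]; gcongr
    have h4 : Cr * t ^ 2 * (l ^ (2 * p + 1) * u) ≤ Cr * |t| * (l ^ (2 * p + 1) * u) := by
      gcongr
    have h5 : (1 + Cr) * |t| * (l ^ (2 * p + 1) * u)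
        ≤ (1 + Cr) * (√θ * (|y| / l)) * (l ^ (2 * p + 1) * u) := by gcongr
    have h6 : (1 + Cr) * (√θ * (|y| / l)) * (l ^ (2 * p + 1) * u)
        = l ^ (2 * p) * ((1 + Cr) * √θ * u * |y|) := by
      rw [pow_succ]; field_simp
    have h7 : (S.card : ℝ) * (c₁ * (y / l) ^ (2 * (p + 1))) = l ^ (2 * p) * (c₁ * y ^ (2 * p + 2)) := by
      rw [← hlk, div_pow, show l ^ (4 * p + 2) = l ^ (2 * p) * l ^ (2 * (p + 1)) by
        rw [← pow_add]; ring_nf, show 2 * (p + 1) = 2 * p + 2 by ring]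
      field_simp
    have h8 := mul_le_mul_of_nonneg_left h2 hk.le
    rw [mul_sub]
    linarith
  · intro y hy
    have h1 := fieldEnergy_tail θ S h (x := y / l) (by
      rw [abs_div, abs_of_pos hl0, le_div_iff₀ hl0]; exact hy)
    refine le_trans (le_of_eq ?_) h1
    rw [← hlk, show l ^ (4 * p + 2) = (l ^ (2 * p)) ^ 2 * l ^ 2 by
      rw [← pow_mul, ← pow_add]; ring_nf]
    field_simp
  · intro y
    have h1 := fieldEnergy_symm θ S h (y / l)
    rw [neg_div]
    refine h1.trans (le_of_eq ?_)
    rw [← hlk, show l ^ (4 * p + 2) = (l ^ (2 * p)) ^ 2 * l ^ 2 by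
      rw [← pow_mul, ← pow_add]; ring_nf]
    field_simp
  · rw [abs_mul, abs_of_pos hsq, abs_div, hsk, abs_of_pos (by positivity : 0 < l ^ (2 * p + 1))]
    have h1 : |tanhDev μ S h 0| / l ^ (2 * p + 1) ≤ u := by
      rw [div_le_iff₀ (by positivity)]; linarith
    calc √θ * (|tanhDev μ S h 0| / l ^ (2 * p + 1)) ≤ √θ * u := by gcongr
      _ ≤ (1 + Cr) * √θ * u := by
        have : 0 ≤ Cr * √θ * u := by positivity
        linarith
  · intro Y hY y hy
    have hm : 0 < min (min δ (1 / √θ)) R := by positivity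
    rw [div_le_iff₀ hm] at hY
    have hyl : |y / l| ≤ min (min δ (1 / √θ)) R := by
      rw [abs_div, abs_of_pos hl0, div_le_iff₀ hl0]; linarith
    have hyδ : |y / l| ≤ δ := hyl.trans ((min_le_left _ _).trans (min_le_left _ _))
    have hyθ : |y / l| ≤ 1 / √θ := hyl.trans ((min_le_left _ _).trans (min_le_right _ _))
    have hyR : |y| ≤ R * l := by
      have := hyl.trans (min_le_right _ _)
      rwa [abs_div, abs_of_pos hl0, div_le_iff₀ hl0] at this
    have h1 := hfl y hyR
    have h2 := hexp (y / l) hyδ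
    set x := y / l with hx
    set t := Real.tanh (√θ * x) with ht
    set W := tanhDev μ S h 0 with hW
    set D := potential μ θ x - potential μ θ 0 with hD
    have hs1 : |√θ * x| ≤ 1 := by
      rw [abs_mul, abs_of_pos hsq]
      rw [le_div_iff₀ hsq] at hyθ; linarith
    have hs2 : |√θ * x| ^ 2 = θ * x ^ 2 := by rw [sq_abs, mul_pow, Real.sq_sqrt hθ.le]
    have ht2 : t ^ 2 ≤ θ * x ^ 2 := by
      rw [← hs2, ← sq_abs]
      have := abs_tanh_le (√θ * x)
      gcongr
    have hts : |t - √θ * x| ≤ θ * x ^ 2 := by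
      refine (abs_tanh_sub_self_le _).trans ?_
      rw [← hs2]
      exact pow_le_pow_of_le_one (abs_nonneg _) hs1 (by norm_num)
    have e1 : l ^ (2 * p) * (c * y ^ (2 * p + 2) - √θ * (W / √S.card) * y)
        = S.card * (c * x ^ (2 * (p + 1))) - (√θ * x) * W := by
      rw [hsk, ← hlk, hx, div_pow, show l ^ (4 * p + 2) = l ^ (2 * p) * l ^ (2 * (p + 1)) by
        rw [← pow_add]; ring_nf, show 2 * (p + 1) = 2 * p + 2 by ring, pow_succ l (2 * p)]
      field_simp
    have e2 : fieldEnergy θ S h x - l ^ (2 * p) * (c * y ^ (2 * p + 2) - √θ * (W / √S.card) * y)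
        = (fieldEnergy θ S h x - S.card * D + t * W)
          + S.card * (D - c * x ^ (2 * (p + 1))) - (t - √θ * x) * W := by
      rw [e1]; ring
    have b1 : |(S.card : ℝ) * (D - c * x ^ (2 * (p + 1)))| ≤
        l ^ (2 * p) * (C₀ * |Y| ^ (2 * p + 3) * u / l) := by
      rw [abs_mul, abs_of_pos hk]
      have hyY : |y| ≤ |Y| := hy.trans (le_abs_self Y)
      calc (S.card : ℝ) * |D - c * x ^ (2 * (p + 1))|
          ≤ S.card * (C₀ * |x| ^ (2 * (p + 1) + 1)) := by gcongr
        _ = l ^ (2 * p) * (C₀ * |y| ^ (2 * p + 3) / l) := by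
          rw [← hlk, hx, abs_div, abs_of_pos hl0, div_pow,
            show l ^ (4 * p + 2) = l ^ (2 * p) * l ^ (2 * p + 2) by rw [← pow_add]; ring_nf,
            show 2 * (p + 1) + 1 = 2 * p + 3 by ring, pow_succ l (2 * p + 2)]
          field_simp
        _ ≤ l ^ (2 * p) * (C₀ * |Y| ^ (2 * p + 3) / l) := by gcongr
        _ ≤ l ^ (2 * p) * (C₀ * |Y| ^ (2 * p + 3) * u / l) := by
          apply mul_le_mul_of_nonneg_left _ (by positivity)
          apply div_le_div_of_nonneg_right _ hl0.le
          exact le_mul_of_one_le_right (by positivity) hu1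
    have b0 : θ * x ^ 2 * (l ^ (2 * p + 1) * u) ≤ l ^ (2 * p) * (θ * Y ^ 2 * u / l) := by
      have hy2 : y ^ 2 ≤ Y ^ 2 := by
        rw [← sq_abs y, ← sq_abs Y]
        have hyY : |y| ≤ |Y| := hy.trans (le_abs_self Y)
        gcongr
      calc θ * x ^ 2 * (l ^ (2 * p + 1) * u) = l ^ (2 * p) * (θ * y ^ 2 * u / l) := by
            rw [hx, pow_succ]; field_simp; ring
        _ ≤ _ := by gcongr
    have b2 : |(t - √θ * x) * W| ≤ l ^ (2 * p) * (θ * Y ^ 2 * u / l) := by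
      refine le_trans ?_ b0
      rw [abs_mul]
      gcongr
    have b3 : Cr * t ^ 2 * (l ^ (2 * p + 1) * u) ≤ Cr * (l ^ (2 * p) * (θ * Y ^ 2 * u / l)) := by
      calc _ ≤ Cr * (θ * x ^ 2) * (l ^ (2 * p + 1) * u) := by gcongr
        _ = Cr * (θ * x ^ 2 * (l ^ (2 * p + 1) * u)) := by ring
        _ ≤ _ := by gcongr
    rw [e2]
    refine (abs_sub _ _).trans ?_
    refine (add_le_add_left (abs_add_le _ _) _).trans ?_
    calc _ ≤ Cr * (l ^ (2 * p) * (θ * Y ^ 2 * u / l)) + l ^ (2 * p) * (C₀ * |Y| ^ (2 * p + 3) * u / l)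
          + l ^ (2 * p) * (θ * Y ^ 2 * u / l) := by
          gcongr
          exact h1.trans b3
      _ = _ := by ring

/-! ### The disorder has bounded mean -/

lemma integral_sq_sum_centered {μ : Measure ℝ} [IsProbabilityMeasure μ] {n : ℕ}
    (S : Finset (Fin n)) {f : ℝ → ℝ} (hf : Continuous f) (hb : ∀ a, |f a| ≤ 1) :
    ∫ h : Fin n → ℝ, (∑ i ∈ S, f (h i) - S.card * ∫ a, f a ∂μ) ^ 2 ∂(Measure.pi fun _ => μ)
      = S.card * Var[f; μ] := by
  have hmem : MemLp f 2 μ := memLp_of_bounded (a := -1) (b := 1)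
    (ae_of_all _ fun a => abs_le.1 (hb a)) hf.aestronglyMeasurable 2
  set X : Fin n → ℝ → ℝ := fun i => if i ∈ S then f else 0 with hX
  have hXm : ∀ i, MemLp (X i) 2 μ := by
    intro i; rw [hX]; dsimp only; split_ifs
    · exact hmem
    · exact MemLp.zero
  have hXc : ∀ i, Continuous (X i) := by
    intro i; rw [hX]; dsimp only; split_ifs
    · exact hf
    · exact continuous_const
  have hXi : ∀ i, Integrable (X i) μ := fun i => (hXm i).integrable (by norm_num)
  have hsum : ∀ h : Fin n → ℝ, (∑ i, fun ω : Fin n → ℝ => X i (ω i)) h = ∑ i ∈ S, f (h i) := by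
    intro h
    rw [Finset.sum_apply]
    simp only [hX]
    rw [← Finset.sum_filter_add_sum_filter_not Finset.univ (fun i => i ∈ S)]
    rw [Finset.sum_congr rfl (g := fun i => f (h i)) (fun i hi => by
      rw [if_pos (Finset.mem_filter.1 hi).2]),
      Finset.sum_congr rfl (s₁ := Finset.univ.filter fun i => i ∉ S) (g := fun i => (0 : ℝ))
        (fun i hi => by rw [if_neg (Finset.mem_filter.1 hi).2]; rfl)]
    simp
  have hmean : ∫ h, (∑ i, fun ω : Fin n → ℝ => X i (ω i)) h ∂(Measure.pi fun _ => μ)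
      = S.card * ∫ a, f a ∂μ := by
    simp_rw [Finset.sum_apply]
    rw [integral_finsetSum _ fun i _ => integrable_comp_eval (hXi i)]
    have h1 : ∀ i, ∫ h : Fin n → ℝ, X i (h i) ∂(Measure.pi fun _ => μ)
        = if i ∈ S then ∫ a, f a ∂μ else 0 := by
      intro i
      rw [integral_comp_eval (μ := fun _ : Fin n => μ) (f := X i) (hXc i).aestronglyMeasurable]
      rw [hX]; dsimp only; split_ifs <;> simp
    simp_rw [h1]
    simp
  have hvar := variance_sum_pi (μ := fun _ : Fin n => μ) hXm
  rw [variance_eq_integral (by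
    apply Continuous.aemeasurable
    rw [funext hsum]; fun_prop), hmean] at hvar
  simp_rw [hsum] at hvar
  rw [hvar]
  have h2 : ∀ i, Var[X i; μ] = if i ∈ S then Var[f; μ] else 0 := by
    intro i; rw [hX]; dsimp only; split_ifs <;> simp
  simp_rw [h2]
  simp

lemma continuous_tanhDev {n : ℕ} (μ : Measure ℝ) (S : Finset (Fin n)) (j : ℕ) :
    Continuous fun h : Fin n → ℝ => tanhDev μ S h j := by
  have := continuous_tanh
  unfold tanhDev
  fun_prop

lemma continuous_disorder {n : ℕ} (μ : Measure ℝ) [IsProbabilityMeasure μ] {r : ℝ} (hr : 0 ≤ r)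
    (hr1 : r < 1) (S : Finset (Fin n)) : Continuous fun h => disorder μ r S h := by
  unfold disorder
  refine continuous_const.add (continuous_tsum (u := fun j => r ^ j * (4 * S.card)) (fun j => ?_)
    ((summable_geometric_of_lt_one hr hr1).mul_right _) fun j h => ?_)
  · have := continuous_tanhDev μ S j
    fun_prop
  · rw [Real.norm_eq_abs, abs_of_nonneg (disorder_term_nonneg μ hr S h j)]
    exact disorder_term_le μ hr S h j

lemma integrable_disorder {n : ℕ} (μ : Measure ℝ) [IsProbabilityMeasure μ] {r : ℝ} (hr : 0 ≤ r)
    (hr1 : r < 1) (S : Finset (Fin n)) :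
    Integrable (fun h => disorder μ r S h) (Measure.pi fun _ => μ) := by
  refine Integrable.mono' (integrable_const (1 + ∑' j, r ^ j * (4 * (S.card : ℝ))))
    (continuous_disorder μ hr hr1 S).aestronglyMeasurable (ae_of_all _ fun h => ?_)
  have h1 := one_le_disorder μ hr S h
  rw [Real.norm_eq_abs, abs_of_nonneg (by linarith), disorder]
  apply add_le_add_right
  exact (summable_disorder μ hr hr1 S h).tsum_le_tsum (disorder_term_le μ hr S h)
    ((summable_geometric_of_lt_one hr hr1).mul_right _)

/-- Each normalized squared fluctuation has mean Var(tanh^(j+1) h) ≤ 1, which leaves a geometric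
series. No higher moment of the disorder is used. -/
lemma integral_disorder_le {n : ℕ} (μ : Measure ℝ) [IsProbabilityMeasure μ] {r : ℝ} (hr : 0 ≤ r)
    (hr1 : r < 1) (S : Finset (Fin n)) :
    ∫ h, disorder μ r S h ∂(Measure.pi fun _ => μ) ≤ 1 + 1 / (1 - r) := by
  have hpow : ∀ (j : ℕ) (a : ℝ), |Real.tanh a ^ (j + 1)| ≤ 1 := fun j a => by
    rw [abs_pow]; exact pow_le_one₀ (abs_nonneg _) (Real.abs_tanh_lt_one a).le
  have hterm : ∀ j, ∫ h : Fin n → ℝ, r ^ j * (tanhDev μ S h j ^ 2 / S.card) ∂(Measure.pi fun _ => μ)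
      ≤ r ^ j := by
    intro j
    rw [integral_const_mul, integral_div]
    have h1 := integral_sq_sum_centered (μ := μ) S (f := fun a => Real.tanh a ^ (j + 1))
      (continuous_tanh.pow _) (hpow j)
    have h2 : Var[fun a => Real.tanh a ^ (j + 1); μ] ≤ 1 := by
      have := variance_le_sq_of_bounded (μ := μ) (a := -1) (b := 1)
        (X := fun a => Real.tanh a ^ (j + 1)) (ae_of_all _ fun a => abs_le.1 (hpow j a))
        (continuous_tanh.pow _).aemeasurable
      norm_num at this
      exact this
    unfold tanhDev
    rw [h1]
    apply mul_le_of_le_one_right (by positivity)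
    apply div_le_one_of_le₀ _ (by positivity)
    have : (0 : ℝ) ≤ S.card := by positivity
    nlinarith
  have hF : ∀ j, Integrable (fun h : Fin n → ℝ => r ^ j * (tanhDev μ S h j ^ 2 / S.card))
      (Measure.pi fun _ => μ) := by
    intro j
    refine Integrable.mono' (integrable_const (r ^ j * (4 * (S.card : ℝ)))) ?_
      (ae_of_all _ fun h => ?_)
    · have := continuous_tanhDev μ S j
      fun_prop
    · rw [Real.norm_eq_abs, abs_of_nonneg (disorder_term_nonneg μ hr S h j)]
      exact disorder_term_le μ hr S h j
  have hg := summable_geometric_of_lt_one hr hr1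
  have hnn : ∀ j, 0 ≤ ∫ h : Fin n → ℝ, r ^ j * (tanhDev μ S h j ^ 2 / S.card)
      ∂(Measure.pi fun _ => μ) :=
    fun j => integral_nonneg fun h => disorder_term_nonneg μ hr S h j
  have hs : Summable fun j => ∫ h : Fin n → ℝ, r ^ j * (tanhDev μ S h j ^ 2 / S.card)
      ∂(Measure.pi fun _ => μ) := Summable.of_nonneg_of_le hnn hterm hg
  have h1 := integral_tsum_of_summable_integral_norm hF (by
    simpa only [Real.norm_eq_abs, abs_of_nonneg (disorder_term_nonneg μ hr S _ _)] using hs)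
  have h2 : ∫ h, disorder μ r S h ∂(Measure.pi fun _ => μ)
      = 1 + ∑' j, ∫ h : Fin n → ℝ, r ^ j * (tanhDev μ S h j ^ 2 / S.card)
      ∂(Measure.pi fun _ => μ) := by
    rw [h1]
    have h3 : Integrable (fun h => ∑' j, r ^ j * (tanhDev μ S h j ^ 2 / S.card))
        (Measure.pi fun _ => μ) := by
      have := (integrable_disorder μ hr hr1 S).sub (integrable_const 1)
      refine this.congr (ae_of_all _ fun h => ?_)
      simp [disorder]
    unfold disorder
    rw [integral_add (integrable_const _) h3]
    simp
  rw [h2, one_div, ← tsum_geometric_of_lt_one hr hr1]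
  apply add_le_add_right
  exact hs.tsum_le_tsum hterm hg

/-! ### The Hubbard–Stratonovich transform -/

lemma gaussian_factor {k : ℝ} (hk : 0 < k) (b x : ℝ) :
    Real.exp (-(k * x ^ 2 / 2) + b * x) = √(2 * Real.pi / k) * Real.exp (b ^ 2 / (2 * k)) *
      gaussianPDFReal (b / k) (1 / k).toNNReal x := by
  have h1 : (((1 / k).toNNReal : NNReal) : ℝ) = 1 / k := Real.coe_toNNReal _ (by positivity)
  rw [gaussianPDFReal, h1, show 2 * Real.pi * (1 / k) = 2 * Real.pi / k by ring]
  have h2 : √(2 * Real.pi / k) ≠ 0 := by positivity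
  rw [show √(2 * Real.pi / k) * Real.exp (b ^ 2 / (2 * k)) * ((√(2 * Real.pi / k))⁻¹ *
    Real.exp (-(x - b / k) ^ 2 / (2 * (1 / k)))) = (√(2 * Real.pi / k) * (√(2 * Real.pi / k))⁻¹) *
    (Real.exp (b ^ 2 / (2 * k)) * Real.exp (-(x - b / k) ^ 2 / (2 * (1 / k)))) by ring,
    mul_inv_cancel₀ h2, one_mul, ← Real.exp_add]
  congr 1
  field_simp
  ring

lemma integral_pow_mul_exp_quadratic {k : ℝ} (hk : 0 < k) (b : ℝ) (j : ℕ) :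
    ∫ x : ℝ, x ^ j * Real.exp (-(k * x ^ 2 / 2) + b * x)
      = √(2 * Real.pi / k) * Real.exp (b ^ 2 / (2 * k)) *
        ∫ x, x ^ j ∂(gaussianReal (b / k) (1 / k).toNNReal) := by
  rw [integral_gaussianReal_eq_integral_smul (by simpa using hk), ← integral_const_mul]
  congr 1
  ext x
  rw [gaussian_factor hk, smul_eq_mul]
  ring

lemma integrable_pow_gaussianReal (m : ℝ) (v : NNReal) (j : ℕ) :
    Integrable (fun x : ℝ => x ^ j) (gaussianReal m v) := by
  have h := (memLp_id_gaussianReal (μ := m) (v := v) (j : NNReal)).integrable_norm_pow'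
  refine Integrable.mono' h (by fun_prop) (ae_of_all _ fun x => ?_)
  simp

lemma integrable_pow_mul_exp_quadratic {k : ℝ} (hk : 0 < k) (b : ℝ) (j : ℕ) :
    Integrable fun x : ℝ => x ^ j * Real.exp (-(k * x ^ 2 / 2) + b * x) := by
  have h := integrable_pow_gaussianReal (b / k) (1 / k).toNNReal j
  rw [gaussianReal_of_var_ne_zero _ (by simpa using hk), gaussianPDF_def,
    integrable_withDensity_iff_integrable_smul' (by fun_prop) (by simp)] at h
  refine (h.const_mul (√(2 * Real.pi / k) * Real.exp (b ^ 2 / (2 * k)))).congr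
    (ae_of_all _ fun x => ?_)
  dsimp only
  rw [gaussian_factor hk, ENNReal.toReal_ofReal (gaussianPDFReal_nonneg _ _ _), smul_eq_mul]
  ring

lemma integral_sq_gaussianReal (m : ℝ) (v : NNReal) :
    ∫ x, x ^ 2 ∂(gaussianReal m v) = m ^ 2 + v := by
  have h := variance_fun_id_gaussianReal (μ := m) (v := v)
  have hm : MemLp (fun x : ℝ => x) 2 (gaussianReal m v) := memLp_id_gaussianReal 2
  rw [variance_eq_sub hm] at h
  simp only [Pi.pow_apply, integral_id_gaussianReal] at h
  linarith

/-- Jensen for the square, through the tangent bound x⁴ ≥ 2 a x² - a² at a = m² + v. -/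
lemma pow_four_le_integral_gaussianReal (m : ℝ) (v : NNReal) :
    m ^ 4 ≤ ∫ x, x ^ 4 ∂(gaussianReal m v) := by
  have h2 := integral_sq_gaussianReal m v
  have hv : (0 : ℝ) ≤ v := v.2
  have h : ∫ x, (2 * (m ^ 2 + v) * x ^ 2 - (m ^ 2 + v) ^ 2) ∂(gaussianReal m v)
      ≤ ∫ x, x ^ 4 ∂(gaussianReal m v) := by
    apply integral_mono (((integrable_pow_gaussianReal m v 2).const_mul _).sub
      (integrable_const _)) (integrable_pow_gaussianReal m v 4)
    intro x
    simp only [Pi.sub_apply]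
    nlinarith [sq_nonneg (x ^ 2 - (m ^ 2 + v))]
  rw [integral_sub ((integrable_pow_gaussianReal m v 2).const_mul _) (integrable_const _),
    integral_const_mul, h2] at h
  simp only [integral_const, probReal_univ, one_smul] at h
  nlinarith [sq_nonneg m]

lemma sum_exp_spin {n : ℕ} (a : Fin n → ℝ) :
    ∑ σ : Fin n → Bool, Real.exp (∑ i, a i * spin (σ i)) = ∏ i, (2 * Real.cosh (a i)) := by
  simp_rw [Real.exp_sum]
  have h := (Finset.prod_univ_sum (fun _ : Fin n => (Finset.univ : Finset Bool))
    (fun i b => Real.exp (a i * spin b))).symm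
  rw [Fintype.piFinset_univ] at h
  rw [h]
  refine Finset.prod_congr rfl fun i _ => ?_
  rw [Fintype.sum_bool, Real.cosh_eq]
  simp only [spin]
  norm_num
  ring

lemma sum_exp_quadratic_spin {n : ℕ} (θ : ℝ) (S : Finset (Fin n)) (h : Fin n → ℝ) (x : ℝ) :
    ∑ σ : Fin n → Bool, Real.exp (∑ i, h i * spin (σ i)) *
      Real.exp (-(S.card * x ^ 2 / 2) + (√θ * ∑ i ∈ S, spin (σ i)) * x)
    = (∏ i, (2 * Real.cosh (h i))) * Real.exp (-fieldEnergy θ S h x) := by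
  have h1 : ∀ σ : Fin n → Bool, Real.exp (∑ i, h i * spin (σ i)) *
      Real.exp (-(S.card * x ^ 2 / 2) + (√θ * ∑ i ∈ S, spin (σ i)) * x)
      = Real.exp (-(S.card * x ^ 2 / 2)) *
        Real.exp (∑ i, ((if i ∈ S then √θ * x else 0) + h i) * spin (σ i)) := by
    intro σ
    rw [← Real.exp_add, ← Real.exp_add]
    congr 1
    simp_rw [add_mul, ite_mul, zero_mul]
    rw [Finset.sum_add_distrib, Finset.sum_ite_mem, Finset.univ_inter, ← Finset.mul_sum]
    ring
  simp_rw [h1]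
  rw [← Finset.mul_sum, sum_exp_spin, fieldEnergy, neg_sub, sub_eq_add_neg, Real.exp_add,
    Real.exp_sum]
  have h2 : ∏ i, (2 * Real.cosh ((if i ∈ S then √θ * x else 0) + h i))
      = (∏ i, (2 * Real.cosh (h i))) *
        ∏ i ∈ S, Real.exp (Real.log (Real.cosh (√θ * x + h i)) - Real.log (Real.cosh (h i))) := by
    -- The product over S is extended by ones to all sites, so that the two products can be compared
    -- factor by factor.
    rw [← Finset.prod_subset (Finset.subset_univ S) (f := fun i =>
      if i ∈ S then Real.exp (Real.log (Real.cosh (√θ * x + h i)) - Real.log (Real.cosh (h i)))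
        else 1) (fun i _ hi => if_neg hi) |>.symm.trans
      (Finset.prod_congr rfl fun i hi => if_pos hi)]
    rw [← Finset.prod_mul_distrib]
    refine Finset.prod_congr rfl fun i _ => ?_
    split_ifs
    · rw [Real.exp_sub, Real.exp_log (Real.cosh_pos _), Real.exp_log (Real.cosh_pos _)]
      have := (Real.cosh_pos (h i)).ne'
      field_simp
    · simp
  rw [h2]
  ring

/-- The conditional mean of `f σ` given the field. -/
def gibbsMean {n : ℕ} (θ : ℝ) (S : Finset (Fin n)) (h : Fin n → ℝ) (f : (Fin n → Bool) → ℝ) : ℝ :=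
  ∑ σ, gibbsProb θ S h σ * f σ

lemma gibbsWeight_pos {n : ℕ} (θ : ℝ) (S : Finset (Fin n)) (h : Fin n → ℝ) (σ : Fin n → Bool) :
    0 < gibbsWeight θ S h σ := Real.exp_pos _

lemma sum_gibbsWeight_pos {n : ℕ} (θ : ℝ) (S : Finset (Fin n)) (h : Fin n → ℝ) :
    0 < ∑ σ : Fin n → Bool, gibbsWeight θ S h σ :=
  Finset.sum_pos (fun σ _ => gibbsWeight_pos θ S h σ) Finset.univ_nonempty

lemma gibbsProb_nonneg {n : ℕ} (θ : ℝ) (S : Finset (Fin n)) (h : Fin n → ℝ) (σ : Fin n → Bool) :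
    0 ≤ gibbsProb θ S h σ :=
  div_nonneg (gibbsWeight_pos θ S h σ).le (sum_gibbsWeight_pos θ S h).le

lemma sum_gibbsProb {n : ℕ} (θ : ℝ) (S : Finset (Fin n)) (h : Fin n → ℝ) :
    ∑ σ : Fin n → Bool, gibbsProb θ S h σ = 1 := by
  unfold gibbsProb
  rw [← Finset.sum_div, div_self (sum_gibbsWeight_pos θ S h).ne']

lemma gibbsMean_eq {n : ℕ} (θ : ℝ) (S : Finset (Fin n)) (h : Fin n → ℝ) (f : (Fin n → Bool) → ℝ) :
    gibbsMean θ S h f = (∑ σ, gibbsWeight θ S h σ * f σ) / ∑ σ, gibbsWeight θ S h σ := by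
  unfold gibbsMean gibbsProb
  rw [Finset.sum_div]
  exact Finset.sum_congr rfl fun σ _ => by ring

/-- Hubbard–Stratonovich. For fixed x the sites are independent and those of S feel the field √θ x +
h_i, so summing over spins yields exp(-F); for fixed σ completing the square yields a Gaussian
centred at √θ m_S with variance 1/k. The density exp(-F) is thus, up to a constant, the Gibbs
mixture of these Gaussians. -/
lemma integral_pow_mul_exp_fieldEnergy {n : ℕ} {θ : ℝ} (hθ : 0 < θ) (S : Finset (Fin n))
    (hS : 0 < S.card) (h : Fin n → ℝ) (j : ℕ) :
    (∏ i, (2 * Real.cosh (h i))) * ∫ x, x ^ j * Real.exp (-fieldEnergy θ S h x)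
      = √(2 * Real.pi / S.card) * ∑ σ : Fin n → Bool, gibbsWeight θ S h σ *
        ∫ x, x ^ j ∂(gaussianReal (√θ * mag S σ) (1 / (S.card : ℝ)).toNNReal) := by
  have hk : (0 : ℝ) < S.card := by exact_mod_cast hS
  rw [← integral_const_mul]
  have h1 : ∀ x, (∏ i, (2 * Real.cosh (h i))) * (x ^ j * Real.exp (-fieldEnergy θ S h x))
      = ∑ σ : Fin n → Bool, Real.exp (∑ i, h i * spin (σ i)) *
        (x ^ j * Real.exp (-(S.card * x ^ 2 / 2) + (√θ * ∑ i ∈ S, spin (σ i)) * x)) := by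
    intro x
    rw [mul_left_comm, ← sum_exp_quadratic_spin, Finset.mul_sum]
    exact Finset.sum_congr rfl fun σ _ => by ring
  simp_rw [h1]
  rw [integral_finsetSum _ fun σ _ => (integrable_pow_mul_exp_quadratic hk _ j).const_mul _,
    Finset.mul_sum]
  refine Finset.sum_congr rfl fun σ _ => ?_
  rw [integral_const_mul, integral_pow_mul_exp_quadratic hk, gibbsWeight, Real.exp_add, mag,
    mul_div_assoc, mul_pow, Real.sq_sqrt hθ.le]
  rw [show θ / (2 * (S.card : ℝ)) * (∑ i ∈ S, spin (σ i)) ^ 2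
    = θ * (∑ i ∈ S, spin (σ i)) ^ 2 / (2 * (S.card : ℝ)) by ring]
  ring_nf

/-- The summand 1/k is the variance of the auxiliary Gaussian; it is negligible at the scale of
m_S². -/
lemma gibbsMean_mag_sq {n : ℕ} {θ : ℝ} (hθ : 0 < θ) (S : Finset (Fin n))
    (hS : 0 < S.card) (h : Fin n → ℝ) :
    (θ * gibbsMean θ S h (fun σ => mag S σ ^ 2) + 1 / S.card)
        * ∫ x, Real.exp (-fieldEnergy θ S h x)
      = ∫ x, x ^ 2 * Real.exp (-fieldEnergy θ S h x) := by
  have hk : (0 : ℝ) < S.card := by exact_mod_cast hS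
  have hP : 0 < ∏ i, (2 * Real.cosh (h i)) :=
    Finset.prod_pos fun i _ => mul_pos two_pos (Real.cosh_pos _)
  have h0 := integral_pow_mul_exp_fieldEnergy hθ S hS h 0
  have h2 := integral_pow_mul_exp_fieldEnergy hθ S hS h 2
  simp only [pow_zero, one_mul, integral_const, probReal_univ, smul_eq_mul, mul_one] at h0
  have hsum : ∑ σ : Fin n → Bool, gibbsWeight θ S h σ *
        ∫ x, x ^ 2 ∂(gaussianReal (√θ * mag S σ) (1 / (S.card : ℝ)).toNNReal)
      = θ * (∑ σ : Fin n → Bool, gibbsWeight θ S h σ * mag S σ ^ 2)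
        + 1 / S.card * ∑ σ : Fin n → Bool, gibbsWeight θ S h σ := by
    rw [Finset.mul_sum, Finset.mul_sum, ← Finset.sum_add_distrib]
    refine Finset.sum_congr rfl fun σ _ => ?_
    rw [integral_sq_gaussianReal, Real.coe_toNNReal _ (by positivity), mul_pow,
      Real.sq_sqrt hθ.le]
    ring
  have hw := sum_gibbsWeight_pos θ S h
  rw [hsum] at h2
  apply mul_left_cancel₀ hP.ne'
  rw [h2, mul_left_comm, h0, gibbsMean_eq]
  field_simp

lemma gibbsMean_mag_pow_four_le {n : ℕ} {θ : ℝ} (hθ : 0 < θ) (S : Finset (Fin n))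
    (hS : 0 < S.card) (h : Fin n → ℝ) :
    θ ^ 2 * gibbsMean θ S h (fun σ => mag S σ ^ 4) * ∫ x, Real.exp (-fieldEnergy θ S h x)
      ≤ ∫ x, x ^ 4 * Real.exp (-fieldEnergy θ S h x) := by
  have hk : (0 : ℝ) < S.card := by exact_mod_cast hS
  have hP : 0 < ∏ i, (2 * Real.cosh (h i)) :=
    Finset.prod_pos fun i _ => mul_pos two_pos (Real.cosh_pos _)
  have h0 := integral_pow_mul_exp_fieldEnergy hθ S hS h 0
  have h4 := integral_pow_mul_exp_fieldEnergy hθ S hS h 4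
  simp only [pow_zero, one_mul, integral_const, probReal_univ, smul_eq_mul, mul_one] at h0
  have hsum : θ ^ 2 * (∑ σ : Fin n → Bool, gibbsWeight θ S h σ * mag S σ ^ 4)
      ≤ ∑ σ : Fin n → Bool, gibbsWeight θ S h σ *
        ∫ x, x ^ 4 ∂(gaussianReal (√θ * mag S σ) (1 / (S.card : ℝ)).toNNReal) := by
    rw [Finset.mul_sum]
    refine Finset.sum_le_sum fun σ _ => ?_
    have h5 := pow_four_le_integral_gaussianReal (√θ * mag S σ) (1 / (S.card : ℝ)).toNNReal
    rw [mul_pow, show √θ ^ 4 = (√θ ^ 2) ^ 2 by ring, Real.sq_sqrt hθ.le] at h5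
    have := mul_le_mul_of_nonneg_left h5 (gibbsWeight_pos θ S h σ).le
    linarith
  have hw := sum_gibbsWeight_pos θ S h
  apply le_of_mul_le_mul_left _ hP
  rw [h4, mul_left_comm, h0, gibbsMean_eq]
  have h6 : 0 ≤ √(2 * Real.pi / S.card) := Real.sqrt_nonneg _
  calc _ = √(2 * Real.pi / S.card) *
        (θ ^ 2 * (∑ σ : Fin n → Bool, gibbsWeight θ S h σ * mag S σ ^ 4)) := by field_simp
    _ ≤ _ := by gcongr

/-! ### Means under the planted law -/

lemma continuous_gibbsProb {n : ℕ} (θ : ℝ) (S : Finset (Fin n)) (σ : Fin n → Bool) :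
    Continuous fun h : Fin n → ℝ => gibbsProb θ S h σ := by
  unfold gibbsProb
  refine Continuous.div ?_ ?_ fun h => (sum_gibbsWeight_pos θ S h).ne'
  · unfold gibbsWeight; fun_prop
  · unfold gibbsWeight; fun_prop

lemma gibbsProb_le_one {n : ℕ} (θ : ℝ) (S : Finset (Fin n)) (h : Fin n → ℝ) (σ : Fin n → Bool) :
    gibbsProb θ S h σ ≤ 1 := by
  rw [← sum_gibbsProb θ S h]
  exact Finset.single_le_sum (fun σ _ => gibbsProb_nonneg θ S h σ) (Finset.mem_univ σ)

lemma integrable_gibbsProb {n : ℕ} (μ : Measure ℝ) [IsProbabilityMeasure μ] (θ : ℝ)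
    (S : Finset (Fin n)) (σ : Fin n → Bool) :
    Integrable (fun h : Fin n → ℝ => gibbsProb θ S h σ) (Measure.pi fun _ => μ) := by
  refine Integrable.mono' (integrable_const (1 : ℝ))
    (continuous_gibbsProb θ S σ).aestronglyMeasurable (ae_of_all _ fun h => ?_)
  rw [Real.norm_eq_abs, abs_of_nonneg (gibbsProb_nonneg θ S h σ)]
  exact gibbsProb_le_one θ S h σ

lemma integrable_gibbsMean {n : ℕ} (μ : Measure ℝ) [IsProbabilityMeasure μ] (θ : ℝ)
    (S : Finset (Fin n)) (f : (Fin n → Bool) → ℝ) :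
    Integrable (fun h : Fin n → ℝ => gibbsMean θ S h f) (Measure.pi fun _ => μ) := by
  unfold gibbsMean
  exact integrable_finsetSum _ fun σ _ => (integrable_gibbsProb μ θ S σ).mul_const _

instance plantedLaw_isProbability {n : ℕ} (μ : Measure ℝ) [IsProbabilityMeasure μ] (θ : ℝ)
    (S : Finset (Fin n)) : IsProbabilityMeasure (plantedLaw μ θ S) := by
  refine ⟨?_⟩
  unfold plantedLaw
  simp only [Measure.coe_finsetSum, Finset.sum_apply, Measure.smul_apply, smul_eq_mul,
    measure_univ, mul_one]
  rw [← lintegral_finsetSum _ fun σ _ =>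
    (continuous_gibbsProb θ S σ).measurable.ennreal_ofReal]
  simp_rw [← ENNReal.ofReal_sum_of_nonneg fun σ _ => gibbsProb_nonneg θ S _ σ, sum_gibbsProb]
  simp

instance nullLaw_isProbability (n : ℕ) (μ : Measure ℝ) [IsProbabilityMeasure μ] :
    IsProbabilityMeasure (nullLaw n μ) := by unfold nullLaw; infer_instance

lemma integral_plantedLaw {n : ℕ} (μ : Measure ℝ) [IsProbabilityMeasure μ] (θ : ℝ)
    (S : Finset (Fin n)) (f : (Fin n → Bool) → ℝ) :
    ∫ σ, f σ ∂(plantedLaw μ θ S) = ∫ h, gibbsMean θ S h f ∂(Measure.pi fun _ => μ) := by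
  have hfin : ∀ σ : Fin n → Bool,
      ∫⁻ h, ENNReal.ofReal (gibbsProb θ S h σ) ∂(Measure.pi fun _ : Fin n => μ) ≠ ⊤ := by
    intro σ
    exact (integrable_gibbsProb μ θ S σ).lintegral_lt_top.ne
  unfold plantedLaw gibbsMean
  rw [integral_finsetSum_measure, integral_finsetSum _ fun σ _ =>
    (integrable_gibbsProb μ θ S σ).mul_const _]
  · refine Finset.sum_congr rfl fun σ _ => ?_
    rw [integral_smul_measure, integral_dirac, integral_mul_const, smul_eq_mul,
      integral_eq_lintegral_of_nonneg_ae (ae_of_all _ fun h => gibbsProb_nonneg θ S h σ)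
        (continuous_gibbsProb θ S σ).aestronglyMeasurable]
  · intro σ _
    exact Integrable.smul_measure .of_finite (hfin σ)

/-! ### Conditional moments of the magnetization -/

/-- The squared critical point `v ^ 2`, where `(2 p + 2) c v ^ (2 p + 1) = √θ w`. -/
def critSq (θ c : ℝ) (p : ℕ) (w : ℝ) : ℝ :=
  |√θ * w / ((2 * p + 2 : ℝ) * c)| ^ (2 / (2 * (p : ℝ) + 1))

lemma exists_critPoint {θ c : ℝ} (hc : 0 < c) (p : ℕ) (w : ℝ) :
    ∃ v : ℝ, (2 * p + 2 : ℝ) * c * v ^ (2 * p + 1) = √θ * w ∧ v ^ 2 = critSq θ c p w := by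
  set b := √θ * w / ((2 * p + 2 : ℝ) * c) with hb
  have hpow : (|b| ^ (1 / (2 * (p : ℝ) + 1))) ^ (2 * p + 1) = |b| := by
    rw [← Real.rpow_natCast, ← Real.rpow_mul (abs_nonneg _)]
    push_cast
    rw [one_div, inv_mul_cancel₀ (by positivity), Real.rpow_one]
  have hsq : (|b| ^ (1 / (2 * (p : ℝ) + 1))) ^ 2 = critSq θ c p w := by
    rw [← Real.rpow_natCast, ← Real.rpow_mul (abs_nonneg _), critSq, ← hb]
    congr 1
    push_cast
    ring
  have hbb : (2 * p + 2 : ℝ) * c * b = √θ * w := by rw [hb]; field_simp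
  rcases le_total 0 b with h | h
  · refine ⟨|b| ^ (1 / (2 * (p : ℝ) + 1)), ?_, hsq⟩
    rw [hpow, abs_of_nonneg h, hbb]
  · refine ⟨-(|b| ^ (1 / (2 * (p : ℝ) + 1))), ?_, by rw [neg_sq, hsq]⟩
    rw [Odd.neg_pow ⟨p, rfl⟩, hpow, abs_of_nonpos h, neg_neg, hbb]

lemma critSq_nonneg (θ c : ℝ) (p : ℕ) (w : ℝ) : 0 ≤ critSq θ c p w := by
  unfold critSq; positivity

lemma continuous_critSq (θ c : ℝ) (p : ℕ) : Continuous (critSq θ c p) := by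
  unfold critSq
  refine Continuous.rpow_const (by fun_prop) fun w => Or.inr (by positivity)

/-- The exponent 2/(2p + 1) is at most 1 because p ≥ 1. Linear growth allows passage to the limit
under the bounded second moment of the normalized sum. -/
lemma critSq_le {θ c : ℝ} (hc : 0 < c) {p : ℕ} (hp : 1 ≤ p) (w : ℝ) :
    critSq θ c p w ≤ 1 + √θ / ((2 * p + 2 : ℝ) * c) * |w| := by
  unfold critSq
  set b := √θ * w / ((2 * p + 2 : ℝ) * c) with hb
  have hbw : |b| = √θ / ((2 * p + 2 : ℝ) * c) * |w| := by
    rw [hb, abs_div, abs_mul, abs_of_nonneg (Real.sqrt_nonneg θ),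
      abs_of_pos (by positivity : 0 < (2 * p + 2 : ℝ) * c)]
    ring
  rw [← hbw]
  have hp' : (1 : ℝ) ≤ p := by exact_mod_cast hp
  have hq : 2 / (2 * (p : ℝ) + 1) ≤ 1 := by rw [div_le_one (by positivity)]; linarith
  rcases le_total 1 |b| with h | h
  · have := Real.rpow_le_rpow_of_exponent_le h hq
    rw [Real.rpow_one] at this
    linarith
  · have := Real.rpow_le_one (abs_nonneg b) h (show 0 ≤ 2 / (2 * (p : ℝ) + 1) by positivity)
    linarith [abs_nonneg b]

lemma gibbsMean_mono {n : ℕ} (θ : ℝ) (S : Finset (Fin n)) (h : Fin n → ℝ)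
    {f g : (Fin n → Bool) → ℝ} (hfg : ∀ σ, f σ ≤ g σ) : gibbsMean θ S h f ≤ gibbsMean θ S h g :=
  Finset.sum_le_sum fun σ _ => mul_le_mul_of_nonneg_left (hfg σ) (gibbsProb_nonneg θ S h σ)

lemma gibbsMean_nonneg {n : ℕ} (θ : ℝ) (S : Finset (Fin n)) (h : Fin n → ℝ)
    {f : (Fin n → Bool) → ℝ} (hf : ∀ σ, 0 ≤ f σ) : 0 ≤ gibbsMean θ S h f :=
  Finset.sum_nonneg fun σ _ => mul_nonneg (gibbsProb_nonneg θ S h σ) (hf σ)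

/-- The fourth moment of the magnetization is controlled by the disorder, and its second moment is
asymptotically a function of the centered sum of `tanh (h i)`. -/
theorem exists_conditional_moments {μ : Measure ℝ} [IsProbabilityMeasure μ]
    (hint : Integrable (fun h : ℝ => h) μ)
    {θ : ℝ} (hθ : 0 < θ) {p : ℕ} (hp : 1 ≤ p) (hflat : HasFlatMinimum (potential μ θ) (p + 1)) :
    ∃ r K : ℝ, 0 < r ∧ r < 1 ∧ 0 < K ∧
      (∀ (n : ℕ) (S : Finset (Fin n)) (h : Fin n → ℝ) (l : ℝ), 0 < S.card → 1 ≤ l →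
        l ^ (4 * p + 2) = S.card →
        l ^ 4 * gibbsMean θ S h (fun σ => mag S σ ^ 4) ≤ K * disorder μ r S h) ∧
      ∀ ε M : ℝ, 0 < ε → 1 ≤ M → ∃ Λ : ℝ, ∀ (n : ℕ) (S : Finset (Fin n)) (h : Fin n → ℝ) (l : ℝ),
        0 < S.card → 1 ≤ l → Λ ≤ l → l ^ (4 * p + 2) = S.card → disorder μ r S h ≤ M →
        |l ^ 2 * gibbsMean θ S h (fun σ => mag S σ ^ 2)
          - critSq θ (flatCoeff μ θ (p + 1)) p (tanhDev μ S h 0 / √S.card) / θ| ≤ ε := by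
  have hc := flatCoeff_pos hflat
  obtain ⟨r, c₁, C, R, η, L₀, hr0, hr1, hc₁, hE⟩ := exists_energyBounds hint hθ p hflat
  obtain ⟨K, hK, hmom⟩ := exists_fourth_moment_bound p hp C R hc₁
  have hscale : ∀ (n : ℕ) (S : Finset (Fin n)) (h : Fin n → ℝ) (l : ℝ) (j : ℕ), 0 < l →
      ∫ y, y ^ j * Real.exp (-fieldEnergy θ S h (y / l))
        = l ^ j * l * ∫ x, x ^ j * Real.exp (-fieldEnergy θ S h x) := by
    intro n S h l j hl
    have h1 := Measure.integral_comp_div (fun x => x ^ j * Real.exp (-fieldEnergy θ S h x)) l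
    rw [abs_of_pos hl, smul_eq_mul] at h1
    rw [mul_assoc, ← h1, ← integral_const_mul]
    congr 1
    ext y
    rw [div_pow]
    field_simp
  refine ⟨r, K / θ ^ 2, hr0, hr1, by positivity, ?_, ?_⟩
  · intro n S h l hS hl hlk
    obtain ⟨hEB, -, -⟩ := hE n S h l hS hl hlk
    have hl0 : 0 < l := by linarith
    have hU := one_le_disorder μ hr0.le S h
    have hu1 : 1 ≤ √(disorder μ r S h) := Real.one_le_sqrt.2 hU
    obtain ⟨-, h1⟩ := hmom l _ hl hu1 _ hEB
    have h0 := hscale n S h l 0 hl0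
    simp only [pow_zero, one_mul] at h0
    rw [hscale n S h l 4 hl0, h0, Real.sq_sqrt (by linarith)] at h1
    have hpos : 0 < ∫ x, Real.exp (-fieldEnergy θ S h x) := by
      have h2 := inv_le_integral_exp_neg (one_le_pow₀ hl) (hEB.integrable hp hc₁ hl hu1) hEB.symm
      rw [h0] at h2
      have h3 : 0 < 1 / l ^ (2 * p) := by positivity
      exact pos_of_mul_pos_right (h3.trans_le h2) hl0.le
    have h2 := gibbsMean_mag_pow_four_le hθ S hS h
    set G := gibbsMean θ S h (fun σ => mag S σ ^ 4)
    set I := ∫ x, Real.exp (-fieldEnergy θ S h x)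
    have h3 : (l * I) * (l ^ 4 * (θ ^ 2 * G)) ≤ (l * I) * (K * disorder μ r S h) := by
      calc (l * I) * (l ^ 4 * (θ ^ 2 * G)) = l ^ 4 * l * (θ ^ 2 * G * I) := by ring
        _ ≤ l ^ 4 * l * ∫ x, x ^ 4 * Real.exp (-fieldEnergy θ S h x) := by gcongr
        _ ≤ _ := by linarith
    have h4 := le_of_mul_le_mul_left h3 (by positivity)
    rw [div_mul_eq_mul_div, le_div_iff₀ (by positivity)]
    linarith
  · intro ε M hε hM
    obtain ⟨Λ, hΛ⟩ := exists_second_moment_scale p hp (C := C) (R := R) hc₁ hc η L₀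
      (show 0 < ε * θ / 2 by positivity) (Real.one_le_sqrt.2 hM)
    -- Half of the tolerance εθ goes to Laplace's method; the second threshold gives the other half
    -- to the Gaussian variance, since l²/k ≤ 1/l.
    refine ⟨max Λ (2 / (ε * θ)), fun n S h l hS hl hlΛ hlk hUM => ?_⟩
    obtain ⟨hEB, hβ, happ⟩ := hE n S h l hS hl hlk
    have hl0 : 0 < l := by linarith
    have hk : (0 : ℝ) < S.card := by exact_mod_cast hS
    have hU := one_le_disorder μ hr0.le S h
    have hu1 : 1 ≤ √(disorder μ r S h) := Real.one_le_sqrt.2 hU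
    obtain ⟨v, hv, hv2⟩ := exists_critPoint (θ := θ) hc p (tanhDev μ S h 0 / √S.card)
    have h1 := hΛ l _ _ v _ ((le_max_left _ _).trans hlΛ) hl hu1 (Real.sqrt_le_sqrt hUM) hβ hv
      hEB happ
    have h0 := hscale n S h l 0 hl0
    simp only [pow_zero, one_mul] at h0
    have hint0 := hEB.integrable hp hc₁ hl hu1
    obtain ⟨hint4, -⟩ := hmom l _ hl hu1 _ hEB
    have hcont := hEB.cont
    have hint2 : Integrable fun y => y ^ 2 * Real.exp (-fieldEnergy θ S h (y / l)) := by
      refine Integrable.mono' (hint0.add hint4) (by fun_prop) (ae_of_all _ fun y => ?_)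
      have p1 := Real.exp_pos (-fieldEnergy θ S h (y / l))
      rw [Real.norm_eq_abs, abs_of_nonneg (by positivity), Pi.add_apply]
      have : y ^ 2 ≤ 1 + y ^ 4 := by nlinarith [sq_nonneg (y ^ 2 - 1), sq_nonneg (y ^ 2)]
      have := mul_le_mul_of_nonneg_right this p1.le
      linarith
    have h3 : ∫ y, (y ^ 2 - v ^ 2) * Real.exp (-fieldEnergy θ S h (y / l))
        = (∫ y, y ^ 2 * Real.exp (-fieldEnergy θ S h (y / l)))
          - v ^ 2 * ∫ y, Real.exp (-fieldEnergy θ S h (y / l)) := by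
      simp_rw [sub_mul]
      rw [integral_sub hint2 (hint0.const_mul _), integral_const_mul]
    have hpos : 0 < ∫ x, Real.exp (-fieldEnergy θ S h x) := by
      have h2 := inv_le_integral_exp_neg (one_le_pow₀ hl) hint0 hEB.symm
      rw [h0] at h2
      have h3 : 0 < 1 / l ^ (2 * p) := by positivity
      exact pos_of_mul_pos_right (h3.trans_le h2) hl0.le
    rw [h3, hscale n S h l 2 hl0, h0, ← gibbsMean_mag_sq hθ S hS h, hv2] at h1
    set G := gibbsMean θ S h (fun σ => mag S σ ^ 2)
    set I := ∫ x, Real.exp (-fieldEnergy θ S h x)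
    set q := critSq θ (flatCoeff μ θ (p + 1)) p (tanhDev μ S h 0 / √S.card)
    rw [show l ^ 2 * l * ((θ * G + 1 / S.card) * I) - q * (l * I)
      = (l * I) * (l ^ 2 * (θ * G + 1 / S.card) - q) by ring, abs_mul,
      abs_of_pos (by positivity : 0 < l * I), mul_comm (ε * θ / 2)] at h1
    have h4 := le_of_mul_le_mul_left h1 (by positivity)
    have h5 : l ^ 2 * (1 / S.card) ≤ ε * θ / 2 := by
      have h6 : 2 / (ε * θ) ≤ l := (le_max_right _ _).trans hlΛ
      rw [div_le_iff₀ (by positivity)] at h6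
      have h7 : l ^ 3 ≤ l ^ (4 * p + 2) := pow_le_pow_right₀ hl (by omega)
      rw [← hlk]
      calc l ^ 2 * (1 / l ^ (4 * p + 2)) ≤ l ^ 2 * (1 / l ^ 3) := by gcongr
        _ = 1 / l := by field_simp
        _ ≤ _ := by rw [div_le_iff₀ hl0]; linarith
    have h6 : 0 ≤ l ^ 2 * (1 / S.card) := by positivity
    rw [show l ^ 2 * G - q / θ = ((l ^ 2 * (θ * G + 1 / S.card) - q) - l ^ 2 * (1 / S.card)) / θ by
      field_simp; ring, abs_div, abs_of_pos hθ, div_le_iff₀ hθ]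
    refine (abs_sub _ _).trans ?_
    rw [abs_of_nonneg h6]
    linarith

/-! ### The central limit theorem for the field -/

/-- Means of functions of the normalized sum of `tanh (h i)` converge, uniformly in the set, to
the Gaussian mean, for continuous functions of linear growth. -/
theorem exists_clt_bound {μ : Measure ℝ} [IsProbabilityMeasure μ]
    (hsymm : μ.map (fun h : ℝ => -h) = μ) {f : ℝ → ℝ} (hf : Continuous f) (hf0 : ∀ w, 0 ≤ f w)
    {C : ℝ} (hfC : ∀ w, f w ≤ 1 + C * |w|) {ε : ℝ} (hε : 0 < ε) :
    ∃ k₀ : ℕ, ∀ (n : ℕ) (S : Finset (Fin n)), k₀ ≤ S.card → 0 < S.card →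
      |∫ h, f (tanhDev μ S h 0 / √S.card) ∂(Measure.pi fun _ : Fin n => μ)
        - ∫ w, f w ∂(gaussianReal 0 Var[Real.tanh; μ].toNNReal)| ≤ ε := by
  -- The law of the normalized sum over S depends on the cardinality of S only. A single infinite
  -- sequence therefore serves all n and S at once, and `hlaw` identifies the laws by characteristic
  -- functions.
  set P := Measure.infinitePi (fun _ : ℕ => μ) with hP
  set X : ℕ → (ℕ → ℝ) → ℝ := fun i ω => Real.tanh (ω i) with hX
  have htc := continuous_tanh
  have htm : Measurable Real.tanh := htc.measurable
  have hXm : ∀ i, Measurable (X i) := fun i => htm.comp (measurable_pi_apply i)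
  have hmapX : ∀ i, P.map (X i) = μ.map Real.tanh := by
    intro i
    have h1 : X i = Real.tanh ∘ (fun ω : ℕ → ℝ => ω i) := rfl
    rw [h1, ← Measure.map_map htm (measurable_pi_apply i),
      (measurePreserving_eval_infinitePi (fun _ : ℕ => μ) i).map_eq]
  have hindep : iIndepFun X P :=
    iIndepFun_infinitePi (P := fun _ : ℕ => μ) (X := fun _ => Real.tanh)
      fun _ => htm
  have hident : ∀ i, IdentDistrib (X i) (X 0) P P := fun i =>
    ⟨(hXm i).aemeasurable, (hXm 0).aemeasurable, by rw [hmapX, hmapX]⟩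
  have hbd : ∀ w, |Real.tanh w| ≤ 1 := fun w => (Real.abs_tanh_lt_one w).le
  have hmemX : MemLp (X 0) 2 P := memLp_of_bounded (a := -1) (b := 1)
    (ae_of_all _ fun ω => abs_le.1 (hbd _)) (hXm 0).aestronglyMeasurable 2
  have hvarX : Var[X 0; P] = Var[Real.tanh; μ] := by
    rw [← variance_id_map (hXm 0).aemeasurable, hmapX, variance_id_map htm.aemeasurable]
  have hmeanX : P[X 0] = 0 := by
    have h1 : ∫ y, y ∂(P.map (X 0)) = ∫ ω, X 0 ω ∂P :=
      integral_map (f := fun y : ℝ => y) (hXm 0).aemeasurable (by fun_prop)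
    have h2 : ∫ y, y ∂(μ.map Real.tanh) = ∫ a, Real.tanh a ∂μ :=
      integral_map (f := fun y : ℝ => y) htm.aemeasurable (by fun_prop)
    rw [← h1, hmapX, h2]
    exact integral_tanh_eq_zero hsymm
  set v := Var[Real.tanh; μ].toNNReal with hv
  set γ := gaussianReal 0 v with hγ
  have hclt := tendstoInDistribution_inv_sqrt_mul_sum_sub (P := P) (P' := γ) (Y := fun y => y)
    (X := X) ⟨by fun_prop, by rw [hvarX]; exact Measure.map_id⟩ hmemX hindep hident
  simp only [hmeanX, mul_zero, sub_zero] at hclt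
  have hlaw : ∀ (n : ℕ) (S : Finset (Fin n)),
      (Measure.pi fun _ : Fin n => μ).map (fun h => tanhDev μ S h 0 / √S.card)
        = P.map (fun ω => (√(S.card : ℝ))⁻¹ * ∑ k ∈ Finset.range S.card, X k ω) := by
    intro n S
    have hm1 : Measurable fun h : Fin n → ℝ => tanhDev μ S h 0 / √S.card :=
      ((continuous_tanhDev μ S 0).div_const _).measurable
    have hm2 : Measurable fun ω => (√(S.card : ℝ))⁻¹ * ∑ k ∈ Finset.range S.card, X k ω :=
      (Finset.measurable_fun_sum _ fun i _ => hXm i).const_mul _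
    have := Measure.isProbabilityMeasure_map (μ := Measure.pi fun _ : Fin n => μ) hm1.aemeasurable
    have := Measure.isProbabilityMeasure_map (μ := P) hm2.aemeasurable
    apply Measure.ext_of_charFun
    ext t
    rw [charFun_inv_sqrt_mul_sum hindep hident, hmapX]
    have e1 : (fun h : Fin n → ℝ => tanhDev μ S h 0 / √S.card)
        = fun h => (√(S.card : ℝ))⁻¹ * ∑ i ∈ S, (fun (i : Fin n) (h : Fin n → ℝ) =>
          Real.tanh (h i)) i h := by
      ext h; rw [tanhDev_zero hsymm, div_eq_inv_mul]
    have hmi : ∀ i : Fin n, (Measure.pi fun _ : Fin n => μ).map (fun h => Real.tanh (h i))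
        = μ.map Real.tanh := by
      intro i
      have h1 : (fun h : Fin n → ℝ => Real.tanh (h i)) = Real.tanh ∘ (fun h : Fin n → ℝ => h i) := rfl
      rw [h1, ← Measure.map_map htm (measurable_pi_apply i),
        (measurePreserving_eval (fun _ : Fin n => μ) i).map_eq]
    have hind : iIndepFun (fun (i : Fin n) (h : Fin n → ℝ) => Real.tanh (h i))
        (Measure.pi fun _ : Fin n => μ) :=
      iIndepFun_pi (μ := fun _ : Fin n => μ) (X := fun _ => Real.tanh) fun _ => htm.aemeasurable
    rw [e1, charFun_map_mul_comp (by
      exact (Finset.measurable_fun_sum _ fun i _ => htm.comp (measurable_pi_apply i)).aemeasurable),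
      iIndepFun.charFun_map_fun_finsetSum_eq_prod
        (X := fun (i : Fin n) (h : Fin n → ℝ) => Real.tanh (h i)) (fun i _ => (htm.comp (measurable_pi_apply i)).aemeasurable) (hind.restrict _)]
    simp [hmi]
  have hvar1 : Var[Real.tanh; μ] ≤ 1 := by
    have := variance_le_sq_of_bounded (μ := μ) (a := -1) (b := 1)
      (X := Real.tanh) (ae_of_all _ fun a => abs_le.1 (hbd a)) htm.aemeasurable
    norm_num at this
    exact this
  -- truncation
  set A := 2 * (1 + C ^ 2) with hA
  have hA0 : 0 < A := by positivity
  -- Truncation at B costs at most E[f²]/B, and E[f²] ≤ A for every law with second moment at most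
  -- 1, as f² ≤ 2 (1 + C² w²).
  set B := 3 * A / ε + 1 with hB
  have hB0 : 0 < B := by positivity
  have hAB : A / B ≤ ε / 3 := by
    rw [div_le_iff₀ hB0, hB]
    have : ε / 3 * (3 * A / ε + 1) = A + ε / 3 := by field_simp
    linarith
  set g : ℝ → ℝ := fun w => min (f w) B with hg
  have hgc : Continuous g := hf.min continuous_const
  have htrunc : ∀ w, |f w - g w| ≤ 2 * (1 + C ^ 2 * w ^ 2) / B := by
    intro w
    have h1 : 0 ≤ f w - g w := sub_nonneg.2 (min_le_left _ _)
    rw [abs_of_nonneg h1, le_div_iff₀ hB0]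
    have h2 : f w ^ 2 ≤ 2 * (1 + C ^ 2 * w ^ 2) := by
      calc f w ^ 2 ≤ (1 + C * |w|) ^ 2 := by gcongr; exacts [hf0 w, hfC w]
        _ ≤ 2 * (1 + C ^ 2 * |w| ^ 2) := by nlinarith [sq_nonneg (1 - C * |w|)]
        _ = _ := by rw [sq_abs]
    rcases le_total (f w) B with h | h
    · have : g w = f w := min_eq_left h
      rw [this, sub_self, zero_mul]; positivity
    · have : g w = B := min_eq_right h
      rw [this]
      nlinarith [hf0 w]
  have hdiff : ∀ ν : Measure ℝ, IsProbabilityMeasure ν → MemLp (fun w : ℝ => w) 2 ν →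
      ∫ w, w ^ 2 ∂ν ≤ 1 → |∫ w, f w ∂ν - ∫ w, g w ∂ν| ≤ ε / 3 := by
    intro ν hν hmem hle
    have hw2 : Integrable (fun w : ℝ => w ^ 2) ν := hmem.integrable_sq
    have hw1 : Integrable (fun w : ℝ => w) ν := hmem.integrable (by norm_num)
    have hfi : Integrable f ν := by
      refine Integrable.mono' ((integrable_const (1 : ℝ)).add (hw1.abs.const_mul C))
        hf.aestronglyMeasurable (ae_of_all _ fun w => ?_)
      rw [Real.norm_eq_abs, abs_of_nonneg (hf0 w)]
      exact hfC w
    have hgi : Integrable g ν := by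
      refine Integrable.mono' hfi hgc.aestronglyMeasurable (ae_of_all _ fun w => ?_)
      rw [Real.norm_eq_abs, abs_of_nonneg (le_min (hf0 w) hB0.le)]
      exact min_le_left _ _
    have hbi : Integrable (fun w : ℝ => 2 * (1 + C ^ 2 * w ^ 2) / B) ν :=
      (((integrable_const (1 : ℝ)).add (hw2.const_mul (C ^ 2))).const_mul 2).div_const B
    rw [← integral_sub hfi hgi]
    refine (norm_integral_le_of_norm_le (f := fun w => f w - g w) hbi
      (ae_of_all _ fun w => htrunc w)).trans ?_
    rw [integral_div, integral_const_mul, integral_add (integrable_const _) (hw2.const_mul _),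
      integral_const_mul]
    simp only [integral_const, probReal_univ, one_smul]
    refine le_trans ?_ hAB
    rw [hA]
    gcongr
    nlinarith [sq_nonneg C]
  -- weak convergence
  have hweak := (ProbabilityMeasure.tendsto_iff_forall_integral_tendsto.1 hclt.tendsto)
    (BoundedContinuousFunction.ofNormedAddCommGroup g hgc B fun w => by
      rw [Real.norm_eq_abs, abs_of_nonneg (le_min (hf0 w) hB0.le)]; exact min_le_right _ _)
  obtain ⟨k₀, hk₀⟩ := (Metric.tendsto_atTop.1 hweak) (ε / 3) (by positivity)
  refine ⟨k₀, fun n S hS hpos => ?_⟩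
  have hk : (0 : ℝ) < S.card := by exact_mod_cast hpos
  have h1 := hk₀ S.card hS
  rw [Real.dist_eq] at h1
  have hmS : Measurable fun h : Fin n → ℝ => tanhDev μ S h 0 / √S.card :=
    ((continuous_tanhDev μ S 0).div_const _).measurable
  set ν := (Measure.pi fun _ : Fin n => μ).map (fun h => tanhDev μ S h 0 / √S.card) with hν
  have hνp : IsProbabilityMeasure ν := Measure.isProbabilityMeasure_map hmS.aemeasurable
  have h2 : |∫ w, g w ∂ν - ∫ w, g w ∂γ| < ε / 3 := by
    have e1 : ν = P.map (fun ω => (√(S.card : ℝ))⁻¹ * ∑ k ∈ Finset.range S.card, X k ω) := hlaw n S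
    rw [e1]
    have e2 : γ.map (fun y => y) = γ := Measure.map_id
    conv at h1 => enter [1, 1, 2]; simp only [ProbabilityMeasure.coe_mk]; rw [e2]
    exact h1
  have h3 : ∫ h, f (tanhDev μ S h 0 / √S.card) ∂(Measure.pi fun _ : Fin n => μ) = ∫ w, f w ∂ν :=
    (integral_map hmS.aemeasurable hf.aestronglyMeasurable).symm
  have hbS : ∀ h : Fin n → ℝ, |tanhDev μ S h 0 / √S.card| ≤ 2 * S.card / √S.card := by
    intro h
    rw [abs_div, abs_of_nonneg (Real.sqrt_nonneg _)]
    gcongr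
    exact abs_tanhDev_le μ S h 0
  have h4 := hdiff ν hνp ((memLp_map_measure_iff (by fun_prop) hmS.aemeasurable).2
    (memLp_of_bounded (a := -(2 * S.card / √S.card)) (b := 2 * S.card / √S.card)
      (ae_of_all _ fun h => abs_le.1 (hbS h)) hmS.aestronglyMeasurable 2)) (by
    rw [hν, integral_map hmS.aemeasurable (by fun_prop)]
    simp_rw [div_pow, Real.sq_sqrt hk.le]
    rw [integral_div]
    have h5 := integral_sq_sum_centered (μ := μ) S htc hbd
    simp only [tanhDev, zero_add, pow_one]
    rw [h5, mul_div_cancel_left₀ _ hk.ne']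
    exact hvar1)
  have h5 := hdiff γ inferInstance (memLp_id_gaussianReal 2) (by
    rw [hγ, integral_sq_gaussianReal, hv, Real.coe_toNNReal _ (variance_nonneg _ _)]
    simpa using hvar1)
  rw [h3]
  rw [abs_le] at h4 h5 ⊢
  rw [abs_lt] at h2
  constructor <;> linarith [h2.1, h2.2, h4.1, h4.2, h5.1, h5.2]

/-! ### Gaussian moments and the limiting constant -/

lemma integral_abs_rpow_gaussianReal {v : NNReal} (hv : v ≠ 0) {q : ℝ} (hq : -1 < q) :
    ∫ w, |w| ^ q ∂(gaussianReal 0 v)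
      = (2 * (v : ℝ)) ^ (q / 2) * Real.Gamma ((q + 1) / 2) / √Real.pi := by
  have hv0 : (0 : ℝ) < v := by positivity
  rw [integral_gaussianReal_eq_integral_smul hv]
  set F : ℝ → ℝ := fun y =>
    (√(2 * Real.pi * v))⁻¹ * (y ^ q * Real.exp (-(1 / (2 * v)) * y ^ (2 : ℝ))) with hF
  have h1 : (fun x : ℝ => gaussianPDFReal 0 v x • |x| ^ q) = fun x => F |x| := by
    ext x
    rw [gaussianPDFReal, smul_eq_mul, hF]
    dsimp only
    rw [Real.rpow_two, sq_abs, sub_zero,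
      show -x ^ 2 / (2 * (v : ℝ)) = -(1 / (2 * v)) * x ^ 2 by ring]
    ring
  rw [h1, integral_comp_abs (f := F), hF, integral_const_mul,
    integral_rpow_mul_exp_neg_mul_rpow two_pos hq (by positivity)]
  have h2 : √(2 * Real.pi * v) = √(2 * v) * √Real.pi := by
    rw [← Real.sqrt_mul (by positivity)]; ring_nf
  have h3 : (1 / (2 * (v : ℝ))) ^ (-(q + 1) / 2) = (2 * (v : ℝ)) ^ (q / 2) * √(2 * v) := by
    rw [one_div, Real.inv_rpow (by positivity), ← Real.rpow_neg (by positivity),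
      Real.sqrt_eq_rpow, ← Real.rpow_add (by positivity)]
    congr 1; ring
  rw [h2, h3]
  have : √(2 * (v : ℝ)) ≠ 0 := by positivity
  have : √Real.pi ≠ 0 := by positivity
  field_simp

lemma integral_even_pow_mul_exp {τ : ℕ} (hτ : 1 ≤ τ) (m : ℕ) {b : ℝ} (hb : 0 < b) :
    ∫ x : ℝ, x ^ (2 * m) * Real.exp (-(x ^ (4 * τ - 2)) / (2 * b))
      = 2 * ((1 / (2 * b)) ^ (-((2 * m : ℝ) + 1) / (4 * τ - 2)) * (1 / (4 * τ - 2))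
        * Real.Gamma (((2 * m : ℝ) + 1) / (4 * τ - 2))) := by
  have hτ' : (1 : ℝ) ≤ τ := by exact_mod_cast hτ
  have hcast : ((4 * τ - 2 : ℕ) : ℝ) = 4 * (τ : ℝ) - 2 := by
    rw [Nat.cast_sub (by omega)]; push_cast; ring
  set F : ℝ → ℝ := fun y =>
    y ^ (2 * m : ℝ) * Real.exp (-(1 / (2 * b)) * y ^ (4 * (τ : ℝ) - 2)) with hF
  have h1 : (fun x : ℝ => x ^ (2 * m) * Real.exp (-(x ^ (4 * τ - 2)) / (2 * b)))
      = fun x => F |x| := by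
    ext x
    rw [hF]
    dsimp only
    rw [← hcast, Real.rpow_natCast, Even.pow_abs ⟨2 * τ - 1, by omega⟩,
      show (2 * (m : ℝ)) = ((2 * m : ℕ) : ℝ) by push_cast; ring, Real.rpow_natCast,
      Even.pow_abs ⟨m, by ring⟩]
    congr 2
    ring
  rw [h1, integral_comp_abs (f := F), hF, integral_rpow_mul_exp_neg_mul_rpow (by linarith)
    (by have : (0 : ℝ) ≤ 2 * m := by positivity
        linarith) (by positivity)]

/-- Zero variance would force tanh h to equal its mean 0 almost surely, hence h = 0 by injectivity
of tanh. -/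
lemma variance_tanh_pos {μ : Measure ℝ} [IsProbabilityMeasure μ]
    (hsymm : μ.map (fun h : ℝ => -h) = μ) (hnondeg : μ ≠ Measure.dirac 0) :
    0 < Var[Real.tanh; μ] := by
  have htm : Measurable Real.tanh := continuous_tanh.measurable
  refine lt_of_le_of_ne (variance_nonneg _ _) fun h => hnondeg ?_
  have hmem : MemLp Real.tanh 2 μ := memLp_of_bounded (a := -1) (b := 1)
    (ae_of_all _ fun ω => abs_le.1 (Real.abs_tanh_lt_one ω).le) htm.aestronglyMeasurable 2
  have h1 := ae_eq_integral_of_variance_eq_zero hmem h.symm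
  rw [integral_tanh_eq_zero hsymm] at h1
  have h2 : (fun a : ℝ => a) =ᵐ[μ] fun _ => (0 : ℝ) := by
    filter_upwards [h1] with a ha
    exact Real.tanh_injective (by rw [ha, Real.tanh_zero])
  calc μ = μ.map (fun a => a) := Measure.map_id.symm
    _ = μ.map (fun _ => (0 : ℝ)) := Measure.map_congr h2
    _ = Measure.dirac 0 := by rw [Measure.map_const]; simp

/-- With E[sech² h] = 1/θ and (2τ)! = 2τ (2τ - 1)!, this says that √θ W / ((2p + 2) c) has limiting
variance θ^(2p+1) times `critVar`. -/
lemma critVar_eq {μ : Measure ℝ} [IsProbabilityMeasure μ] {θ : ℝ} (hcrit : θ = 1 / meanSechSq μ)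
    {p : ℕ} (hflat : HasFlatMinimum (potential μ θ) (p + 1)) :
    critVar μ θ (p + 1) = Var[Real.tanh; μ]
      / (((2 * p + 2 : ℝ) * flatCoeff μ θ (p + 1)) ^ 2 * θ ^ (2 * p)) := by
  have hm := meanSechSq_pos μ
  have hθ : 0 < θ := by rw [hcrit]; positivity
  have hD := hflat.2.1
  have hms : meanSechSq μ = 1 / θ := by rw [hcrit]; field_simp
  unfold critVar flatCoeff
  rw [hms]
  set D := iteratedDeriv (2 * (p + 1)) (potential μ θ) 0
  have e1 : 2 * (p + 1) - 1 = 2 * p + 1 := by omega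
  have e2 : 4 * (p + 1) - 2 = 4 * p + 2 := by omega
  have e3 : (Nat.factorial (2 * (p + 1)) : ℝ) = (2 * p + 2 : ℝ) * Nat.factorial (2 * p + 1) := by
    rw [show 2 * (p + 1) = (2 * p + 1) + 1 by ring, Nat.factorial_succ]; push_cast; ring
  rw [e1, e2, e3, div_pow, one_pow]
  have hf : (Nat.factorial (2 * p + 1) : ℝ) ≠ 0 := by positivity
  field_simp
  ring

lemma critVar_pos {μ : Measure ℝ} [IsProbabilityMeasure μ]
    (hsymm : μ.map (fun h : ℝ => -h) = μ) (hnondeg : μ ≠ Measure.dirac 0)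
    {θ : ℝ} (hcrit : θ = 1 / meanSechSq μ)
    {p : ℕ} (hflat : HasFlatMinimum (potential μ θ) (p + 1)) : 0 < critVar μ θ (p + 1) := by
  have hm := meanSechSq_pos μ
  have hθ : 0 < θ := by rw [hcrit]; positivity
  have := variance_tanh_pos hsymm hnondeg
  have := flatCoeff_pos hflat
  rw [critVar_eq hcrit hflat]
  positivity

lemma critMoment_pos {μ : Measure ℝ} {θ : ℝ} {τ : ℕ} (hτ : 1 ≤ τ) (hV : 0 < critVar μ θ τ) :
    0 < critMoment μ θ τ := by
  have hτ' : (1 : ℝ) ≤ τ := by exact_mod_cast hτ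
  unfold critMoment
  have : 0 < Real.Gamma ((2 * (τ : ℝ) + 1) / (4 * (τ : ℝ) - 2)) :=
    Real.Gamma_pos_of_pos (div_pos (by linarith) (by linarith))
  positivity

/-- Both integrals are Gamma integrals, the denominator at argument 1/2, whence √π. The normalized
weight is the law of the real (2τ - 1)-th root of a centred Gaussian of variance `critVar`, and the
ratio is its second moment. -/
lemma critMoment_eq_ratio {μ : Measure ℝ} {θ : ℝ} {τ : ℕ} (hτ : 1 ≤ τ) (hV : 0 < critVar μ θ τ) :
    (∫ x : ℝ, x ^ (2 * τ) * Real.exp (-(x ^ (4 * τ - 2)) / (2 * critVar μ θ τ)))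
      / (∫ x : ℝ, x ^ (2 * τ - 2) * Real.exp (-(x ^ (4 * τ - 2)) / (2 * critVar μ θ τ)))
      = critMoment μ θ τ := by
  have hτ' : (1 : ℝ) ≤ τ := by exact_mod_cast hτ
  rw [show 2 * τ - 2 = 2 * (τ - 1) by omega, integral_even_pow_mul_exp hτ _ hV,
    integral_even_pow_mul_exp hτ _ hV, critMoment]
  set V := critVar μ θ τ
  have h4 : (0 : ℝ) < 4 * τ - 2 := by linarith
  have h2 : (0 : ℝ) < 2 * τ - 1 := by linarith
  have hc : ((τ - 1 : ℕ) : ℝ) = (τ : ℝ) - 1 := by rw [Nat.cast_sub hτ]; simp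
  rw [hc]
  have h2' := h2.ne'
  have h42 : 4 * (τ : ℝ) - 2 = 2 * (2 * τ - 1) := by ring
  have e1 : (2 * ((τ : ℝ) - 1) + 1) / (4 * τ - 2) = 1 / 2 := by
    rw [h42, show 2 * ((τ : ℝ) - 1) + 1 = 2 * τ - 1 by ring]; field_simp
  have e2 : -(2 * ((τ : ℝ) - 1) + 1) / (4 * τ - 2) = -(1 / 2) := by rw [neg_div, e1]
  rw [e1, e2, Real.Gamma_one_half_eq]
  have e3 : (1 / (2 * V)) ^ (-(2 * (τ : ℝ) + 1) / (4 * τ - 2))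
      = (2 * V) ^ (1 / (2 * (τ : ℝ) - 1)) * (1 / (2 * V)) ^ (-(1 / 2) : ℝ) := by
    rw [one_div (2 * V), Real.inv_rpow (by positivity), Real.inv_rpow (by positivity),
      ← Real.rpow_neg (by positivity), ← Real.rpow_neg (by positivity),
      ← Real.rpow_add (by positivity)]
    congr 1
    rw [h42]
    field_simp
    ring
  rw [e3]
  have h5 : (0 : ℝ) < (1 / (2 * V)) ^ (-(1 / 2) : ℝ) := by positivity
  have h6 : (0 : ℝ) < √Real.pi := by positivity
  generalize hd : 4 * (τ : ℝ) - 2 = d at h4 ⊢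
  field_simp

/-- A Gaussian absolute moment of order q = 2/(2p + 1). The factor θ^(2p+1) in the variance, raised
to the power q/2, becomes θ and cancels the division by θ. -/
lemma integral_critSq {μ : Measure ℝ} [IsProbabilityMeasure μ]
    (hsymm : μ.map (fun h : ℝ => -h) = μ) (hnondeg : μ ≠ Measure.dirac 0)
    {θ : ℝ} (hcrit : θ = 1 / meanSechSq μ)
    {p : ℕ} (hflat : HasFlatMinimum (potential μ θ) (p + 1)) :
    (∫ w, critSq θ (flatCoeff μ θ (p + 1)) p w ∂(gaussianReal 0 Var[Real.tanh; μ].toNNReal)) / θ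
      = critMoment μ θ (p + 1) := by
  have hm := meanSechSq_pos μ
  have hθ : 0 < θ := by rw [hcrit]; positivity
  have hs := variance_tanh_pos hsymm hnondeg
  have hc := flatCoeff_pos hflat
  set c := flatCoeff μ θ (p + 1)
  set s := Var[Real.tanh; μ] with hsdef
  set a := (2 * p + 2 : ℝ) * c with ha
  have ha0 : 0 < a := by positivity
  set q := 2 / (2 * (p : ℝ) + 1) with hq
  have hq0 : 0 < q := by positivity
  have h1 : ∀ w, critSq θ c p w = (√θ / a) ^ q * |w| ^ q := by
    intro w
    rw [critSq, ← ha, ← hq, ← Real.mul_rpow (by positivity) (abs_nonneg w), abs_div, abs_mul,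
      abs_of_nonneg (Real.sqrt_nonneg θ), abs_of_pos ha0]
    congr 1; ring
  simp_rw [h1]
  rw [integral_const_mul, integral_abs_rpow_gaussianReal (by simpa using hs) (by linarith),
    Real.coe_toNNReal _ hs.le, critMoment, critVar_eq hcrit hflat, ← ha, ← hsdef]
  have e1 : 1 / (2 * ((p + 1 : ℕ) : ℝ) - 1) = q / 2 := by
    rw [hq]; push_cast; rw [show 2 * ((p : ℝ) + 1) - 1 = 2 * p + 1 by ring]; field_simp
  have e2 : (2 * ((p + 1 : ℕ) : ℝ) + 1) / (4 * ((p + 1 : ℕ) : ℝ) - 2) = (q + 1) / 2 := by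
    rw [hq]; push_cast
    rw [show 4 * ((p : ℝ) + 1) - 2 = 2 * (2 * p + 1) by ring]
    field_simp
    ring
  rw [e1, e2]
  have e3 : (2 * (s / (a ^ 2 * θ ^ (2 * p)))) ^ (q / 2) = (√θ / a) ^ q * (2 * s) ^ (q / 2) / θ := by
    have f1 : 2 * (s / (a ^ 2 * θ ^ (2 * p)))
        = (√θ / a) ^ (2 : ℝ) * (2 * s) * (θ ^ (2 * (p : ℝ) + 1))⁻¹ := by
      rw [Real.rpow_two, div_pow, Real.sq_sqrt hθ.le, Real.rpow_add hθ, Real.rpow_one,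
        show 2 * (p : ℝ) = ((2 * p : ℕ) : ℝ) by push_cast; ring, Real.rpow_natCast]
      field_simp
    rw [f1, Real.mul_rpow (by positivity) (by positivity),
      Real.mul_rpow (by positivity) (by positivity), ← Real.rpow_mul (by positivity),
      Real.inv_rpow (by positivity), ← Real.rpow_mul hθ.le,
      show (2 * (p : ℝ) + 1) * (q / 2) = 1 by rw [hq]; field_simp, Real.rpow_one,
      show 2 * (q / 2) = q by ring]
    rfl
  rw [e3]
  ring

/-! ### Moments of the magnetization under the planted law -/

lemma gibbsMean_const_mul {n : ℕ} (θ : ℝ) (S : Finset (Fin n)) (h : Fin n → ℝ) (c : ℝ)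
    (f : (Fin n → Bool) → ℝ) : gibbsMean θ S h (fun σ => c * f σ) = c * gibbsMean θ S h f := by
  unfold gibbsMean
  rw [Finset.mul_sum]
  exact Finset.sum_congr rfl fun σ _ => by ring

lemma exists_scale (p : ℕ) {k : ℝ} (hk : 1 ≤ k) :
    ∃ l : ℝ, 1 ≤ l ∧ l ^ (4 * p + 2) = k ∧ l ^ 2 = k ^ (1 / (2 * ((p + 1 : ℕ) : ℝ) - 1)) := by
  refine ⟨k ^ (1 / (4 * (p : ℝ) + 2)), Real.one_le_rpow hk (by positivity), ?_, ?_⟩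
  · rw [← Real.rpow_natCast, ← Real.rpow_mul (by linarith)]
    push_cast
    rw [one_div, inv_mul_cancel₀ (by positivity), Real.rpow_one]
  · rw [← Real.rpow_natCast, ← Real.rpow_mul (by linarith)]
    congr 1
    push_cast
    rw [show 2 * ((p : ℝ) + 1) - 1 = 2 * p + 1 by ring,
      show 4 * (p : ℝ) + 2 = 2 * (2 * p + 1) by ring]
    field_simp

theorem exists_mag_fourth_moment_bound {μ : Measure ℝ} [IsProbabilityMeasure μ]
    (hint : Integrable (fun h : ℝ => h) μ)
    {θ : ℝ} (hθ : 0 < θ) {p : ℕ} (hp : 1 ≤ p) (hflat : HasFlatMinimum (potential μ θ) (p + 1)) :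
    ∃ K : ℝ, 0 < K ∧ ∀ (n : ℕ) (S : Finset (Fin n)), 0 < S.card →
      ∫ σ, ((S.card : ℝ) ^ (1 / (2 * ((p + 1 : ℕ) : ℝ) - 1)) * mag S σ ^ 2) ^ 2
        ∂(plantedLaw μ θ S) ≤ K := by
  obtain ⟨r, K, hr0, hr1, hK, h4, -⟩ := exists_conditional_moments hint hθ hp hflat
  have h1r : 0 < 1 - r := by linarith
  refine ⟨K * (1 + 1 / (1 - r)), by positivity, fun n S hS => ?_⟩
  obtain ⟨l, hl, hlk, hl2⟩ := exists_scale p (k := S.card) (by exact_mod_cast hS)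
  rw [← hl2, integral_plantedLaw]
  have h1 : ∀ h : Fin n → ℝ, gibbsMean θ S h (fun σ => (l ^ 2 * mag S σ ^ 2) ^ 2)
      ≤ K * disorder μ r S h := by
    intro h
    refine le_trans (le_of_eq ?_) (h4 n S h l hS hl hlk)
    rw [← gibbsMean_const_mul]
    congr 1; ext σ; ring
  calc _ ≤ ∫ h, K * disorder μ r S h ∂(Measure.pi fun _ => μ) :=
        integral_mono (integrable_gibbsMean μ θ S _)
          ((integrable_disorder μ hr0.le hr1 S).const_mul K) h1
    _ ≤ _ := by
        rw [integral_const_mul]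
        exact mul_le_mul_of_nonneg_left (integral_disorder_le μ hr0.le hr1 S) hK.le

-- On U ≤ M the conditional second moment is replaced by a function of W. On U > M both quantities
-- are O(√U), and √U ≤ U/√M, so the bounded mean of U makes this part O(1/√M). The central limit
-- theorem then evaluates the remaining mean.
set_option maxHeartbeats 1000000 in
theorem exists_mag_second_moment_limit {μ : Measure ℝ} [IsProbabilityMeasure μ]
    (hint : Integrable (fun h : ℝ => h) μ) (hsymm : μ.map (fun h : ℝ => -h) = μ)
    (hnondeg : μ ≠ Measure.dirac 0) {θ : ℝ} (hcrit : θ = 1 / meanSechSq μ)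
    {p : ℕ} (hp : 1 ≤ p) (hflat : HasFlatMinimum (potential μ θ) (p + 1)) {ε : ℝ} (hε : 0 < ε) :
    ∃ k₀ : ℕ, ∀ (n : ℕ) (S : Finset (Fin n)), k₀ ≤ S.card →
      |(∫ σ, (S.card : ℝ) ^ (1 / (2 * ((p + 1 : ℕ) : ℝ) - 1)) * mag S σ ^ 2 ∂(plantedLaw μ θ S))
        - critMoment μ θ (p + 1)| ≤ ε := by
  have hm := meanSechSq_pos μ
  have hθ : 0 < θ := by rw [hcrit]; positivity
  have hc := flatCoeff_pos hflat
  obtain ⟨r, K, hr0, hr1, hK, h4, h2⟩ := exists_conditional_moments hint hθ hp hflat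
  have h1r : 0 < 1 - r := by linarith
  rw [← integral_critSq hsymm hnondeg hcrit hflat]
  set f := critSq θ (flatCoeff μ θ (p + 1)) p with hf
  set b := √θ / ((2 * p + 2 : ℝ) * flatCoeff μ θ (p + 1)) with hb
  have hb0 : 0 ≤ b := by positivity
  have hfb : ∀ w, f w ≤ 1 + b * |w| := critSq_le hc hp
  have hf0 : ∀ w, 0 ≤ f w := critSq_nonneg _ _ _
  -- The first summand bounds the conditional second moment by √U, through AM–GM and the fourth
  -- moment; the second comes from the linear growth of the limiting function and |W| ≤ √U.
  set Q := (1 + K) / 2 + (1 + b) / θ with hQ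
  have hQ0 : 0 < Q := by positivity
  set E := 1 + 1 / (1 - r) with hE
  have hE0 : 0 < E := by positivity
  set M := max 1 ((3 * Q * E / ε) ^ 2) with hM
  have hM1 : 1 ≤ M := le_max_left _ _
  have hsM : 3 * Q * E / ε ≤ √M := Real.le_sqrt_of_sq_le (le_max_right _ _)
  have hsM0 : 0 < √M := Real.sqrt_pos.2 (by linarith)
  have hQM : Q / √M * E ≤ ε / 3 := by
    rw [div_le_iff₀ hε] at hsM
    rw [div_mul_eq_mul_div, div_le_iff₀ hsM0]
    linarith
  obtain ⟨Λ, hΛ⟩ := h2 (ε / 3) M (by positivity) hM1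
  obtain ⟨k₁, hk₁⟩ := exists_clt_bound hsymm (continuous_critSq θ (flatCoeff μ θ (p + 1)) p) hf0 hfb
    (show 0 < ε / 3 * θ by positivity)
  obtain ⟨k₂, hk₂⟩ := exists_nat_ge (|Λ| ^ (4 * p + 2))
  refine ⟨max 1 (max k₁ k₂), fun n S hS => ?_⟩
  have hS0 : 0 < S.card := lt_of_lt_of_le one_pos ((le_max_left _ _).trans hS)
  have hS1 : k₁ ≤ S.card := (le_max_left _ _).trans ((le_max_right _ _).trans hS)
  have hS2 : k₂ ≤ S.card := (le_max_right _ _).trans ((le_max_right _ _).trans hS)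
  obtain ⟨l, hl, hlk, hl2⟩ := exists_scale p (k := S.card) (by exact_mod_cast hS0)
  have hl0 : 0 ≤ l := by linarith
  have hΛl : Λ ≤ l := by
    refine (le_abs_self Λ).trans ?_
    refine le_of_pow_le_pow_left₀ (n := 4 * p + 2) (by omega) hl0 ?_
    rw [hlk]
    exact hk₂.trans (by exact_mod_cast hS2)
  rw [← hl2, integral_plantedLaw]
  set G : (Fin n → ℝ) → ℝ := fun h => gibbsMean θ S h (fun σ => l ^ 2 * mag S σ ^ 2) with hG
  set W : (Fin n → ℝ) → ℝ := fun h => tanhDev μ S h 0 / √S.card with hW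
  have hG2 : ∀ h, G h = l ^ 2 * gibbsMean θ S h (fun σ => mag S σ ^ 2) := fun h =>
    gibbsMean_const_mul _ _ _ _ _
  have hpt : ∀ h, |G h - f (W h) / θ| ≤ ε / 3 + Q / √M * disorder μ r S h := by
    intro h
    have hU1 := one_le_disorder μ hr0.le S h
    set U := disorder μ r S h with hU
    rcases le_total U M with hUM | hUM
    · have := hΛ n S h l hS0 hl hΛl hlk hUM
      rw [hG2]
      have h3 : 0 ≤ Q / √M * U := by positivity
      linarith
    · have hu0 : 0 < √U := Real.sqrt_pos.2 (by linarith)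
      have hu1 : 1 ≤ √U := Real.one_le_sqrt.2 hU1
      have huu : √U * √U = U := Real.mul_self_sqrt (by linarith)
      have hGn : 0 ≤ G h := gibbsMean_nonneg _ _ _ fun σ => by positivity
      have hGle : G h ≤ (1 + K) / 2 * √U := by
        have e1 : G h ≤ gibbsMean θ S h (fun σ => √U / 2 * 1 + 1 / (2 * √U) * (l ^ 4 * mag S σ ^ 4)) := by
          apply gibbsMean_mono
          intro σ
          have e2 : √U / 2 * 1 + 1 / (2 * √U) * (l ^ 4 * mag S σ ^ 4)
              = (√U ^ 2 + (l ^ 2 * mag S σ ^ 2) ^ 2) / (2 * √U) := by field_simp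
          rw [e2, le_div_iff₀ (by positivity)]
          nlinarith [sq_nonneg (√U - l ^ 2 * mag S σ ^ 2)]
        have e3 : gibbsMean θ S h (fun σ => √U / 2 * 1 + 1 / (2 * √U) * (l ^ 4 * mag S σ ^ 4))
            = √U / 2 + 1 / (2 * √U) * (l ^ 4 * gibbsMean θ S h (fun σ => mag S σ ^ 4)) := by
          rw [← gibbsMean_const_mul, ← gibbsMean_const_mul]
          unfold gibbsMean
          simp_rw [mul_add, Finset.sum_add_distrib, mul_one]
          rw [← Finset.sum_mul, sum_gibbsProb, one_mul]
        rw [e3] at e1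
        refine e1.trans ?_
        calc _ ≤ √U / 2 + 1 / (2 * √U) * (K * U) := by
              have := h4 n S h l hS0 hl hlk
              exact add_le_add_right (mul_le_mul_of_nonneg_left this (by positivity)) _
          _ = √U / 2 + 1 / (2 * √U) * (K * (√U * √U)) := by rw [huu]
          _ = _ := by field_simp
      have hfle : f (W h) / θ ≤ (1 + b) / θ * √U := by
        have e1 : |W h| ≤ √U := by
          rw [hW]
          dsimp only
          rw [abs_div, abs_of_nonneg (Real.sqrt_nonneg _), div_le_iff₀ (Real.sqrt_pos.2 (by
            exact_mod_cast hS0))]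
          linarith [abs_tanhDev_zero_le μ hr0.le hr1 S h]
        rw [div_mul_eq_mul_div]
        gcongr
        refine (hfb _).trans ?_
        nlinarith [mul_le_mul_of_nonneg_left e1 hb0]
      have hfn : 0 ≤ f (W h) / θ := div_nonneg (hf0 _) hθ.le
      have h5 : √U ≤ U / √M := by
        rw [le_div_iff₀ hsM0]
        calc √U * √M ≤ √U * √U := by gcongr
          _ = U := huu
      have h6 : |G h - f (W h) / θ| ≤ Q * √U := by
        rw [abs_le, hQ, add_mul]
        constructor <;> linarith
      calc _ ≤ Q * √U := h6
        _ ≤ Q * (U / √M) := by gcongr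
        _ = Q / √M * U := by ring
        _ ≤ _ := by linarith
  have hfi : Integrable (fun h => f (W h)) (Measure.pi fun _ : Fin n => μ) := by
    refine Integrable.mono' (integrable_const (1 + b * (2 * S.card / √S.card)))
      (((continuous_critSq _ _ _).comp ((continuous_tanhDev μ S 0).div_const _)).aestronglyMeasurable)
      (ae_of_all _ fun h => ?_)
    change ‖f (W h)‖ ≤ _
    rw [Real.norm_eq_abs, abs_of_nonneg (hf0 _)]
    refine (hfb _).trans ?_
    rw [hW]
    dsimp only
    rw [abs_div, abs_of_nonneg (Real.sqrt_nonneg _)]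
    gcongr
    exact abs_tanhDev_le μ S h 0
  have hGi : Integrable G (Measure.pi fun _ : Fin n => μ) := integrable_gibbsMean μ θ S _
  have hDi := integrable_disorder μ hr0.le hr1 S
  have h7 : |∫ h, G h ∂(Measure.pi fun _ : Fin n => μ)
      - (∫ h, f (W h) ∂(Measure.pi fun _ : Fin n => μ)) / θ| ≤ ε / 3 + ε / 3 := by
    rw [← integral_div, ← integral_sub hGi (hfi.div_const θ)]
    refine (norm_integral_le_of_norm_le (f := fun h => G h - f (W h) / θ)
      ((integrable_const (ε / 3)).add (hDi.const_mul (Q / √M))) (ae_of_all _ fun h => hpt h)).trans ?_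
    simp only [Pi.add_apply]
    rw [integral_add (integrable_const _) (hDi.const_mul _), integral_const_mul]
    simp only [integral_const, probReal_univ, one_smul]
    gcongr
    refine le_trans ?_ hQM
    have := integral_disorder_le μ hr0.le hr1 S
    gcongr
  have h8 := hk₁ n S hS1 hS0
  have h9 : |(∫ h, f (W h) ∂(Measure.pi fun _ : Fin n => μ)) / θ
      - (∫ w, f w ∂(gaussianReal 0 Var[Real.tanh; μ].toNNReal)) / θ| ≤ ε / 3 := by
    rw [← sub_div, abs_div, abs_of_pos hθ, div_le_iff₀ hθ]
    exact h8
  rw [abs_le] at h7 h9 ⊢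
  constructor <;> linarith [h7.1, h7.2, h9.1, h9.2]

/-! ### Averages over independent signs -/

/-- The mean over independent uniform signs. -/
def signAvg {n : ℕ} (g : (Fin n → Bool) → ℝ) : ℝ := (∑ ε, g ε) / 2 ^ n

lemma spin_sq (b : Bool) : spin b ^ 2 = 1 := by cases b <;> simp [spin]

lemma spin_beq (a b : Bool) : spin (a == b) = spin a * spin b := by
  cases a <;> cases b <;> simp [spin]

lemma signAvg_const {n : ℕ} (c : ℝ) : signAvg (fun _ : Fin n → Bool => c) = c := by
  simp [signAvg]

lemma signAvg_mono {n : ℕ} {f g : (Fin n → Bool) → ℝ} (h : ∀ ε, f ε ≤ g ε) :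
    signAvg f ≤ signAvg g := by
  unfold signAvg
  gcongr
  exact h _

lemma signAvg_add {n : ℕ} (f g : (Fin n → Bool) → ℝ) :
    signAvg (fun ε => f ε + g ε) = signAvg f + signAvg g := by
  unfold signAvg; rw [Finset.sum_add_distrib, add_div]

lemma signAvg_const_mul {n : ℕ} (c : ℝ) (f : (Fin n → Bool) → ℝ) :
    signAvg (fun ε => c * f ε) = c * signAvg f := by
  unfold signAvg; rw [← Finset.mul_sum, mul_div_assoc]

lemma signAvg_sum {n : ℕ} {ι : Type*} (s : Finset ι) (f : ι → (Fin n → Bool) → ℝ) :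
    signAvg (fun ε => ∑ i ∈ s, f i ε) = ∑ i ∈ s, signAvg (f i) := by
  unfold signAvg; rw [Finset.sum_comm, Finset.sum_div]

lemma signAvg_eq_zero_of_flip {n : ℕ} (i : Fin n) {g : (Fin n → Bool) → ℝ}
    (h : ∀ ε, g (Function.update ε i (!ε i)) = -g ε) : signAvg g = 0 := by
  have hinv : Function.Involutive (fun ε : Fin n → Bool => Function.update ε i (!ε i)) := by
    intro ε; simp
  have h1 := Equiv.sum_comp hinv.toPerm g
  simp only [Function.Involutive.coe_toPerm, h, Finset.sum_neg_distrib] at h1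
  unfold signAvg
  rw [show ∑ ε, g ε = 0 by linarith, zero_div]

lemma signAvg_spin {n : ℕ} (i : Fin n) : signAvg (fun ε => spin (ε i)) = 0 := by
  apply signAvg_eq_zero_of_flip i
  intro ε
  cases h : ε i <;> simp [spin]

lemma signAvg_spin_mul_spin {n : ℕ} (i j : Fin n) :
    signAvg (fun ε => spin (ε i) * spin (ε j)) = if i = j then 1 else 0 := by
  split_ifs with hij
  · subst hij
    have : (fun ε : Fin n → Bool => spin (ε i) * spin (ε i)) = fun _ => 1 := by
      ext ε; rw [← sq, spin_sq]
    rw [this, signAvg_const]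
  · apply signAvg_eq_zero_of_flip i
    intro ε
    rw [Function.update_of_ne (Ne.symm hij)]
    cases ε i <;> cases ε j <;> simp [spin]

lemma signAvg_sq_add_linear {n : ℕ} (A : ℝ) (a : Fin n → ℝ) :
    signAvg (fun ε => (A + ∑ i, a i * spin (ε i)) ^ 2) = A ^ 2 + ∑ i, a i ^ 2 := by
  have h1 : (fun ε : Fin n → Bool => (A + ∑ i, a i * spin (ε i)) ^ 2)
      = fun ε => A ^ 2 + (2 * A * ∑ i, a i * spin (ε i)
        + ∑ i, ∑ j, (a i * a j) * (spin (ε i) * spin (ε j))) := by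
    ext ε
    have : ∑ i, ∑ j, (a i * a j) * (spin (ε i) * spin (ε j)) = (∑ i, a i * spin (ε i)) ^ 2 := by
      rw [sq, Finset.sum_mul_sum]
      exact Finset.sum_congr rfl fun i _ => Finset.sum_congr rfl fun j _ => by ring
    rw [this]; ring
  rw [h1, signAvg_add, signAvg_const, signAvg_add, signAvg_const_mul, signAvg_sum, signAvg_sum]
  simp_rw [signAvg_const_mul, signAvg_spin, signAvg_sum, signAvg_const_mul,
    signAvg_spin_mul_spin]
  simp [sq]

/-- Writing exp(z²/4) as a Gaussian average of exp(z x/√2) reduces to independent signs, for which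
cosh b ≤ exp(b²/2). The comparison of Gaussian integrals gives √2, rounded up to 2. -/
lemma signAvg_exp_sq_le {n : ℕ} {a : Fin n → ℝ} (ha : ∑ i, a i ^ 2 ≤ 1) :
    signAvg (fun ε => Real.exp ((∑ i, a i * spin (ε i)) ^ 2 / 4)) ≤ 2 := by
  have hpi : (0 : ℝ) < √(2 * Real.pi / 1) := by positivity
  have h1 : ∀ z : ℝ, √(2 * Real.pi / 1) * Real.exp (z ^ 2 / 4)
      = ∫ x, Real.exp (-(x ^ 2 / 2) + z / √2 * x) := by
    intro z
    have h := integral_pow_mul_exp_quadratic one_pos (z / √2) 0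
    simp only [pow_zero, one_mul, integral_const, probReal_univ, smul_eq_mul, mul_one] at h
    rw [h, div_pow, Real.sq_sqrt zero_le_two]
    congr 2
    ring
  have hint : ∀ z : ℝ, Integrable fun x : ℝ => Real.exp (-(x ^ 2 / 2) + z / √2 * x) := by
    intro z
    have h := integrable_pow_mul_exp_quadratic one_pos (z / √2) 0
    simpa only [pow_zero, one_mul] using h
  have h2 : √(2 * Real.pi / 1) * ∑ ε : Fin n → Bool, Real.exp ((∑ i, a i * spin (ε i)) ^ 2 / 4)
      ≤ 2 ^ n * ∫ x : ℝ, Real.exp (-(1 / 4) * x ^ 2) := by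
    rw [Finset.mul_sum]
    simp_rw [h1]
    rw [← integral_finsetSum _ fun ε _ => hint _, ← integral_const_mul]
    apply integral_mono (integrable_finsetSum _ fun ε _ => hint _)
      ((integrable_exp_neg_mul_sq (by norm_num)).const_mul _)
    intro x
    dsimp only
    have e1 : ∀ ε : Fin n → Bool, Real.exp (-(x ^ 2 / 2) + (∑ i, a i * spin (ε i)) / √2 * x)
        = Real.exp (-(x ^ 2 / 2)) * Real.exp (∑ i, (a i * x / √2) * spin (ε i)) := by
      intro ε
      rw [← Real.exp_add, Finset.sum_div, Finset.sum_mul]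
      congr 2
      exact Finset.sum_congr rfl fun i _ => by ring
    simp_rw [e1]
    rw [← Finset.mul_sum, sum_exp_spin, Finset.prod_mul_distrib, Finset.prod_const,
      Finset.card_univ, Fintype.card_fin]
    have e2 : ∏ i, Real.cosh (a i * x / √2) ≤ Real.exp (x ^ 2 / 4) := by
      calc ∏ i, Real.cosh (a i * x / √2) ≤ ∏ i, Real.exp ((a i * x / √2) ^ 2 / 2) :=
            Finset.prod_le_prod (fun i _ => (Real.cosh_pos _).le)
              fun i _ => Real.cosh_le_exp_half_sq _
        _ = Real.exp ((∑ i, a i ^ 2) * (x ^ 2 / 4)) := by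
            rw [← Real.exp_sum, Finset.sum_mul]
            congr 1
            refine Finset.sum_congr rfl fun i _ => ?_
            rw [div_pow, Real.sq_sqrt zero_le_two]; ring
        _ ≤ _ := by
            apply Real.exp_le_exp.2
            exact mul_le_of_le_one_left (by positivity) ha
    calc Real.exp (-(x ^ 2 / 2)) * (2 ^ n * ∏ i, Real.cosh (a i * x / √2))
        ≤ Real.exp (-(x ^ 2 / 2)) * (2 ^ n * Real.exp (x ^ 2 / 4)) := by gcongr
      _ = 2 ^ n * (Real.exp (-(x ^ 2 / 2)) * Real.exp (x ^ 2 / 4)) := by ring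
      _ = 2 ^ n * Real.exp (-(1 / 4) * x ^ 2) := by rw [← Real.exp_add]; ring_nf
  rw [integral_gaussian] at h2
  have h3 : √(Real.pi / (1 / 4)) ≤ 2 * √(2 * Real.pi / 1) := by
    apply Real.sqrt_le_iff.2
    refine ⟨by positivity, ?_⟩
    rw [mul_pow, Real.sq_sqrt (by positivity)]
    linarith [Real.pi_pos]
  unfold signAvg
  rw [div_le_iff₀ (by positivity)]
  have h4 : √(2 * Real.pi / 1) * ∑ ε : Fin n → Bool, Real.exp ((∑ i, a i * spin (ε i)) ^ 2 / 4)
      ≤ √(2 * Real.pi / 1) * (2 * 2 ^ n) := by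
    calc _ ≤ 2 ^ n * √(Real.pi / (1 / 4)) := h2
      _ ≤ 2 ^ n * (2 * √(2 * Real.pi / 1)) := by gcongr
      _ = _ := by ring
  exact le_of_mul_le_mul_left h4 hpi

/-- z⁴/32 is the second-order term of exp(z²/4), so the exponential moment of the normalized sum
gives 32 · 2 = 64. -/
lemma signAvg_pow_four_le {n : ℕ} {a : Fin n → ℝ} {s : ℝ} (hs : 0 < s) (ha : ∑ i, a i ^ 2 ≤ s) :
    signAvg (fun ε => (∑ i, a i * spin (ε i)) ^ 4) ≤ 64 * s ^ 2 := by
  have h1 := signAvg_exp_sq_le (a := fun i => a i / √s) (by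
    simp_rw [div_pow, Real.sq_sqrt hs.le]
    rw [← Finset.sum_div]
    exact div_le_one_of_le₀ ha hs.le)
  have h2 : ∀ ε : Fin n → Bool, (∑ i, a i * spin (ε i)) ^ 4
      ≤ 32 * s ^ 2 * Real.exp ((∑ i, a i / √s * spin (ε i)) ^ 2 / 4) := by
    intro ε
    set z := ∑ i, a i / √s * spin (ε i) with hz
    have e1 : ∑ i, a i * spin (ε i) = √s * z := by
      rw [hz, Finset.mul_sum]
      refine Finset.sum_congr rfl fun i _ => ?_
      have : √s ≠ 0 := by positivity
      field_simp
    have e2 := Real.quadratic_le_exp_of_nonneg (show 0 ≤ z ^ 2 / 4 by positivity)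
    rw [e1, mul_pow, show √s ^ 4 = (√s ^ 2) ^ 2 by ring, Real.sq_sqrt hs.le]
    have e3 : z ^ 4 ≤ 32 * Real.exp (z ^ 2 / 4) := by nlinarith [sq_nonneg z]
    calc s ^ 2 * z ^ 4 ≤ s ^ 2 * (32 * Real.exp (z ^ 2 / 4)) := by gcongr
      _ = _ := by ring
  calc _ ≤ signAvg (fun ε : Fin n → Bool =>
        32 * s ^ 2 * Real.exp ((∑ i, a i / √s * spin (ε i)) ^ 2 / 4)) := signAvg_mono h2
    _ ≤ 32 * s ^ 2 * 2 := by rw [signAvg_const_mul]; gcongr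
    _ = _ := by ring

/-! ### Symmetry of the planted law outside of the clique -/

/-- Multiply the spins outside of `S` by the signs `ε`. -/
def twist {n : ℕ} (S : Finset (Fin n)) (ε σ : Fin n → Bool) : Fin n → Bool :=
  fun i => if i ∈ S then σ i else (σ i == ε i)

lemma spin_twist {n : ℕ} (S : Finset (Fin n)) (ε σ : Fin n → Bool) (i : Fin n) :
    spin (twist S ε σ i) = spin (σ i) * if i ∈ S then 1 else spin (ε i) := by
  unfold twist
  split_ifs
  · rw [mul_one]
  · exact spin_beq _ _

lemma twist_involutive {n : ℕ} (S : Finset (Fin n)) (ε : Fin n → Bool) :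
    Function.Involutive (twist S ε) := by
  intro σ
  ext i
  unfold twist
  split_ifs
  · rfl
  · cases σ i <;> cases ε i <;> rfl

lemma sum_spin_twist {n : ℕ} (S : Finset (Fin n)) (ε σ : Fin n → Bool) :
    ∑ i ∈ S, spin (twist S ε σ i) = ∑ i ∈ S, spin (σ i) :=
  Finset.sum_congr rfl fun i hi => by rw [spin_twist, if_pos hi, mul_one]

lemma gibbsWeight_twist {n : ℕ} (θ : ℝ) (S : Finset (Fin n)) (h : Fin n → ℝ) (ε σ : Fin n → Bool) :
    gibbsWeight θ S h (twist S ε σ)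
      = gibbsWeight θ S (fun i => (if i ∈ S then 1 else spin (ε i)) * h i) σ := by
  unfold gibbsWeight
  rw [sum_spin_twist]
  congr 2
  exact Finset.sum_congr rfl fun i _ => by rw [spin_twist]; ring

lemma gibbsProb_twist {n : ℕ} (θ : ℝ) (S : Finset (Fin n)) (h : Fin n → ℝ) (ε σ : Fin n → Bool) :
    gibbsProb θ S h (twist S ε σ)
      = gibbsProb θ S (fun i => (if i ∈ S then 1 else spin (ε i)) * h i) σ := by
  unfold gibbsProb
  rw [gibbsWeight_twist]
  congr 1
  rw [← Equiv.sum_comp (twist_involutive S ε).toPerm]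
  exact Finset.sum_congr rfl fun σ _ => gibbsWeight_twist θ S h ε σ

lemma measurePreserving_signs {μ : Measure ℝ} [IsProbabilityMeasure μ]
    (hsymm : μ.map (fun h : ℝ => -h) = μ) {n : ℕ} (S : Finset (Fin n)) (ε : Fin n → Bool) :
    MeasurePreserving (fun (h : Fin n → ℝ) i => (if i ∈ S then 1 else spin (ε i)) * h i)
      (Measure.pi fun _ => μ) (Measure.pi fun _ => μ) := by
  refine measurePreserving_pi (fun _ => μ) (fun _ => μ)
    (f := fun i x => (if i ∈ S then 1 else spin (ε i)) * x) fun i => ?_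
  split_ifs
  · simp only [one_mul]
    exact MeasurePreserving.id μ
  · cases ε i
    · simp only [spin, Bool.false_eq_true, if_false, neg_one_mul]
      exact ⟨measurable_neg, hsymm⟩
    · simp only [spin, if_true, one_mul]
      exact MeasurePreserving.id μ

/-- The interaction does not involve the spins off S, so changing their signs amounts to changing
the signs of their fields, and this preserves the product law because μ is symmetric. -/
lemma integral_plantedLaw_twist {μ : Measure ℝ} [IsProbabilityMeasure μ]
    (hsymm : μ.map (fun h : ℝ => -h) = μ) (θ : ℝ) {n : ℕ} (S : Finset (Fin n)) (ε : Fin n → Bool)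
    (f : (Fin n → Bool) → ℝ) :
    ∫ σ, f (twist S ε σ) ∂(plantedLaw μ θ S) = ∫ σ, f σ ∂(plantedLaw μ θ S) := by
  rw [integral_plantedLaw, integral_plantedLaw]
  have hmp := measurePreserving_signs hsymm S ε
  have h1 : ∀ h : Fin n → ℝ, gibbsMean θ S h (fun σ => f (twist S ε σ))
      = gibbsMean θ S (fun i => (if i ∈ S then 1 else spin (ε i)) * h i) f := by
    intro h
    unfold gibbsMean
    simp_rw [← gibbsProb_twist]
    rw [← Equiv.sum_comp (twist_involutive S ε).toPerm]
    refine Finset.sum_congr rfl fun σ _ => ?_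
    simp only [Function.Involutive.coe_toPerm]
    rw [twist_involutive S ε σ]
  simp_rw [h1]
  have h2 := integral_map (μ := Measure.pi fun _ : Fin n => μ) hmp.measurable.aemeasurable
    (f := fun h => gibbsMean θ S h f)
    (by rw [hmp.map_eq]; exact (integrable_gibbsMean μ θ S f).aestronglyMeasurable)
  rw [hmp.map_eq] at h2
  exact h2.symm

lemma integral_plantedLaw_signAvg {μ : Measure ℝ} [IsProbabilityMeasure μ]
    (hsymm : μ.map (fun h : ℝ => -h) = μ) (θ : ℝ) {n : ℕ} (S : Finset (Fin n))
    (f : (Fin n → Bool) → ℝ) :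
    ∫ σ, f σ ∂(plantedLaw μ θ S)
      = ∫ σ, signAvg (fun ε => f (twist S ε σ)) ∂(plantedLaw μ θ S) := by
  unfold signAvg
  rw [integral_div, integral_finsetSum _ fun ε _ => .of_finite]
  simp_rw [integral_plantedLaw_twist hsymm]
  simp

/-- With S empty every spin can be flipped, so the null law is uniform on sign vectors, whatever the
symmetric law of the field. -/
lemma integral_nullLaw {μ : Measure ℝ} [IsProbabilityMeasure μ]
    (hsymm : μ.map (fun h : ℝ => -h) = μ) {n : ℕ} (f : (Fin n → Bool) → ℝ) :
    ∫ σ, f σ ∂(nullLaw n μ) = signAvg f := by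
  unfold nullLaw
  rw [integral_plantedLaw_signAvg hsymm]
  have h1 : ∀ σ : Fin n → Bool, signAvg (fun ε => f (twist ∅ ε σ)) = signAvg f := by
    intro σ
    unfold signAvg
    congr 1
    have e1 : ∀ ε, twist ∅ ε σ = twist ∅ σ ε := by
      intro ε; ext i; simp only [twist, Finset.notMem_empty, if_false]; rw [Bool.beq_comm]
    simp_rw [e1]
    exact Equiv.sum_comp (twist_involutive ∅ σ).toPerm f
  simp_rw [h1]
  simp

/-! ### Deviation bounds for samples -/

instance sampleLaw_isProbability {n m : ℕ} (P : Measure (Fin n → Bool)) [IsProbabilityMeasure P] :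
    IsProbabilityMeasure (sampleLaw m P) := by unfold sampleLaw; infer_instance

lemma sampleLaw_chebyshev {n m : ℕ} (P : Measure (Fin n → Bool)) [IsProbabilityMeasure P]
    (Y : (Fin n → Bool) → ℝ) (hm : 0 < m) {t : ℝ} (ht : 0 < t) :
    (sampleLaw m P).real {x | t ≤ |(∑ j, Y (x j)) / (m : ℝ) - ∫ σ, Y σ ∂P|}
      ≤ (∫ σ, Y σ ^ 2 ∂P) / (m * t ^ 2) := by
  have hm0 : (0 : ℝ) < m := by exact_mod_cast hm
  have hY : MemLp Y 2 P := .of_discrete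
  have hvar := variance_sum_pi (μ := fun _ : Fin m => P) (X := fun _ => Y) fun _ => hY
  have hfun : (∑ j : Fin m, fun x : Fin m → Fin n → Bool => Y (x j)) = fun x => ∑ j, Y (x j) := by
    ext x; simp
  rw [hfun] at hvar
  have hmean : ∫ x : Fin m → Fin n → Bool, (∑ j, Y (x j)) ∂(sampleLaw m P) = m * ∫ σ, Y σ ∂P := by
    unfold sampleLaw
    rw [integral_finsetSum _ fun j _ => .of_finite]
    have : ∀ j : Fin m, ∫ x : Fin m → Fin n → Bool, Y (x j) ∂(Measure.pi fun _ => P)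
        = ∫ σ, Y σ ∂P := fun j =>
      integral_comp_eval (μ := fun _ : Fin m => P) (f := Y) (i := j) hY.aestronglyMeasurable
    simp [this]
  have hcheb := meas_ge_le_variance_div_sq (μ := sampleLaw m P)
    (X := fun x => ∑ j, Y (x j)) .of_discrete (show 0 < m * t by positivity)
  have hset : {x : Fin m → Fin n → Bool | t ≤ |(∑ j, Y (x j)) / (m : ℝ) - ∫ σ, Y σ ∂P|}
      = {x | m * t ≤ |∑ j, Y (x j) - ∫ x, (∑ j, Y (x j)) ∂(sampleLaw m P)|} := by
    ext x
    rw [Set.mem_ofPred_eq, Set.mem_ofPred_eq, hmean]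
    have e1 : (∑ j, Y (x j)) / (m : ℝ) - ∫ σ, Y σ ∂P
        = (∑ j, Y (x j) - m * ∫ σ, Y σ ∂P) / m := by field_simp
    rw [e1, abs_div, abs_of_pos hm0, le_div_iff₀ hm0, mul_comm]
  rw [hset, measureReal_def]
  have hnn : 0 ≤ Var[fun x : Fin m → Fin n → Bool => ∑ j, Y (x j); sampleLaw m P] / (m * t) ^ 2 :=
    div_nonneg (variance_nonneg _ _) (by positivity)
  refine (ENNReal.toReal_le_of_le_ofReal hnn hcheb).trans ?_
  have h1 : Var[fun x : Fin m → Fin n → Bool => ∑ j, Y (x j); sampleLaw m P]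
      ≤ m * ∫ σ, Y σ ^ 2 ∂P := by
    unfold sampleLaw
    rw [hvar, Finset.sum_const, Finset.card_univ, Fintype.card_fin, nsmul_eq_mul]
    have := variance_le_expectation_sq (μ := P) (X := Y) hY.aestronglyMeasurable
    gcongr
    exact this
  calc _ ≤ m * (∫ σ, Y σ ^ 2 ∂P) / (m * t) ^ 2 := by gcongr
    _ = _ := by field_simp

lemma sampleLaw_chernoff {n m : ℕ} (P : Measure (Fin n → Bool)) [IsProbabilityMeasure P]
    (Y : (Fin n → Bool) → ℝ) (t : ℝ) :
    (sampleLaw m P).real {x | t ≤ ∑ j, Y (x j)}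
      ≤ Real.exp (-t) * (∫ σ, Real.exp (Y σ) ∂P) ^ m := by
  have h := measure_ge_le_exp_mul_mgf (μ := sampleLaw m P)
    (X := fun x => ∑ j, Y (x j)) t zero_le_one .of_finite
  refine h.trans (le_of_eq ?_)
  rw [neg_one_mul, mgf]
  congr 1
  simp_rw [one_mul, Real.exp_sum]
  unfold sampleLaw
  rw [integral_fintype_prod_eq_prod (fun _ : Fin m => fun σ => Real.exp (Y σ))]
  simp

/-! ### The local test -/

lemma critExponent_pos {τ : ℕ} (hτ : 2 ≤ τ) : 0 < 1 / (2 * (τ : ℝ) - 1) := by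
  have : (2 : ℝ) ≤ τ := by exact_mod_cast hτ
  have : 0 < 2 * (τ : ℝ) - 1 := by linarith
  positivity

lemma critExponent_lt_one {τ : ℕ} (hτ : 2 ≤ τ) : 1 / (2 * (τ : ℝ) - 1) < 1 := by
  have : (2 : ℝ) ≤ τ := by exact_mod_cast hτ
  rw [div_lt_one (by linarith)]
  linarith

lemma card_mul_mag_sq {n : ℕ} (S : Finset (Fin n)) (hS : 0 < S.card) (σ : Fin n → Bool) :
    (S.card : ℝ) * mag S σ ^ 2 / 4
      = (∑ i, (if i ∈ S then 1 / √(S.card : ℝ) else 0) * spin (σ i)) ^ 2 / 4 := by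
  have hk : (0 : ℝ) < S.card := by exact_mod_cast hS
  have h1 : ∑ i, (if i ∈ S then 1 / √(S.card : ℝ) else 0) * spin (σ i)
      = 1 / √(S.card : ℝ) * ∑ i ∈ S, spin (σ i) := by
    simp_rw [ite_mul, zero_mul]
    rw [Finset.sum_ite_mem, Finset.univ_inter, Finset.mul_sum]
  rw [h1, mul_pow, div_pow, Real.sq_sqrt hk.le, mag]
  field_simp

lemma integral_exp_mag_sq_nullLaw_le {μ : Measure ℝ} [IsProbabilityMeasure μ]
    (hsymm : μ.map (fun h : ℝ => -h) = μ) {n : ℕ} (S : Finset (Fin n)) (hS : 0 < S.card) :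
    ∫ σ, Real.exp ((S.card : ℝ) * mag S σ ^ 2 / 4) ∂(nullLaw n μ) ≤ 2 := by
  have hk : (0 : ℝ) < S.card := by exact_mod_cast hS
  rw [integral_nullLaw hsymm]
  simp_rw [card_mul_mag_sq S hS]
  apply signAvg_exp_sq_le
  simp_rw [ite_pow]
  rw [Finset.sum_ite, Finset.sum_const]
  simp only [Finset.filter_mem_eq_inter, Finset.univ_inter, div_pow, Real.sq_sqrt hk.le]
  simp [hk.ne']

/-- Union bound over the candidate sets, at most n^k in number, with a Chernoff bound for each. The
factor 2^m comes from the exponential moment of k m_T²/4. -/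
lemma localStat_nullLaw_le {μ : Measure ℝ} [IsProbabilityMeasure μ]
    (hsymm : μ.map (fun h : ℝ => -h) = μ) (τ : ℕ) {n m : ℕ} (S : Finset (Fin n))
    (hS : 0 < S.card) (hm : 0 < m) (t : ℝ) :
    (sampleLaw m (nullLaw n μ)).real {x | t ≤ localStat τ S.card x}
      ≤ (n : ℝ) ^ S.card
        * (Real.exp (-(m * t * (S.card : ℝ) ^ (1 - 1 / (2 * (τ : ℝ) - 1)) / 4)) * 2 ^ m) := by
  classical
  set k := S.card with hk
  have hk0 : (0 : ℝ) < k := by exact_mod_cast hS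
  have hm0 : (0 : ℝ) < m := by exact_mod_cast hm
  set r : ℝ := m * t * (k : ℝ) ^ (1 - 1 / (2 * (τ : ℝ) - 1)) / 4 with hr
  have : Nonempty {S : Finset (Fin n) // S.card = k} := ⟨⟨S, rfl⟩⟩
  have hsub : {x : Fin m → Fin n → Bool | t ≤ localStat τ k x}
      ⊆ ⋃ T ∈ Finset.powersetCard k (Finset.univ : Finset (Fin n)),
        {x | r ≤ ∑ j, (k : ℝ) * mag T (x j) ^ 2 / 4} := by
    intro x hx
    obtain ⟨T, hT⟩ := exists_eq_ciSup_of_finite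
      (f := fun T : {S : Finset (Fin n) // S.card = k} =>
        (k : ℝ) ^ (1 / (2 * (τ : ℝ) - 1)) * ((∑ j, mag T.1 (x j) ^ 2) / (m : ℝ)))
    have hx' : t ≤ localStat τ k x := hx
    unfold localStat at hx'
    rw [← hT] at hx'
    simp only [Set.mem_iUnion]
    refine ⟨T.1, by simp [Finset.mem_powersetCard, T.2], ?_⟩
    show r ≤ ∑ j, (k : ℝ) * mag T.1 (x j) ^ 2 / 4
    have e1 : (k : ℝ) ^ (1 - 1 / (2 * (τ : ℝ) - 1)) * (k : ℝ) ^ (1 / (2 * (τ : ℝ) - 1)) = k := by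
      rw [← Real.rpow_add hk0, sub_add_cancel, Real.rpow_one]
    rw [← Finset.sum_div, ← Finset.mul_sum, hr]
    have hpos : 0 < m * (k : ℝ) ^ (1 - 1 / (2 * (τ : ℝ) - 1)) := by positivity
    have h2 := mul_le_mul_of_nonneg_left hx' hpos.le
    have e2 : m * (k : ℝ) ^ (1 - 1 / (2 * (τ : ℝ) - 1))
        * ((k : ℝ) ^ (1 / (2 * (τ : ℝ) - 1)) * ((∑ j, mag T.1 (x j) ^ 2) / (m : ℝ)))
        = k * ∑ j, mag T.1 (x j) ^ 2 := by
      calc _ = ((k : ℝ) ^ (1 - 1 / (2 * (τ : ℝ) - 1)) * (k : ℝ) ^ (1 / (2 * (τ : ℝ) - 1)))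
            * (m * ((∑ j, mag T.1 (x j) ^ 2) / (m : ℝ))) := by ring
        _ = _ := by rw [e1, mul_div_cancel₀ _ hm0.ne']
    rw [e2] at h2
    linarith
  calc (sampleLaw m (nullLaw n μ)).real {x | t ≤ localStat τ k x}
      ≤ (sampleLaw m (nullLaw n μ)).real
        (⋃ T ∈ Finset.powersetCard k (Finset.univ : Finset (Fin n)),
          {x | r ≤ ∑ j, (k : ℝ) * mag T (x j) ^ 2 / 4}) := measureReal_mono hsub (measure_ne_top _ _)
    _ ≤ ∑ T ∈ Finset.powersetCard k (Finset.univ : Finset (Fin n)),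
        (sampleLaw m (nullLaw n μ)).real {x | r ≤ ∑ j, (k : ℝ) * mag T (x j) ^ 2 / 4} :=
        measureReal_biUnion_finset_le _ _
    _ ≤ ∑ T ∈ Finset.powersetCard k (Finset.univ : Finset (Fin n)), Real.exp (-r) * 2 ^ m := by
        refine Finset.sum_le_sum fun T hT => ?_
        have hT : T.card = k := (Finset.mem_powersetCard.1 hT).2
        refine (sampleLaw_chernoff (nullLaw n μ) (fun σ => (k : ℝ) * mag T σ ^ 2 / 4) r).trans ?_
        have := integral_exp_mag_sq_nullLaw_le hsymm T (by omega)
        rw [hT] at this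
        gcongr
    _ = (n.choose k : ℝ) * (Real.exp (-r) * 2 ^ m) := by
        rw [Finset.sum_const, Finset.card_powersetCard, Finset.card_univ, Fintype.card_fin,
          nsmul_eq_mul]
    _ ≤ _ := by
        gcongr
        exact_mod_cast Nat.choose_le_pow n k

/-- The supremum is at least its value at the true clique, so Chebyshev for that single set is
enough. -/
lemma localStat_plantedLaw_le {μ : Measure ℝ} [IsProbabilityMeasure μ] (θ : ℝ) (τ : ℕ)
    {n m : ℕ} (S : Finset (Fin n)) (hm : 0 < m) {t d K : ℝ} (hd : 0 < d)
    (h₁ : t + d ≤ ∫ σ, (S.card : ℝ) ^ (1 / (2 * (τ : ℝ) - 1)) * mag S σ ^ 2 ∂(plantedLaw μ θ S))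
    (h₂ : ∫ σ, ((S.card : ℝ) ^ (1 / (2 * (τ : ℝ) - 1)) * mag S σ ^ 2) ^ 2 ∂(plantedLaw μ θ S)
      ≤ K) :
    (sampleLaw m (plantedLaw μ θ S)).real {x | localStat τ S.card x < t} ≤ K / (m * d ^ 2) := by
  refine le_trans (measureReal_mono (s₂ := {x : Fin m → Fin n → Bool | d ≤
      |(∑ j, (S.card : ℝ) ^ (1 / (2 * (τ : ℝ) - 1)) * mag S (x j) ^ 2) / (m : ℝ)
        - ∫ σ, (S.card : ℝ) ^ (1 / (2 * (τ : ℝ) - 1)) * mag S σ ^ 2 ∂(plantedLaw μ θ S)|})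
    (fun x hx => ?_) (measure_ne_top _ _)) ((sampleLaw_chebyshev (plantedLaw μ θ S)
      (fun σ => (S.card : ℝ) ^ (1 / (2 * (τ : ℝ) - 1)) * mag S σ ^ 2) hm hd).trans ?_)
  · have hx' : localStat τ S.card x < t := hx
    have h3 := (le_ciSup (f := fun T : {T : Finset (Fin n) // T.card = S.card} =>
        (S.card : ℝ) ^ (1 / (2 * (τ : ℝ) - 1)) * ((∑ j, mag T.1 (x j) ^ 2) / (m : ℝ)))
      (Set.finite_range _).bddAbove ⟨S, rfl⟩).trans_lt hx'
    rw [Set.mem_ofPred_eq, ← Finset.mul_sum, mul_div_assoc, abs_sub_comm]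
    refine le_trans ?_ (le_abs_self _)
    linarith
  · gcongr

/-- The constant 16/t need not depend on δ: the Type I bound is 1/n ≤ 1/k, and the Type II bound
decays because m ≥ (16/t) log k. Only the threshold on k depends on δ. -/
lemma local_test {μ : Measure ℝ} [IsProbabilityMeasure μ]
    (hsymm : μ.map (fun h : ℝ => -h) = μ) (θ : ℝ) {τ : ℕ} (hτ : 2 ≤ τ) {L K₄ : ℝ}
    (hlim : ∀ ε : ℝ, 0 < ε → ∃ k₀ : ℕ, ∀ (n : ℕ) (S : Finset (Fin n)), k₀ ≤ S.card →
      |(∫ σ, (S.card : ℝ) ^ (1 / (2 * (τ : ℝ) - 1)) * mag S σ ^ 2 ∂(plantedLaw μ θ S)) - L| ≤ ε)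
    (hmom : ∀ (n : ℕ) (S : Finset (Fin n)), 0 < S.card →
      ∫ σ, ((S.card : ℝ) ^ (1 / (2 * (τ : ℝ) - 1)) * mag S σ ^ 2) ^ 2 ∂(plantedLaw μ θ S) ≤ K₄)
    {t : ℝ} (ht : 0 < t) (htL : t < L) {δ : ℝ} (hδ : 0 < δ) :
    ∃ K : ℕ, ∀ (n m : ℕ) (S : Finset (Fin n)), K ≤ S.card →
      16 / t * (S.card : ℝ) ^ (1 / (2 * (τ : ℝ) - 1)) * Real.log (n : ℝ) ≤ (m : ℝ) →
      errorSum μ θ S (localStat τ S.card (n := n) (m := m)) t ≤ δ := by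
  set a := 1 / (2 * (τ : ℝ) - 1) with ha
  have ha0 : 0 < a := critExponent_pos hτ
  have ha1 : a < 1 := critExponent_lt_one hτ
  set d := (L - t) / 2 with hd
  have hd0 : 0 < d := by rw [hd]; linarith
  obtain ⟨k₀, hk₀⟩ := hlim d hd0
  have hev : ∀ᶠ k : ℕ in atTop, 2 ≤ k ∧ k₀ ≤ k ∧ 8 * Real.log 2 / t ≤ (k : ℝ) ^ (1 - a)
      ∧ 2 / δ ≤ (k : ℝ) ∧ 2 * K₄ * t / (16 * δ * d ^ 2) ≤ Real.log (k : ℝ) := by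
    refine (eventually_ge_atTop 2).and <| (eventually_ge_atTop k₀).and <|
      Eventually.and ?_ <| Eventually.and ?_ ?_
    · exact ((tendsto_rpow_atTop (by linarith)).comp tendsto_natCast_atTop_atTop).eventually_ge_atTop _
    · exact tendsto_natCast_atTop_atTop.eventually_ge_atTop _
    · exact (Real.tendsto_log_atTop.comp tendsto_natCast_atTop_atTop).eventually_ge_atTop _
  obtain ⟨K, hK⟩ := eventually_atTop.1 hev
  refine ⟨K, fun n m S hS hm => ?_⟩
  obtain ⟨h2, hkk, hlog2, hkδ, hlogk⟩ := hK _ hS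
  have hk1 : (2 : ℝ) ≤ S.card := by exact_mod_cast h2
  have hkn : (S.card : ℝ) ≤ n := by exact_mod_cast (card_finset_fin_le S)
  have hk0 : (0 : ℝ) < S.card := by linarith
  have hn0 : (0 : ℝ) < n := by linarith
  have hlogn : Real.log S.card ≤ Real.log n := Real.log_le_log hk0 hkn
  have hlogk0 : 0 < Real.log S.card := Real.log_pos (by linarith)
  have hlogn0 : 0 < Real.log n := by linarith
  have hka : 1 ≤ (S.card : ℝ) ^ a := Real.one_le_rpow (by linarith) ha0.le
  have hm0 : (0 : ℝ) < m := lt_of_lt_of_le (by positivity) hm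
  have hmn : 0 < m := by exact_mod_cast hm0
  have hSpos : 0 < S.card := by omega
  have hI : (sampleLaw m (nullLaw n μ)).real {x | t ≤ localStat τ S.card x} ≤ δ / 2 := by
    refine (localStat_nullLaw_le hsymm τ S hSpos hmn t).trans ?_
    rw [← ha]
    have e1 : (n : ℝ) ^ S.card = Real.exp (S.card * Real.log n) := by
      rw [Real.exp_nat_mul, Real.exp_log hn0]
    have e2 : (2 : ℝ) ^ m = Real.exp (m * Real.log 2) := by
      rw [Real.exp_nat_mul, Real.exp_log two_pos]
    rw [e1, e2, ← Real.exp_add, ← Real.exp_add]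
    have e3 : (S.card : ℝ) ^ a * (S.card : ℝ) ^ (1 - a) = S.card := by
      rw [← Real.rpow_add hk0, add_sub_cancel, Real.rpow_one]
    rw [div_le_iff₀ ht] at hlog2
    -- Half of the Chernoff exponent m t k^(1-a)/4 absorbs 2^m. The other half is at least 2 k log
    -- n: one k log n cancels n^k, and the other leaves at least log n.
    have b1 : m * Real.log 2 ≤ m * ((S.card : ℝ) ^ (1 - a) * t / 8) := by gcongr; linarith
    have b2 : 16 / t * (S.card : ℝ) ^ a * Real.log n * (t * (S.card : ℝ) ^ (1 - a) / 8)
        ≤ m * (t * (S.card : ℝ) ^ (1 - a) / 8) := by gcongr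
    have b3 : 16 / t * (S.card : ℝ) ^ a * Real.log n * (t * (S.card : ℝ) ^ (1 - a) / 8)
        = 2 * (S.card * Real.log n) := by
      calc _ = 2 * (t / t) * ((S.card : ℝ) ^ a * (S.card : ℝ) ^ (1 - a) * Real.log n) := by ring
        _ = _ := by rw [e3, div_self ht.ne', mul_one]
    have b4 : 1 * Real.log n ≤ S.card * Real.log n := by gcongr; linarith
    calc _ ≤ Real.exp (-Real.log n) := by
          apply Real.exp_le_exp.2
          rw [b3] at b2
          linarith
      _ = (n : ℝ)⁻¹ := by rw [Real.exp_neg, Real.exp_log hn0]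
      _ ≤ δ / 2 := by
          rw [← inv_div]
          exact inv_anti₀ (by positivity) (hkδ.trans hkn)
  have hII : (sampleLaw m (plantedLaw μ θ S)).real {x | localStat τ S.card x < t} ≤ δ / 2 := by
    have hlow := (abs_le.1 (hk₀ n S hkk)).1
    refine (localStat_plantedLaw_le θ τ S hmn hd0 (by rw [← ha]; linarith)
      (hmom n S hSpos)).trans ?_
    rw [div_le_iff₀ (by positivity)]
    rw [div_le_iff₀ (by positivity)] at hlogk
    have b1 : 16 / t * 1 * Real.log S.card ≤ m := by
      refine le_trans ?_ hm
      gcongr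
    have b2 : 16 * Real.log S.card ≤ m * t := by
      rw [mul_one, div_mul_eq_mul_div, div_le_iff₀ ht] at b1
      exact b1
    have b3 : K₄ * t ≤ δ / 2 * (m * d ^ 2) * t := by
      calc K₄ * t ≤ 16 * Real.log S.card * (δ * d ^ 2 / 2) := by linarith
        _ ≤ m * t * (δ * d ^ 2 / 2) := by gcongr
        _ = _ := by ring
    exact le_of_mul_le_mul_right b3 ht
  unfold errorSum
  linarith

/-! ### The global test -/

lemma sum_spin_twist_univ {n : ℕ} (S : Finset (Fin n)) (ε σ : Fin n → Bool) :
    ∑ i, spin (twist S ε σ i)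
      = ∑ i ∈ S, spin (σ i) + ∑ i, (if i ∈ S then 0 else spin (σ i)) * spin (ε i) := by
  have h1 : ∑ i ∈ S, spin (σ i) = ∑ i, if i ∈ S then spin (σ i) else 0 := by
    rw [Finset.sum_ite_mem, Finset.univ_inter]
  rw [h1, ← Finset.sum_add_distrib]
  refine Finset.sum_congr rfl fun i _ => ?_
  rw [spin_twist]
  split_ifs <;> ring

lemma sum_sq_offSet {n : ℕ} (S : Finset (Fin n)) (σ : Fin n → Bool) :
    ∑ i, (if i ∈ S then 0 else spin (σ i)) ^ 2 = (n : ℝ) - S.card := by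
  have h1 : ∀ i, (if i ∈ S then 0 else spin (σ i)) ^ 2 = 1 - if i ∈ S then (1 : ℝ) else 0 := by
    intro i
    split_ifs
    · norm_num
    · rw [spin_sq, sub_zero]
  simp_rw [h1]
  rw [Finset.sum_sub_distrib, Finset.sum_ite_mem, Finset.univ_inter]
  simp

/-- Averaging over signs off S kills all cross terms, and each spin off S contributes 1. -/
lemma integral_sum_spin_sq_plantedLaw {μ : Measure ℝ} [IsProbabilityMeasure μ]
    (hsymm : μ.map (fun h : ℝ => -h) = μ) (θ : ℝ) {n : ℕ} (S : Finset (Fin n)) :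
    ∫ σ, (∑ i, spin (σ i)) ^ 2 ∂(plantedLaw μ θ S)
      = ∫ σ, (∑ i ∈ S, spin (σ i)) ^ 2 ∂(plantedLaw μ θ S) + ((n : ℝ) - S.card) := by
  rw [integral_plantedLaw_signAvg hsymm]
  simp_rw [sum_spin_twist_univ, signAvg_sq_add_linear, sum_sq_offSet]
  rw [integral_add .of_finite .of_finite]
  simp

/-- From (x + y)⁴ ≤ 8 (x⁴ + y⁴) with x the clique sum; 512 = 8 · 64 comes from the fourth moment of
a signed sum. -/
lemma integral_sum_spin_pow_four_plantedLaw_le {μ : Measure ℝ} [IsProbabilityMeasure μ]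
    (hsymm : μ.map (fun h : ℝ => -h) = μ) (θ : ℝ) {n : ℕ} (S : Finset (Fin n)) (hn : 0 < n) :
    ∫ σ, ((∑ i, spin (σ i)) ^ 2) ^ 2 ∂(plantedLaw μ θ S)
      ≤ 8 * ∫ σ, (∑ i ∈ S, spin (σ i)) ^ 4 ∂(plantedLaw μ θ S) + 512 * (n : ℝ) ^ 2 := by
  have hn0 : (0 : ℝ) < n := by exact_mod_cast hn
  rw [integral_plantedLaw_signAvg hsymm]
  have h1 : ∀ σ : Fin n → Bool,
      signAvg (fun ε => ((∑ i, spin (twist S ε σ i)) ^ 2) ^ 2)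
        ≤ 8 * (∑ i ∈ S, spin (σ i)) ^ 4 + 512 * (n : ℝ) ^ 2 := by
    intro σ
    have h2 := signAvg_pow_four_le (a := fun i => if i ∈ S then 0 else spin (σ i)) hn0
      (by rw [sum_sq_offSet]; linarith [Nat.cast_nonneg (α := ℝ) S.card])
    calc _ ≤ signAvg (fun ε => 8 * (∑ i ∈ S, spin (σ i)) ^ 4
          + 8 * (∑ i, (if i ∈ S then 0 else spin (σ i)) * spin (ε i)) ^ 4) := by
          apply signAvg_mono
          intro ε
          rw [sum_spin_twist_univ]
          generalize ∑ i ∈ S, spin (σ i) = x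
          generalize ∑ i, (if i ∈ S then 0 else spin (σ i)) * spin (ε i) = y
          have e1 : (x + y) ^ 2 ≤ 2 * (x ^ 2 + y ^ 2) := by nlinarith [sq_nonneg (x - y)]
          calc ((x + y) ^ 2) ^ 2 ≤ (2 * (x ^ 2 + y ^ 2)) ^ 2 := by gcongr
            _ ≤ 8 * x ^ 4 + 8 * y ^ 4 := by nlinarith [sq_nonneg (x ^ 2 - y ^ 2)]
      _ ≤ _ := by
          rw [signAvg_add, signAvg_const, signAvg_const_mul]
          linarith
  calc _ ≤ ∫ σ, (8 * (∑ i ∈ S, spin (σ i)) ^ 4 + 512 * (n : ℝ) ^ 2) ∂(plantedLaw μ θ S) :=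
        integral_mono .of_finite .of_finite h1
    _ = _ := by
        rw [integral_add .of_finite .of_finite, integral_const_mul]
        simp

lemma integral_sum_spin_sq_nullLaw {μ : Measure ℝ} [IsProbabilityMeasure μ]
    (hsymm : μ.map (fun h : ℝ => -h) = μ) (n : ℕ) :
    ∫ σ, (∑ i, spin (σ i)) ^ 2 ∂(nullLaw n μ) = n := by
  unfold nullLaw
  rw [integral_sum_spin_sq_plantedLaw hsymm]
  simp

lemma integral_sum_spin_pow_four_nullLaw_le {μ : Measure ℝ} [IsProbabilityMeasure μ]
    (hsymm : μ.map (fun h : ℝ => -h) = μ) {n : ℕ} (hn : 0 < n) :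
    ∫ σ, ((∑ i, spin (σ i)) ^ 2) ^ 2 ∂(nullLaw n μ) ≤ 512 * (n : ℝ) ^ 2 := by
  unfold nullLaw
  have := integral_sum_spin_pow_four_plantedLaw_le hsymm 0 (∅ : Finset (Fin n)) hn
  simpa using this

lemma globalStat_nullLaw_le {μ : Measure ℝ} [IsProbabilityMeasure μ]
    (hsymm : μ.map (fun h : ℝ => -h) = μ) (τ : ℕ) {n m k : ℕ} (hk : 0 < k) (hn : 0 < n)
    (hm : 0 < m) {t : ℝ} (ht : 0 < t) :
    (sampleLaw m (nullLaw n μ)).real {x | t ≤ globalStat τ k x}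
      ≤ 512 * (n : ℝ) ^ 2
        / (m * (t * (k : ℝ) ^ ((4 * (τ : ℝ) - 3) / (2 * (τ : ℝ) - 1))) ^ 2) := by
  have hk0 : (0 : ℝ) < k := by exact_mod_cast hk
  set b := (4 * (τ : ℝ) - 3) / (2 * (τ : ℝ) - 1) with hb
  have hkb : 0 < (k : ℝ) ^ b := by positivity
  have hsub : {x : Fin m → Fin n → Bool | t ≤ globalStat τ k x}
      ⊆ {x | t * (k : ℝ) ^ b ≤ |(∑ j, (∑ i, spin (x j i)) ^ 2) / (m : ℝ)
        - ∫ σ, (∑ i, spin (σ i)) ^ 2 ∂(nullLaw n μ)|} := by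
    intro x hx
    have hx' : t ≤ globalStat τ k x := hx
    unfold globalStat at hx'
    rw [Real.rpow_neg hk0.le, inv_mul_eq_div, le_div_iff₀ hkb] at hx'
    show t * (k : ℝ) ^ b ≤ _
    rw [integral_sum_spin_sq_nullLaw hsymm]
    exact hx'.trans (le_abs_self _)
  calc _ ≤ _ := measureReal_mono hsub (measure_ne_top _ _)
    _ ≤ _ := sampleLaw_chebyshev (nullLaw n μ) (fun σ => (∑ i, spin (σ i)) ^ 2) hm (by positivity)
    _ ≤ _ := by
        gcongr
        exact integral_sum_spin_pow_four_nullLaw_le hsymm hn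

/-- The exponents satisfy a + b = 2, so the squared clique sum is k^b times k^a m_S². Subtracting
the k clique spins from n shifts the normalized mean by k^(1-b) = k^(a-1), hence the extra term in
the first hypothesis. -/
lemma globalStat_plantedLaw_le {μ : Measure ℝ} [IsProbabilityMeasure μ]
    (hsymm : μ.map (fun h : ℝ => -h) = μ) (θ : ℝ) {τ : ℕ} (hτ : 2 ≤ τ) {n m : ℕ}
    (S : Finset (Fin n)) (hS : 0 < S.card) (hm : 0 < m) {t d K : ℝ} (hd : 0 < d)
    (h₁ : t + d + (S.card : ℝ) ^ (1 / (2 * (τ : ℝ) - 1) - 1)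
      ≤ ∫ σ, (S.card : ℝ) ^ (1 / (2 * (τ : ℝ) - 1)) * mag S σ ^ 2 ∂(plantedLaw μ θ S))
    (h₂ : ∫ σ, ((S.card : ℝ) ^ (1 / (2 * (τ : ℝ) - 1)) * mag S σ ^ 2) ^ 2 ∂(plantedLaw μ θ S)
      ≤ K) :
    (sampleLaw m (plantedLaw μ θ S)).real {x | globalStat τ S.card x < t}
      ≤ (8 * ((S.card : ℝ) ^ ((4 * (τ : ℝ) - 3) / (2 * (τ : ℝ) - 1))) ^ 2 * K
          + 512 * (n : ℝ) ^ 2)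
        / (m * (d * (S.card : ℝ) ^ ((4 * (τ : ℝ) - 3) / (2 * (τ : ℝ) - 1))) ^ 2) := by
  have hk0 : (0 : ℝ) < S.card := by exact_mod_cast hS
  have hn : 0 < n := hS.trans_le (card_finset_fin_le S)
  set k : ℝ := (S.card : ℝ) with hk
  set a := 1 / (2 * (τ : ℝ) - 1) with ha
  set b := (4 * (τ : ℝ) - 3) / (2 * (τ : ℝ) - 1) with hb
  have hab : b + a = 2 := by
    have : (2 : ℝ) ≤ τ := by exact_mod_cast hτ
    have : 2 * (τ : ℝ) - 1 ≠ 0 := by linarith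
    rw [ha, hb, ← add_div, div_eq_iff this]; ring
  have hkb : 0 < k ^ b := by positivity
  have hkab : k ^ b * k ^ a = k ^ 2 := by
    rw [← Real.rpow_add hk0, hab, Real.rpow_two]
  have hsum : ∀ σ : Fin n → Bool, (∑ i ∈ S, spin (σ i)) ^ 2 = k ^ b * (k ^ a * mag S σ ^ 2) := by
    intro σ
    rw [← mul_assoc, hkab, mag, ← hk, ← mul_pow, mul_div_cancel₀ _ hk0.ne']
  have hmean : (t + d) * k ^ b + n ≤ ∫ σ, (∑ i, spin (σ i)) ^ 2 ∂(plantedLaw μ θ S) := by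
    rw [integral_sum_spin_sq_plantedLaw hsymm]
    simp_rw [hsum]
    rw [integral_const_mul]
    have e1 := mul_le_mul_of_nonneg_left h₁ hkb.le
    have e2 : k ^ b * k ^ (a - 1) = k := by
      rw [← Real.rpow_add hk0, show b + (a - 1) = 1 by linarith, Real.rpow_one]
    rw [mul_add, e2] at e1
    linarith
  have hsq : ∫ σ, ((∑ i, spin (σ i)) ^ 2) ^ 2 ∂(plantedLaw μ θ S)
      ≤ 8 * (k ^ b) ^ 2 * K + 512 * (n : ℝ) ^ 2 := by
    refine (integral_sum_spin_pow_four_plantedLaw_le hsymm θ S hn).trans ?_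
    have e1 : ∀ σ : Fin n → Bool,
        (∑ i ∈ S, spin (σ i)) ^ 4 = (k ^ b) ^ 2 * (k ^ a * mag S σ ^ 2) ^ 2 := by
      intro σ
      rw [← mul_pow, ← hsum, ← pow_mul]
    simp_rw [e1]
    rw [integral_const_mul, mul_assoc]
    gcongr
  have hsub : {x : Fin m → Fin n → Bool | globalStat τ S.card x < t}
      ⊆ {x | d * k ^ b ≤ |(∑ j, (∑ i, spin (x j i)) ^ 2) / (m : ℝ)
        - ∫ σ, (∑ i, spin (σ i)) ^ 2 ∂(plantedLaw μ θ S)|} := by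
    intro x hx
    have hx' : globalStat τ S.card x < t := hx
    unfold globalStat at hx'
    rw [Real.rpow_neg hk0.le, inv_mul_eq_div, div_lt_iff₀ hkb] at hx'
    show d * k ^ b ≤ _
    rw [abs_sub_comm]
    refine le_trans ?_ (le_abs_self _)
    linarith
  calc _ ≤ _ := measureReal_mono hsub (measure_ne_top _ _)
    _ ≤ _ := sampleLaw_chebyshev (plantedLaw μ θ S) (fun σ => (∑ i, spin (σ i)) ^ 2) hm
        (by positivity)
    _ ≤ _ := by gcongr

lemma global_test {μ : Measure ℝ} [IsProbabilityMeasure μ]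
    (hsymm : μ.map (fun h : ℝ => -h) = μ) (θ : ℝ) {τ : ℕ} (hτ : 2 ≤ τ) {L K₄ : ℝ} (hK₄ : 0 < K₄)
    (hlim : ∀ ε : ℝ, 0 < ε → ∃ k₀ : ℕ, ∀ (n : ℕ) (S : Finset (Fin n)), k₀ ≤ S.card →
      |(∫ σ, (S.card : ℝ) ^ (1 / (2 * (τ : ℝ) - 1)) * mag S σ ^ 2 ∂(plantedLaw μ θ S)) - L| ≤ ε)
    (hmom : ∀ (n : ℕ) (S : Finset (Fin n)), 0 < S.card →
      ∫ σ, ((S.card : ℝ) ^ (1 / (2 * (τ : ℝ) - 1)) * mag S σ ^ 2) ^ 2 ∂(plantedLaw μ θ S) ≤ K₄)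
    {t : ℝ} (ht : 0 < t) (htL : t < L) {A : ℝ} (hA : 0 < A) {δ : ℝ} (hδ : 0 < δ) :
    ∃ C : ℝ, 0 < C ∧ ∃ K : ℕ, ∀ (n m : ℕ) (S : Finset (Fin n)), K ≤ S.card →
      ((S.card : ℝ) ≤ A * (n : ℝ) ^ ((2 * (τ : ℝ) - 1) / (4 * (τ : ℝ) - 3)) ∧
          C * (n : ℝ) ^ 2 * (S.card : ℝ) ^ (-(2 * (4 * (τ : ℝ) - 3) / (2 * (τ : ℝ) - 1)))
            ≤ (m : ℝ)
        ∨ A * (n : ℝ) ^ ((2 * (τ : ℝ) - 1) / (4 * (τ : ℝ) - 3)) ≤ (S.card : ℝ) ∧ C ≤ (m : ℝ)) →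
      errorSum μ θ S (globalStat τ S.card (n := n) (m := m)) t ≤ δ := by
  set a := 1 / (2 * (τ : ℝ) - 1) with ha
  have ha1 : a < 1 := critExponent_lt_one hτ
  have hτ' : (2 : ℝ) ≤ τ := by exact_mod_cast hτ
  have hτ1 : 0 < 2 * (τ : ℝ) - 1 := by linarith
  have hτ3 : 0 < 4 * (τ : ℝ) - 3 := by linarith
  set b := (4 * (τ : ℝ) - 3) / (2 * (τ : ℝ) - 1) with hb
  have hb0 : 0 < b := div_pos hτ3 hτ1
  have hbinv : (2 * (τ : ℝ) - 1) / (4 * (τ : ℝ) - 3) = b⁻¹ := by rw [hb, inv_div]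
  rw [hbinv]
  -- One third each for the error in the limit, for the shift k^(a-1), and for the margin in
  -- Chebyshev's inequality.
  set d := (L - t) / 3 with hd
  have hd0 : 0 < d := by rw [hd]; linarith
  set c₁ := 8 * K₄ / d ^ 2 with hc₁
  set c₂ := 512 / t ^ 2 + 512 / d ^ 2 with hc₂
  have hc₁0 : 0 < c₁ := by positivity
  have hc₂0 : 0 < c₂ := by positivity
  set B := (A ^ b) ^ 2 with hB
  have hB0 : 0 < B := by positivity
  -- The total error is (c₁ + c₂ q)/m with q = n²/k^(2b). For small k one has B q ≥ 1, so the error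
  -- is at most (c₁ B + c₂) q/m; for large k one has q ≤ 1/B. This C serves both regimes.
  set C := (c₁ * (1 + B) + c₂ * (1 + B⁻¹)) / δ with hC
  have hC0 : 0 < C := by positivity
  have hCδ : δ * C = c₁ * (1 + B) + c₂ * (1 + B⁻¹) := mul_div_cancel₀ _ hδ.ne'
  obtain ⟨k₀, hk₀⟩ := hlim d hd0
  have hev : ∀ᶠ k : ℕ in atTop, 0 < k ∧ k₀ ≤ k ∧ (k : ℝ) ^ (a - 1) ≤ d := by
    refine (eventually_gt_atTop 0).and <| (eventually_ge_atTop k₀).and ?_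
    have h := (tendsto_rpow_neg_atTop (show 0 < 1 - a by linarith)).comp
      (tendsto_natCast_atTop_atTop (R := ℝ))
    rw [neg_sub] at h
    exact h.eventually_le_const hd0
  obtain ⟨K, hK⟩ := eventually_atTop.1 hev
  refine ⟨C, hC0, K, fun n m S hS hreg => ?_⟩
  obtain ⟨hkpos, hkk, hka⟩ := hK _ hS
  have hkn : S.card ≤ n := card_finset_fin_le S
  have hnpos : 0 < n := by omega
  have hk0 : (0 : ℝ) < S.card := by exact_mod_cast hkpos
  have hn0 : (0 : ℝ) < n := by exact_mod_cast hnpos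
  set k : ℝ := (S.card : ℝ) with hk
  have hkb : 0 < k ^ b := by positivity
  set q := (n : ℝ) ^ 2 / (k ^ b) ^ 2 with hq
  have hq0 : 0 < q := by positivity
  have hkey : 0 < (m : ℝ) ∧ c₁ + c₂ * q ≤ δ * m := by
    have hAn : (A * (n : ℝ) ^ b⁻¹) ^ b = A ^ b * n := by
      rw [Real.mul_rpow hA.le (by positivity), ← Real.rpow_mul hn0.le, inv_mul_cancel₀ hb0.ne',
        Real.rpow_one]
    rcases hreg with ⟨h1, h2⟩ | ⟨h1, h2⟩
    · have e1 : k ^ (-(2 * (4 * (τ : ℝ) - 3) / (2 * (τ : ℝ) - 1))) = ((k ^ b) ^ 2)⁻¹ := by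
        rw [Real.rpow_neg hk0.le, ← Real.rpow_natCast (k ^ b) 2, ← Real.rpow_mul hk0.le]
        congr 2
        rw [hb]; push_cast; ring
      rw [e1, mul_assoc, ← div_eq_mul_inv, ← hq] at h2
      have e2 : k ^ b ≤ A ^ b * n := by
        rw [← hAn]; exact Real.rpow_le_rpow hk0.le h1 hb0.le
      have e3 : 1 ≤ B * q := by
        rw [hq, mul_div_assoc', one_le_div (by positivity), hB, ← mul_pow]
        gcongr
      refine ⟨lt_of_lt_of_le (by positivity) h2, ?_⟩
      calc c₁ + c₂ * q ≤ c₁ * (B * q) + c₂ * q := by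
            gcongr; exact le_mul_of_one_le_right hc₁0.le e3
        _ ≤ c₁ * (B * q) + c₂ * q + (c₁ * q + c₂ * B⁻¹ * q) := by
            have : 0 ≤ c₁ * q + c₂ * B⁻¹ * q := by positivity
            linarith
        _ = δ * C * q := by rw [hCδ]; ring
        _ ≤ δ * m := by rw [mul_assoc]; gcongr
    · have e2 : A ^ b * n ≤ k ^ b := by
        rw [← hAn]; exact Real.rpow_le_rpow (by positivity) h1 hb0.le
      have e3 : q ≤ B⁻¹ := by
        rw [hq, div_le_iff₀ (by positivity), inv_mul_eq_div, le_div_iff₀ hB0, hB, ← mul_pow,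
          mul_comm]
        gcongr
      refine ⟨lt_of_lt_of_le hC0 h2, ?_⟩
      calc c₁ + c₂ * q ≤ c₁ + c₂ * B⁻¹ := by gcongr
        _ ≤ c₁ + c₂ * B⁻¹ + (c₁ * B + c₂) := by
            have : 0 ≤ c₁ * B + c₂ := by positivity
            linarith
        _ = δ * C := by rw [hCδ]; ring
        _ ≤ δ * m := by gcongr
  obtain ⟨hm0, hfin⟩ := hkey
  have hm : 0 < m := by exact_mod_cast hm0
  have hlow := (abs_le.1 (hk₀ n S hkk)).1
  have hI := globalStat_nullLaw_le (m := m) hsymm τ hkpos hnpos hm ht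
  have hII := globalStat_plantedLaw_le hsymm θ hτ S hkpos hm hd0 (t := t)
    (by rw [← ha, ← hk]; linarith) (hmom n S hkpos)
  rw [← hb, ← hk] at hI hII
  unfold errorSum
  calc _ ≤ 512 * (n : ℝ) ^ 2 / (m * (t * k ^ b) ^ 2)
        + (8 * (k ^ b) ^ 2 * K₄ + 512 * (n : ℝ) ^ 2) / (m * (d * k ^ b) ^ 2) := add_le_add hI hII
    _ = (c₁ + c₂ * q) / m := by
        rw [hc₁, hc₂, hq]
        field_simp
        ring
    _ ≤ δ := by rwa [div_le_iff₀ hm0]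

end RFCW

end

/-! ### Assembly: limiting moment, local test and global test -/

theorem mainTheorem5
    (μ : Measure ℝ) [IsProbabilityMeasure μ]
    (hint : Integrable (fun h : ℝ => h) μ)
    (hsymm : μ.map (fun h : ℝ => -h) = μ)
    (hnondeg : μ ≠ Measure.dirac 0)
    (θ : ℝ) (hcrit : θ = 1 / RFCW.meanSechSq μ)
    (τ : ℕ) (hflat : RFCW.HasFlatMinimum (RFCW.potential μ θ) τ) :
    -- the constant is positive and is the ratio of the two moment integrals
    (0 < RFCW.critMoment μ θ τ ∧
      (∫ x : ℝ, x ^ (2 * τ) * Real.exp (-(x ^ (4 * τ - 2)) / (2 * RFCW.critVar μ θ τ)))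
        / (∫ x : ℝ, x ^ (2 * τ - 2) * Real.exp (-(x ^ (4 * τ - 2)) / (2 * RFCW.critVar μ θ τ)))
        = RFCW.critMoment μ θ τ) ∧
    -- the limiting second moment
    (∀ ε : ℝ, 0 < ε → ∃ K : ℕ, ∀ (n k : ℕ) (S : Finset (Fin n)), K ≤ k → S.card = k →
      |(∫ σ, (k : ℝ) ^ (1 / (2 * (τ : ℝ) - 1)) * RFCW.mag S σ ^ 2 ∂(RFCW.plantedLaw μ θ S))
        - RFCW.critMoment μ θ τ| ≤ ε) ∧
    -- the local test
    (∀ t : ℝ, 0 < t → t < RFCW.critMoment μ θ τ →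
      ∃ C : ℝ, 0 < C ∧ ∀ δ : ℝ, 0 < δ → ∃ K : ℕ,
        ∀ (n k m : ℕ) (S : Finset (Fin n)), K ≤ k → S.card = k →
          C * (k : ℝ) ^ (1 / (2 * (τ : ℝ) - 1)) * Real.log (n : ℝ) ≤ (m : ℝ) →
          RFCW.errorSum μ θ S (RFCW.localStat τ k (n := n) (m := m)) t ≤ δ) ∧
    -- the global test
    (∀ t : ℝ, 0 < t → t < RFCW.critMoment μ θ τ →
      ∀ A : ℝ, 0 < A → ∀ δ : ℝ, 0 < δ → ∃ C : ℝ, 0 < C ∧ ∃ K : ℕ,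
        ∀ (n k m : ℕ) (S : Finset (Fin n)), K ≤ k → S.card = k →
          ((k : ℝ) ≤ A * (n : ℝ) ^ ((2 * (τ : ℝ) - 1) / (4 * (τ : ℝ) - 3)) ∧
              C * (n : ℝ) ^ 2 * (k : ℝ) ^ (-(2 * (4 * (τ : ℝ) - 3) / (2 * (τ : ℝ) - 1))) ≤ (m : ℝ)
            ∨ A * (n : ℝ) ^ ((2 * (τ : ℝ) - 1) / (4 * (τ : ℝ) - 3)) ≤ (k : ℝ) ∧ C ≤ (m : ℝ)) →
          RFCW.errorSum μ θ S (RFCW.globalStat τ k (n := n) (m := m)) t ≤ δ) := by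
  have hθ : 0 < θ := by rw [hcrit]; exact one_div_pos.2 (RFCW.meanSechSq_pos μ)
  have hτ := RFCW.two_le_flatness hint hsymm hcrit hflat
  -- With p = τ - 1 ≥ 1 the exponents 2τ - 1 and 4τ - 2 become 2p + 1 and 4p + 2, free of truncated
  -- subtraction.
  obtain ⟨p, rfl⟩ : ∃ p, τ = p + 1 := ⟨τ - 1, by omega⟩
  have hp : 1 ≤ p := by omega
  have hV := RFCW.critVar_pos hsymm hnondeg hcrit hflat
  have hlim : ∀ ε : ℝ, 0 < ε → ∃ k₀ : ℕ, ∀ (n : ℕ) (S : Finset (Fin n)), k₀ ≤ S.card →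
      |(∫ σ, (S.card : ℝ) ^ (1 / (2 * ((p + 1 : ℕ) : ℝ) - 1)) * RFCW.mag S σ ^ 2
        ∂(RFCW.plantedLaw μ θ S)) - RFCW.critMoment μ θ (p + 1)| ≤ ε := fun ε hε =>
    RFCW.exists_mag_second_moment_limit hint hsymm hnondeg hcrit hp hflat hε
  obtain ⟨K₄, hK₄, hmom⟩ := RFCW.exists_mag_fourth_moment_bound hint hθ hp hflat
  refine ⟨⟨RFCW.critMoment_pos (by omega) hV, RFCW.critMoment_eq_ratio (by omega) hV⟩,
    ?_, ?_, ?_⟩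
  · intro ε hε
    obtain ⟨k₀, hk₀⟩ := hlim ε hε
    refine ⟨k₀, fun n k S hk hS => ?_⟩
    subst hS
    exact hk₀ n S hk
  · intro t ht htL
    refine ⟨16 / t, by positivity, fun δ hδ => ?_⟩
    obtain ⟨K, hK⟩ := RFCW.local_test hsymm θ hτ hlim hmom ht htL hδ
    refine ⟨K, fun n k m S hk hS hm => ?_⟩
    subst hS
    exact hK n m S hk hm
  · intro t ht htL A hA δ hδ
    obtain ⟨C, hC, K, hK⟩ := RFCW.global_test hsymm θ hτ hK₄ hlim hmom ht htL hA hδ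
    refine ⟨C, hC, K, fun n k m S hk hS hm => ?_⟩
    subst hS
    exact hK n m S hk hm
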